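/- Let $r,m\ge 0$, $n=r+m$, and write $U=(U_I,U_{II})\in\mathbb R^r\times\mathbb R^m$. Consider on $0<x<1$ the system $$U_t+f(U)_x=(B(U)U_x)_x,\qquad B=\begin{pmatrix}0&0\\0&B_{22}\end{pmatrix},\qquad A(U)=df(U)=\begin{pmatrix}A_{11}&A_{12}\\A_{21}&A_{22}\end{pmatrix},$$ with boundary conditions $U(0)=U_0\in\mathbb R^n$, $U_{II}(1)=U_{1II}\in\mathbb R^m$. Assume: (H0) $f:\mathbb R^n\to\mathbb R^n$ and $B_{22}:\mathbb R^n\to M_m(\mathbb R)$ are $C^\infty$; (H1) $B_{22}(U)+B_{22}(U)^t>0$ for all $U$; (H2) all eigenvalues of $A_{11}(U)=(df_I)_I(U)$ are positive, for all $U$; (H3) (symmetrizability) there is a smooth $S(U)=\begin{pmatrix}S_{11}(U)&0\\0&S_{22}(U)\end{pmatrix}$, symmetric positive definite for all $U$, such that $S(U)A(U)$ is symmetric and $S_{22}(U)B_{22}(U)+(S_{22}(U)B_{22}(U))^t>0$ for all $U$. A steady solution with data $(U_0,U_{1II})$ is a function $\hat U\in C^2([0,1];\mathbb R^n)$ with $f(\hat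 U)_x=(B(\hat U)\hat U_x)_x$ on $(0,1)$, $\hat U(0)=U_0$, $\hat U_{II}(1)=U_{1II}$. **Theorem.** For every $U_0\in\mathbb R^n$ there is $\varepsilon_0>0$ such that for every $0<\varepsilon\le\varepsilon_0$ there is $\delta>0$ with the following property. For every $U_{1II}$ with $|U_{1II}-U_{0II}|\le\delta$ there is a steady solution $\hat U$ with data $(U_0,U_{1II})$ such that 1. (almost constant) $\sup_{[0,1]}|\hat U_x|\le\varepsilon$; 2. (local uniqueness) every steady solution $\tilde U$ with the same data and $|\tilde U_{II}'(0)|\le\varepsilon_0$ equals $\hat U$ on $[0,1]$; 3. (nondegeneracy) $C=\hat U_{II}'(0)$ is a nondegenerate root of $\Phi(U_{1II},\cdot)$. Here $\Phi(U_{1II},C)=U_{II}(1)-U_{1II}$, where $U$ is the solution on $[0,1]$ of $$B_{22}(U)U_{II}'=f_{II}(U)-f_{II}(U_0)+B_{22}(U_0)C,\qquad f_I(U)=f_I(U_0),\qquad U(0)=U_0.$$ That is, the domain of $\Phi(U_{1II},\cdot)$ is a neighbourhood of $C$, $\Phi(U_{1II},C)=0$, and $\Phi(U_{1II},\cdot)$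 is differentiable at $C$ with invertible differential; 4. (spectral stability) the spectrum of the linearized operator $$LV=\big(B(\hat U)V_x+(dB(\hat U)V)\hat U_x\big)_x-(A(\hat U)V)_x$$ on $L^2((0,1);\mathbb C^n)$, with domain $\{V: V_I\in H^1(0,1),\ V_{II}\in H^2(0,1),\ V(0)=0,\ V_{II}(1)=0\}$, is contained in $\{\lambda\in\mathbb C:\operatorname{Re}\lambda<0\}$. -/

import Mathlib

open Set Filter Topology MeasureTheory
open scoped Matrix ContDiff

noncomputable section

/-- States `U = (U_I, U_II) ∈ 𝕜^r × 𝕜^m` (with `m = n - r`): `Sum.inl` indexes the hyperbolic block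
`U_I`, `Sum.inr` the parabolic block `U_II`. -/
abbrev BlockVec (𝕜 : Type) (r m : ℕ) : Type := Fin r ⊕ Fin m → 𝕜

/-- The block `U_I`. -/
def partI {𝕜 : Type} {r m : ℕ} (U : BlockVec 𝕜 r m) : Fin r → 𝕜 := fun i => U (Sum.inl i)

/-- The block `U_II`. -/
def partII {𝕜 : Type} {r m : ℕ} (U : BlockVec 𝕜 r m) : Fin m → 𝕜 := fun i => U (Sum.inr i)

/-- The data of a system `U_t + f(U)_x = (B(U) U_x)_x` whose viscosity matrix has the block form
`B = [[0, 0], [0, B₂₂]]`. -/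
structure ViscousSystem (r m : ℕ) where
  f : BlockVec ℝ r m → BlockVec ℝ r m
  B₂₂ : BlockVec ℝ r m → Matrix (Fin m) (Fin m) ℝ

namespace ViscousSystem

variable {r m : ℕ}

/-- The viscosity matrix `B(U)`. -/
def B (s : ViscousSystem r m) (U : BlockVec ℝ r m) :
    Matrix (Fin r ⊕ Fin m) (Fin r ⊕ Fin m) ℝ :=
  Matrix.fromBlocks 0 0 0 (s.B₂₂ U)

/-- The Jacobian matrix `A(U) = df(U)`. -/
def A (s : ViscousSystem r m) (U : BlockVec ℝ r m) :
    Matrix (Fin r ⊕ Fin m) (Fin r ⊕ Fin m) ℝ :=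
  Matrix.of fun i j => fderiv ℝ s.f U (Pi.single j 1) i

/-- (H0): `f` and `B` are smooth. -/
def H0 (s : ViscousSystem r m) : Prop :=
  ContDiff ℝ ∞ s.f ∧ ∀ i j, ContDiff ℝ ∞ fun U => s.B₂₂ U i j

/-- (H1): `B₂₂(U) + B₂₂(U)ᵗ > 0` for every `U`. -/
def H1 (s : ViscousSystem r m) : Prop :=
  ∀ U, (s.B₂₂ U + (s.B₂₂ U)ᵀ).PosDef

/-- (H2): for every `U`, all (complex) eigenvalues of `A₁₁(U) = (df_I)_I(U)` are positive reals. -/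
def H2 (s : ViscousSystem r m) : Prop :=
  ∀ U, ∀ μ ∈ spectrum ℂ ((s.A U).toBlocks₁₁.map ((↑) : ℝ → ℂ)), 0 < μ.re ∧ μ.im = 0

/-- (H3), symmetrizability: there is a smooth map `S = diag(S₁₁, S₂₂)` such that for every `U`, `S(U)`
is symmetric positive definite, `S(U) A(U)` is symmetric and `S₂₂ B₂₂ + (S₂₂ B₂₂)ᵗ > 0`. -/
def H3 (s : ViscousSystem r m) : Prop :=
  ∃ (S₁₁ : BlockVec ℝ r m → Matrix (Fin r) (Fin r) ℝ)
    (S₂₂ : BlockVec ℝ r m → Matrix (Fin m) (Fin m) ℝ),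
    (∀ i j, ContDiff ℝ ∞ fun U => S₁₁ U i j) ∧
    (∀ i j, ContDiff ℝ ∞ fun U => S₂₂ U i j) ∧
    ∀ U, (Matrix.fromBlocks (S₁₁ U) 0 0 (S₂₂ U)).PosDef ∧
      (Matrix.fromBlocks (S₁₁ U) 0 0 (S₂₂ U) * s.A U).IsSymm ∧
      (S₂₂ U * s.B₂₂ U + (S₂₂ U * s.B₂₂ U)ᵀ).PosDef

/-- The derivative `W_x` on `[0,1]` (one-sided at the end points). -/
def dx {E : Type} [NormedAddCommGroup E] [NormedSpace ℝ E] (W : ℝ → E) (x : ℝ) : E :=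
  derivWithin W (Icc 0 1) x

/-- `W` is a classical solution of the steady problem
`f(W)_x = (B(W) W_x)_x` on `(0,1)`, `W(0) = U₀`, `W_II(1) = U₁`. -/
structure IsSteadySolution (s : ViscousSystem r m) (U₀ : BlockVec ℝ r m) (U₁ : Fin m → ℝ)
    (W : ℝ → BlockVec ℝ r m) : Prop where
  contDiffOn : ContDiffOn ℝ 2 W (Icc 0 1)
  left_bc : W 0 = U₀
  right_bc : partII (W 1) = U₁
  equation : ∀ x ∈ Ioo (0 : ℝ) 1,
    deriv (fun y => s.f (W y)) x = deriv (fun y => s.B (W y) *ᵥ dx W y) x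

/-- `W` solves on `[0,1]` the integrated profile problem with parameter `C` :
`B₂₂(W) W_II' = f_II(W) - f_II(U₀) + B₂₂(U₀) C`, `f_I(W) = f_I(U₀)`, `W(0) = U₀`.
Note that `W_II'(0) = C`. -/
structure IsProfile (s : ViscousSystem r m) (U₀ : BlockVec ℝ r m) (C : Fin m → ℝ)
    (W : ℝ → BlockVec ℝ r m) : Prop where
  continuousOn : ContinuousOn W (Icc 0 1)
  differentiableOn : DifferentiableOn ℝ (fun x => partII (W x)) (Icc 0 1)
  init : W 0 = U₀
  constraint : ∀ x ∈ Icc (0 : ℝ) 1, partI (s.f (W x)) = partI (s.f U₀)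
  ode : ∀ x ∈ Icc (0 : ℝ) 1,
    s.B₂₂ (W x) *ᵥ dx (fun y => partII (W y)) x =
      partII (s.f (W x)) - partII (s.f U₀) + s.B₂₂ U₀ *ᵥ C

open Classical in
/-- The mapping `Φ(U₁, C) = W_II(1) - U₁`, where `W` is the solution on `[0,1]` of the profile problem
with parameter `C`. (Under (H0)-(H2) that solution is unique if it exists; the value is `0` by
convention for those `C` whose solution does not reach `x = 1`.) -/
def Φ (s : ViscousSystem r m) (U₀ : BlockVec ℝ r m) (U₁ C : Fin m → ℝ) : Fin m → ℝ :=
  if h : ∃ W, s.IsProfile U₀ C W then partII (h.choose 1) - U₁ else 0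

/-- The steady solution `W` is nondegenerate: `C = W_II'(0)` is interior to the domain of
`Φ(U₁, ·)` and is a root of that map, at which its differential exists and is invertible. -/
def IsNondegenerate (s : ViscousSystem r m) (U₀ : BlockVec ℝ r m) (U₁ : Fin m → ℝ)
    (W : ℝ → BlockVec ℝ r m) : Prop :=
  (∀ᶠ C in 𝓝 (partII (dx W 0)), ∃ W', s.IsProfile U₀ C W') ∧
  s.Φ U₀ U₁ (partII (dx W 0)) = 0 ∧
  ∃ L : (Fin m → ℝ) ≃L[ℝ] (Fin m → ℝ),
    HasFDerivAt (s.Φ U₀ U₁) (L : (Fin m → ℝ) →L[ℝ] (Fin m → ℝ)) (partII (dx W 0))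

/-- Lebesgue measure on `(0,1)`. -/
def unitMeasure : Measure ℝ := volume.restrict (Ioo 0 1)

/-- The complex space `L²((0,1); ℂ^r × ℂ^m)`. -/
abbrev L2 (r m : ℕ) : Type := Lp (BlockVec ℂ r m) 2 unitMeasure

/-- `u` is (on `[0,1]`) the continuous representative of an `H¹(0,1)` function with weak derivative
`u' ∈ L²(0,1)`. -/
def HasH1Deriv {ι : Type} [Fintype ι] (u u' : ℝ → ι → ℂ) : Prop :=
  MemLp u' 2 unitMeasure ∧ ∀ x ∈ Icc (0 : ℝ) 1, u x = u 0 + ∫ t in (0 : ℝ)..x, u' t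

/-- The complex matrix `dB(U) V = ∑ₖ Vₖ ∂ₖB(U)`. -/
def dB (s : ViscousSystem r m) (U : BlockVec ℝ r m) (V : BlockVec ℂ r m) :
    Matrix (Fin r ⊕ Fin m) (Fin r ⊕ Fin m) ℂ :=
  Matrix.of fun i j =>
    ∑ k, V k * ((fderiv ℝ (fun U' => s.B U' i j) U (Pi.single k 1) : ℝ) : ℂ)

/-- The linearized flux `B(W) V_x + (dB(W) V) W_x - A(W) V`, with `v` for `V` and `v'` for `V_x`. -/
def linearizedFlux (s : ViscousSystem r m) (W : ℝ → BlockVec ℝ r m) (v v' : ℝ → BlockVec ℂ r m)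
    (x : ℝ) : BlockVec ℂ r m :=
  (s.B (W x)).map ((↑) : ℝ → ℂ) *ᵥ v' x + s.dB (W x) (v x) *ᵥ (fun j => ((dx W x j : ℝ) : ℂ))
    - (s.A (W x)).map ((↑) : ℝ → ℂ) *ᵥ v x

/-- The graph in `L² × L²` of the linearized operator about `W`,
`L V = (B(W) V_x + (dB(W) V) W_x)_x - (A(W) V)_x`, with domain
`{V : V_I ∈ H¹(0,1), V_II ∈ H²(0,1), V(0) = 0, V_II(1) = 0}`. -/
def linearizedGraph (s : ViscousSystem r m) (W : ℝ → BlockVec ℝ r m) : Set (L2 r m × L2 r m) :=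
  {p | ∃ (v v' g : ℝ → BlockVec ℂ r m) (w : ℝ → Fin m → ℂ),
    p.1 =ᵐ[unitMeasure] v ∧ p.2 =ᵐ[unitMeasure] g ∧
    HasH1Deriv v v' ∧ HasH1Deriv (fun x => partII (v' x)) w ∧
    v 0 = 0 ∧ partII (v 1) = 0 ∧
    HasH1Deriv (s.linearizedFlux W v v') g}

end ViscousSystem

/-- The resolvent set of the (unbounded) operator `L` with graph `T`: those `z` for which
`z - L : D(L) → X` is a bijection with a bounded inverse `R`. -/
def graphResolventSet {X : Type} [NormedAddCommGroup X] [NormedSpace ℂ X] (T : Set (X × X)) :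
    Set ℂ :=
  {z | ∃ R : X →L[ℂ] X, (∀ F, (R F, z • R F - F) ∈ T) ∧
    ∀ V G, (V, G) ∈ T → R (z • V - G) = V}

/-- The spectrum of the (unbounded) operator with graph `T`. -/
def graphSpectrum {X : Type} [NormedAddCommGroup X] [NormedSpace ℂ X] (T : Set (X × X)) : Set ℂ :=
  (graphResolventSet T)ᶜ

/-- Spectral stability of the steady state `W`: the spectrum of the linearized operator about `W`
lies in `{Re z < 0}`. -/
def ViscousSystem.IsSpectrallyStable {r m : ℕ} (s : ViscousSystem r m) (W : ℝ → BlockVec ℝ r m) :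
    Prop :=
  ∀ z ∈ graphSpectrum (s.linearizedGraph W), z.re < 0

end

/-!
Steady solutions are found by shooting, and are stable by an energy estimate.

Integrated once, the steady equation says that `f(W) - B(W) W_x` is constant. Since `A₁₁` and `B₂₂` are
invertible, this is an initial value problem for `W` with the parameter `C = W_II'(0)`
(`isProfile_iff`), whose solution for `C = 0` is the constant `U₀`. The solution depends differentiably
on `C`, by the inverse function theorem in `C([0,1])`: the linearized initial value problem is a
Volterra equation, and `1 - T` is invertible for every Volterra operator `T`
(`hasStrictFDerivAt_solutionCurve`). So the shooting map `C ↦ W_II(1)` is a local diffeomorphism at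
`C = 0` once its derivative is injective there, and then `exists_shooting` yields the existence,
uniqueness and nondegeneracy of almost constant steady solutions. Injectivity means that the
linearization at `U₀` has no solution with `V(0) = 0`, `V_II(1) = 0` and constant flux except zero.

That is one consequence of the energy inequality `IsSymmetrizer.exists_energy_inequality`. With `S` the
symmetrizer and `P = B V_x + (dB V) W_x - A V` the linearized flux, consider the density
`(1 - κ x)(V · S P + ½ V · S A V) + η x |V_II|²`. It vanishes at `x = 0`. At `x = 1`, where `V_II = 0`,
it is a negative multiple of `V · S A V ≥ 0`, as `S₁₁ A₁₁` is positive definite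
(`Matrix.PosDef.mul_posDef_of_spectrum`). Its derivative is `(1 - κ x) V · S P_x` plus a quadratic form
in `(V, V_II')`, which is positive definite at the constant `U₀` for small `η` and `κ`
(`IsSymmetrizer.exists_energyForm_const_pos`), and so for all curves that are `C¹`-close to `U₀`. Hence
`∫ c |V|² + (1 - κ x) V · S P_x ≤ 0`.

With `P_x = z V - F` and `Re z ≥ 0` the same inequality bounds `V` by `F` in `L²`
(`IsSymmetrizer.exists_resolvent_estimate`), so that `z - L` is injective with closed range. It is onto
by linear shooting (`exists_mem_linearizedGraph`): written as a first order system for `V_II` and `P`,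
the equation `(z - L) V = F` is a Volterra equation, and the boundary condition `V_II(1) = 0` is a
linear system for `P_II(0)`, with as many equations as unknowns and, by the estimate, with trivial
kernel. Therefore every `z` with `Re z ≥ 0` is in the resolvent set.
-/

noncomputable section

/-! ### Integral operators on `C([0,1], Z)` -/

section Volterra

variable {Z Y : Type*} [NormedAddCommGroup Z] [NormedAddCommGroup Y]

/-- The extension of a curve on `[0,1]` to `ℝ`, constant outside `[0,1]`. -/
abbrev extendCurve (u : C(Icc (0 : ℝ) 1, Z)) : ℝ → Z := IccExtend zero_le_one u

theorem continuous_extendCurve (u : C(Icc (0 : ℝ) 1, Z)) : Continuous (extendCurve u) :=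
  u.continuous.Icc_extend'

theorem extendCurve_coe (u : C(Icc (0 : ℝ) 1, Z)) (x : Icc (0 : ℝ) 1) :
    extendCurve u x = u x := IccExtend_val _ _ _

theorem norm_extendCurve_le (u : C(Icc (0 : ℝ) 1, Z)) (x : ℝ) : ‖extendCurve u x‖ ≤ ‖u‖ :=
  u.norm_coe_le_norm _

variable [NormedSpace ℝ Z] [NormedSpace ℝ Y]

/-- Integration from `0`, as a bounded operator on `C([0,1], Z)`. -/
def integrateCurve [CompleteSpace Z] : C(Icc (0 : ℝ) 1, Z) →L[ℝ] C(Icc (0 : ℝ) 1, Z) :=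
  LinearMap.mkContinuous
    { toFun := fun u => ⟨fun x => ∫ t in (0 : ℝ)..x, extendCurve u t,
        (intervalIntegral.continuous_primitive
          (fun a b => (continuous_extendCurve u).intervalIntegrable a b) 0).comp
          continuous_subtype_val⟩
      map_add' := fun u v => by
        ext x
        simp only [ContinuousMap.coe_mk, ContinuousMap.add_apply]
        rw [← intervalIntegral.integral_add ((continuous_extendCurve u).intervalIntegrable _ _)
          ((continuous_extendCurve v).intervalIntegrable _ _)]
        rfl
      map_smul' := fun c u => by
        ext x
        simp only [ContinuousMap.coe_mk, ContinuousMap.smul_apply, RingHom.id_apply]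
        rw [← intervalIntegral.integral_smul]
        rfl } 1 (fun u => by
      rw [ContinuousMap.norm_le _ (by positivity)]
      intro x
      have := intervalIntegral.norm_integral_le_of_norm_le_const (a := 0) (b := (x : ℝ))
        (f := extendCurve u) (C := ‖u‖) (fun t _ => norm_extendCurve_le u t)
      refine this.trans ?_
      have hx := x.2
      rw [sub_zero, abs_of_nonneg hx.1, one_mul]
      exact mul_le_of_le_one_right (norm_nonneg _) hx.2)

theorem integrateCurve_apply [CompleteSpace Z] (u : C(Icc (0 : ℝ) 1, Z)) (x : Icc (0 : ℝ) 1) :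
    integrateCurve u x = ∫ t in (0 : ℝ)..x, extendCurve u t := rfl

/-- Pointwise application of a continuous family of bounded operators to a curve. -/
def applyCurve (M : C(Icc (0 : ℝ) 1, Z →L[ℝ] Y)) :
    C(Icc (0 : ℝ) 1, Z) →L[ℝ] C(Icc (0 : ℝ) 1, Y) :=
  LinearMap.mkContinuous
    { toFun := fun u => ⟨fun x => M x (u x), M.continuous.clm_apply u.continuous⟩
      map_add' := fun u v => by ext x; simp
      map_smul' := fun c u => by ext x; simp } ‖M‖ (fun u => by
      rw [ContinuousMap.norm_le _ (by positivity)]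
      intro x
      refine ((M x).le_opNorm _).trans ?_
      gcongr
      · exact M.norm_coe_le_norm x
      · exact u.norm_coe_le_norm x)

theorem applyCurve_apply (M : C(Icc (0 : ℝ) 1, Z →L[ℝ] Y)) (u : C(Icc (0 : ℝ) 1, Z))
    (x : Icc (0 : ℝ) 1) : applyCurve M u x = M x (u x) := rfl

/-- The iterates of a Volterra operator decay factorially, so that they are eventually contractions
even though the operator itself need not be one. -/
theorem norm_volterra_pow_apply_le [CompleteSpace Z] (M : C(Icc (0 : ℝ) 1, Z →L[ℝ] Z)) (n : ℕ)
    (u : C(Icc (0 : ℝ) 1, Z)) (x : Icc (0 : ℝ) 1) :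
    ‖((integrateCurve ∘L applyCurve M) ^ n) u x‖ ≤ (‖M‖ * x) ^ n / n.factorial * ‖u‖ := by
  induction n generalizing x with
  | zero => simpa using u.norm_coe_le_norm x
  | succ n ih =>
    rw [pow_succ', mul_apply_eq_comp]
    set v := ((integrateCurve ∘L applyCurve M) ^ n) u
    change ‖∫ t in (0 : ℝ)..x, extendCurve (applyCurve M v) t‖ ≤ _
    have hx := x.2
    have key : ∀ t ∈ Ioc (0 : ℝ) x, ‖extendCurve (applyCurve M v) t‖ ≤
        ‖M‖ * ((‖M‖ * t) ^ n / n.factorial * ‖u‖) := by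
      intro t ht
      have htI : t ∈ Icc (0 : ℝ) 1 := ⟨ht.1.le, ht.2.trans hx.2⟩
      rw [extendCurve, IccExtend_of_mem _ _ htI, applyCurve_apply]
      refine ((M _).le_opNorm _).trans ?_
      gcongr
      · exact M.norm_coe_le_norm _
      · exact ih ⟨t, htI⟩
    refine (intervalIntegral.norm_integral_le_of_norm_le hx.1
      (ae_of_all _ key) (Continuous.intervalIntegrable (by fun_prop) _ _)).trans ?_
    have : ∀ t : ℝ, ‖M‖ * ((‖M‖ * t) ^ n / n.factorial * ‖u‖) =
        (‖M‖ ^ (n + 1) / n.factorial * ‖u‖) * t ^ n := by intro t; ring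
    simp only [this, intervalIntegral.integral_const_mul, integral_pow]
    rw [Nat.factorial_succ]
    push_cast
    apply le_of_eq
    have : (n.factorial : ℝ) ≠ 0 := by positivity
    field_simp
    simp
    ring

/-- `1 - T` is invertible for every Volterra operator `T`. -/
theorem isUnit_one_sub_volterra [CompleteSpace Z] (M : C(Icc (0 : ℝ) 1, Z →L[ℝ] Z)) :
    IsUnit (1 - integrateCurve ∘L applyCurve M) := by
  set T := integrateCurve ∘L applyCurve M with hT
  have hlim := FloorSemiring.tendsto_pow_div_factorial_atTop ‖M‖
  obtain ⟨n, hn⟩ := ((hlim.eventually (gt_mem_nhds zero_lt_one))).exists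
  have h1 : ‖T ^ n‖ < 1 := by
    refine lt_of_le_of_lt (ContinuousLinearMap.opNorm_le_bound _ (by positivity) fun u => ?_) hn
    rw [ContinuousMap.norm_le _ (by positivity)]
    intro x
    refine (norm_volterra_pow_apply_le M n u x).trans ?_
    have hx := x.2
    gcongr
    · exact mul_nonneg (norm_nonneg M) hx.1
    · exact mul_le_of_le_one_right (norm_nonneg M) hx.2
  have h2 : IsUnit (1 - T ^ n) := 
    isUnit_one_sub_of_norm_lt_one (R := C(Icc (0 : ℝ) 1, Z) →L[ℝ] C(Icc (0 : ℝ) 1, Z)) h1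
  have hc : Commute (1 - T) (∑ i ∈ Finset.range n, T ^ i) :=
    Commute.sum_right _ _ _ fun i _ =>
      ((Commute.one_left _).sub_left ((Commute.refl T).pow_right i))
  have h3 : (1 - T) * ∑ i ∈ Finset.range n, T ^ i = 1 - T ^ n := mul_neg_geom_sum T n
  rw [← h3] at h2
  exact (hc.isUnit_mul_iff.1 h2).1

/-- The continuous linear equivalence given by `1 - T` for a Volterra operator `T`. -/
def volterraEquiv [CompleteSpace Z] (M : C(Icc (0 : ℝ) 1, Z →L[ℝ] Z)) :
    C(Icc (0 : ℝ) 1, Z) ≃L[ℝ] C(Icc (0 : ℝ) 1, Z) :=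
  ContinuousLinearEquiv.unitsEquiv ℝ _ (isUnit_one_sub_volterra M).unit

theorem coe_volterraEquiv [CompleteSpace Z] (M : C(Icc (0 : ℝ) 1, Z →L[ℝ] Z)) :
    (volterraEquiv M : C(Icc (0 : ℝ) 1, Z) →L[ℝ] C(Icc (0 : ℝ) 1, Z)) =
      1 - integrateCurve ∘L applyCurve M := by
  ext u x
  rfl

theorem volterraEquiv_apply [CompleteSpace Z] (M : C(Icc (0 : ℝ) 1, Z →L[ℝ] Z))
    (Y : C(Icc (0 : ℝ) 1, Z)) : volterraEquiv M Y = Y - integrateCurve (applyCurve M Y) := rfl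

/-- Left composition with a `C¹` map is strictly differentiable on `C([0,1], Z)`. -/
theorem hasStrictFDerivAt_comp_curve {g : Z → Y} (hg : ContDiff ℝ 1 g)
    (u : C(Icc (0 : ℝ) 1, Z)) :
    HasStrictFDerivAt (fun v : C(Icc (0 : ℝ) 1, Z) => (⟨g, hg.continuous⟩ : C(Z, Y)).comp v)
      (applyCurve ((⟨fderiv ℝ g, hg.continuous_fderiv one_ne_zero⟩ : C(Z, Z →L[ℝ] Y)).comp u)) u := by
  refine .of_isLittleO (Asymptotics.isLittleO_iff.2 fun ε hε => ?_)
  have hK : IsCompact (range u) := isCompact_range u.continuous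
  have huc := hK.uniformContinuousAt_of_continuousAt (fderiv ℝ g)
    (fun a _ => (hg.continuous_fderiv one_ne_zero).continuousAt) (Metric.dist_mem_uniformity hε)
  obtain ⟨δ, hδ, hball⟩ := Metric.mem_uniformity_dist.1 huc
  have hn : ∀ᶠ p : C(Icc (0 : ℝ) 1, Z) × C(Icc (0 : ℝ) 1, Z) in 𝓝 (u, u),
      p.1 ∈ Metric.ball u δ ∧ p.2 ∈ Metric.ball u δ :=
    prod_mem_nhds (Metric.ball_mem_nhds u hδ) (Metric.ball_mem_nhds u hδ)
  filter_upwards [hn] with p hp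
  rw [ContinuousMap.norm_le _ (by positivity)]
  intro x
  have hx : ∀ q ∈ Metric.ball u δ, q x ∈ Metric.ball (u x) δ := fun q hq =>
    lt_of_le_of_lt (ContinuousMap.dist_apply_le_dist x) hq
  have := (convex_ball (u x) δ).norm_image_sub_le_of_norm_hasFDerivWithin_le' (f := g)
    (f' := fderiv ℝ g) (φ := fderiv ℝ g (u x)) (C := ε)
    (fun y _ => ((hg.differentiable one_ne_zero) y).hasFDerivAt.hasFDerivWithinAt)
    (fun y hy => by
      have h : dist (fderiv ℝ g (u x)) (fderiv ℝ g y) < ε :=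
        hball (a := u x) (b := y) (by rw [dist_comm]; exact hy) (mem_range_self x)
      rw [dist_comm, dist_eq_norm] at h
      exact le_of_lt h) (hx _ hp.2) (hx _ hp.1)
  refine le_trans (le_of_eq ?_) (this.trans ?_)
  · rfl
  · gcongr
    exact (p.1 - p.2).norm_coe_le_norm x

end Volterra

/-! ### Autonomous differential equations on `[0,1]` -/

section Flow

variable {E : Type*} [NormedAddCommGroup E] [NormedSpace ℝ E]

/-- The map `u ↦ u - ∫₀ˣ g(u)`, whose values at solutions of `u' = g(u)` are the constant curves. -/
def odeDefect [CompleteSpace E] {g : E → E} (hg : ContDiff ℝ 1 g) (u : C(Icc (0 : ℝ) 1, E)) :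
    C(Icc (0 : ℝ) 1, E) :=
  u - integrateCurve ((⟨g, hg.continuous⟩ : C(E, E)).comp u)

theorem hasStrictFDerivAt_odeDefect [CompleteSpace E] {g : E → E} (hg : ContDiff ℝ 1 g)
    (u : C(Icc (0 : ℝ) 1, E)) :
    HasStrictFDerivAt (odeDefect hg) (volterraEquiv
      ((⟨fderiv ℝ g, hg.continuous_fderiv one_ne_zero⟩ : C(E, E →L[ℝ] E)).comp u) :
        C(Icc (0 : ℝ) 1, E) →L[ℝ] C(Icc (0 : ℝ) 1, E)) u := by
  rw [coe_volterraEquiv]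
  exact (hasStrictFDerivAt_id u).sub
    ((integrateCurve (Z := E)).hasStrictFDerivAt.comp u (hasStrictFDerivAt_comp_curve hg u))

theorem odeDefect_eq_const_iff [CompleteSpace E] {g : E → E} (hg : ContDiff ℝ 1 g)
    (u : C(Icc (0 : ℝ) 1, E)) (a : E) :
    odeDefect hg u = ContinuousMap.const _ a ↔
      ∀ x ∈ Icc (0 : ℝ) 1, extendCurve u x = a + ∫ t in (0 : ℝ)..x, g (extendCurve u t) := by
  rw [ContinuousMap.ext_iff]
  have hcomp : ∀ t, extendCurve ((⟨g, hg.continuous⟩ : C(E, E)).comp u) t =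
      g (extendCurve u t) := fun t => rfl
  constructor
  · intro h x hx
    have := h ⟨x, hx⟩
    simp only [odeDefect, ContinuousMap.sub_apply, integrateCurve_apply, hcomp,
      ContinuousMap.const_apply] at this
    rw [extendCurve, IccExtend_of_mem _ _ hx, ← this]
    abel
  · rintro h ⟨x, hx⟩
    have := h x hx
    simp only [odeDefect, ContinuousMap.sub_apply, integrateCurve_apply, hcomp,
      ContinuousMap.const_apply]
    rw [extendCurve, IccExtend_of_mem _ _ hx] at this
    rw [this]
    abel

/-- The integral form of `u' = g(u)` on `[0,1]` implies the differential form. -/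
theorem hasDerivWithinAt_of_integral_eq [CompleteSpace E] {g : E → E} (hg : Continuous g) {a : E}
    {u : ℝ → E} (hu : Continuous u)
    (h : ∀ x ∈ Icc (0 : ℝ) 1, u x = a + ∫ t in (0 : ℝ)..x, g (u t)) {x : ℝ}
    (hx : x ∈ Icc (0 : ℝ) 1) : HasDerivWithinAt u (g (u x)) (Icc 0 1) x := by
  have h1 : HasDerivAt (fun x => a + ∫ t in (0 : ℝ)..x, g (u t)) (g (u x)) x :=
    (intervalIntegral.integral_hasDerivAt_right ((hg.comp hu).intervalIntegrable _ _)
      ((hg.comp hu).stronglyMeasurableAtFilter _ _) (hg.comp hu).continuousAt).const_add a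
  exact h1.hasDerivWithinAt.congr h (h x hx)

/-- Uniqueness for `u' = g(u)` on `[0,1]` with `g` of class `C¹`. -/
theorem ode_eqOn [FiniteDimensional ℝ E] {g : E → E} (hg : ContDiff ℝ 1 g) {u v : ℝ → E}
    (hu : ∀ x ∈ Icc (0 : ℝ) 1, HasDerivWithinAt u (g (u x)) (Icc 0 1) x)
    (hv : ∀ x ∈ Icc (0 : ℝ) 1, HasDerivWithinAt v (g (v x)) (Icc 0 1) x)
    (h0 : u 0 = v 0) : EqOn u v (Icc 0 1) := by
  have : ProperSpace E := FiniteDimensional.proper ℝ E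
  have hcu : ContinuousOn u (Icc 0 1) := fun x hx => (hu x hx).continuousWithinAt
  have hcv : ContinuousOn v (Icc 0 1) := fun x hx => (hv x hx).continuousWithinAt
  obtain ⟨R, hR⟩ := ((isCompact_Icc.image_of_continuousOn hcu).union
    (isCompact_Icc.image_of_continuousOn hcv)).isBounded.subset_closedBall 0
  obtain ⟨K, hK⟩ := (hg.contDiffOn (s := Metric.closedBall (0 : E) R)).exists_lipschitzOnWith
    one_ne_zero (convex_closedBall _ _) (isCompact_closedBall _ _)
  have hI : ∀ {w : ℝ → E}, (∀ x ∈ Icc (0 : ℝ) 1, HasDerivWithinAt w (g (w x)) (Icc 0 1) x) →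
      ∀ t ∈ Ico (0 : ℝ) 1, HasDerivWithinAt w (g (w t)) (Ici t) t := fun hw t ht =>
    (hw t (Ico_subset_Icc_self ht)).mono_of_mem_nhdsWithin
      (mem_of_superset (Icc_mem_nhdsGE ht.2) (Icc_subset_Icc_left ht.1))
  refine ODE_solution_unique_of_mem_Icc_right (v := fun _ => g) (s := fun _ => Metric.closedBall 0 R)
    (K := K) (fun t _ => hK) hcu (hI hu) (fun t ht => ?_) hcv (hI hv) (fun t ht => ?_) h0
  · exact hR (Or.inl (mem_image_of_mem _ (Ico_subset_Icc_self ht)))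
  · exact hR (Or.inr (mem_image_of_mem _ (Ico_subset_Icc_self ht)))

theorem odeDefect_eq_const_iff_hasDerivWithinAt [CompleteSpace E] {g : E → E}
    (hg : ContDiff ℝ 1 g) (u : C(Icc (0 : ℝ) 1, E)) (a : E) :
    odeDefect hg u = ContinuousMap.const _ a ↔ extendCurve u 0 = a ∧
      ∀ x ∈ Icc (0 : ℝ) 1, HasDerivWithinAt (extendCurve u) (g (extendCurve u x)) (Icc 0 1) x := by
  rw [odeDefect_eq_const_iff]
  constructor
  · intro h
    refine ⟨?_, fun x hx => ?_⟩
    · simpa using h 0 (by simp)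
    · exact hasDerivWithinAt_of_integral_eq hg.continuous (continuous_extendCurve u) h hx
  · rintro ⟨h0, h⟩ x hx
    have := intervalIntegral.integral_eq_sub_of_hasDeriv_right_of_le (a := 0) (b := x)
      (f := extendCurve u) (f' := fun t => g (extendCurve u t)) hx.1
      (continuous_extendCurve u).continuousOn (fun t ht => ?_)
      ((hg.continuous.comp (continuous_extendCurve u)).intervalIntegrable _ _)
    · rw [this, h0]; abel
    · have ht1 : t < 1 := lt_of_lt_of_le ht.2 hx.2
      exact (h t ⟨ht.1.le, ht1.le⟩).mono_of_mem_nhdsWithin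
        (mem_of_superset (Icc_mem_nhdsGT ht1) (Icc_subset_Icc_left ht.1.le))

/-- The uniqueness of solutions of an initial value problem, in terms of `odeDefect`. -/
theorem odeDefect_injective_of_const [FiniteDimensional ℝ E] [CompleteSpace E] {g : E → E}
    (hg : ContDiff ℝ 1 g) {u v : C(Icc (0 : ℝ) 1, E)} {a : E}
    (hu : odeDefect hg u = ContinuousMap.const _ a)
    (hv : odeDefect hg v = ContinuousMap.const _ a) : u = v := by
  rw [odeDefect_eq_const_iff_hasDerivWithinAt] at hu hv
  ext x
  rw [← extendCurve_coe u, ← extendCurve_coe v]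
  exact ode_eqOn hg hu.2 hv.2 (hu.1.trans hv.1.symm) x.2

/-- The solution curve of `u' = g(u)`, `u(0) = a` on `[0,1]`; it is the constant curve `0` if there
is no such solution. -/
def solutionCurve [CompleteSpace E] {g : E → E} (hg : ContDiff ℝ 1 g) (a : E) :
    C(Icc (0 : ℝ) 1, E) :=
  open Classical in
  if h : ∃ u, odeDefect hg u = ContinuousMap.const _ a then h.choose else 0

theorem solutionCurve_eq [FiniteDimensional ℝ E] [CompleteSpace E] {g : E → E}
    (hg : ContDiff ℝ 1 g) {u : C(Icc (0 : ℝ) 1, E)} {a : E}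
    (hu : odeDefect hg u = ContinuousMap.const _ a) : solutionCurve hg a = u := by
  have h : ∃ u, odeDefect hg u = ContinuousMap.const _ a := ⟨u, hu⟩
  rw [solutionCurve, dif_pos h]
  exact odeDefect_injective_of_const hg h.choose_spec hu

/-- The inclusion of `E` into `C([0,1], E)` as constant curves. -/
def constCurve : E →L[ℝ] C(Icc (0 : ℝ) 1, E) := ContinuousLinearMap.const ℝ _

/-- Differentiability of the solution in the initial value: if the solution through `a` reaches
`x = 1`, so do the solutions through nearby points, and `b ↦ solutionCurve b` is strictly
differentiable at `a`. -/
theorem hasStrictFDerivAt_solutionCurve [FiniteDimensional ℝ E] [CompleteSpace E] {g : E → E}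
    (hg : ContDiff ℝ 1 g) {u : C(Icc (0 : ℝ) 1, E)} {a : E}
    (hu : odeDefect hg u = ContinuousMap.const _ a) :
    (∀ᶠ b in 𝓝 a, odeDefect hg (solutionCurve hg b) = ContinuousMap.const _ b) ∧
    HasStrictFDerivAt (solutionCurve hg)
      (((volterraEquiv ((⟨fderiv ℝ g, hg.continuous_fderiv one_ne_zero⟩ : C(E, E →L[ℝ] E)).comp
        u)).symm : C(Icc (0 : ℝ) 1, E) →L[ℝ] C(Icc (0 : ℝ) 1, E)) ∘L constCurve) a := by
  have hN := hasStrictFDerivAt_odeDefect hg u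
  have hri := hN.eventually_right_inverse
  have hli := hN.to_localInverse
  rw [hu] at hri hli
  have hri' : ∀ᶠ b in 𝓝 a, odeDefect hg (hN.localInverse _ _ _ (constCurve b)) =
      ContinuousMap.const _ b :=
    ((constCurve (E := E)).continuous.tendsto a).eventually hri
  have hs : ∀ᶠ b in 𝓝 a, solutionCurve hg b = hN.localInverse _ _ _ (constCurve b) :=
    hri'.mono fun b hb => solutionCurve_eq hg hb
  refine ⟨?_, ?_⟩
  · filter_upwards [hri', hs] with b hb hb'
    rw [hb', hb]
  · have := HasStrictFDerivAt.comp a (g := hN.localInverse _ _ _) (f := constCurve (E := E)) hli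
      (constCurve (E := E)).hasStrictFDerivAt
    exact this.congr_of_eventuallyEq (hs.mono fun b hb => hb.symm)

end Flow

/-! ### Primitives of integrable functions on `[0,1]` -/

/-- `u` is on `[0,1]` a primitive of the integrable function `u'`. -/
def IsPrimitive {E : Type*} [NormedAddCommGroup E] [NormedSpace ℝ E] (u u' : ℝ → E) : Prop :=
  IntervalIntegrable u' volume 0 1 ∧ ∀ x ∈ Icc (0 : ℝ) 1, u x = u 0 + ∫ t in (0 : ℝ)..x, u' t

namespace IsPrimitive

variable {E F : Type*} [NormedAddCommGroup E] [NormedSpace ℝ E] [NormedAddCommGroup F]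
  [NormedSpace ℝ F] {u u' v v' : ℝ → E}

theorem intervalIntegrable (h : IsPrimitive u u') {x : ℝ} (hx : x ∈ Icc (0 : ℝ) 1) :
    IntervalIntegrable u' volume 0 x :=
  h.1.mono_set (by
    rw [uIcc_of_le hx.1, uIcc_of_le zero_le_one]; exact Icc_subset_Icc_right hx.2)

theorem integral_eq (h : IsPrimitive u u') : ∫ t in (0 : ℝ)..1, u' t = u 1 - u 0 := by
  rw [h.2 1 (by simp)]; abel

theorem congr (h : IsPrimitive u u') (hu : EqOn v u (Icc 0 1)) : IsPrimitive v u' :=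
  ⟨h.1, fun x hx => by rw [hu hx, hu (by simp), h.2 x hx]⟩

theorem add (hu : IsPrimitive u u') (hv : IsPrimitive v v') :
    IsPrimitive (fun x => u x + v x) (fun x => u' x + v' x) := by
  refine ⟨hu.1.add hv.1, fun x hx => ?_⟩
  rw [intervalIntegral.integral_add (hu.intervalIntegrable hx) (hv.intervalIntegrable hx)]
  simp only [hu.2 x hx, hv.2 x hx]
  abel

theorem clm_comp [CompleteSpace E] [CompleteSpace F] (L : E →L[ℝ] F) (hu : IsPrimitive u u') :
    IsPrimitive (fun x => L (u x)) (fun x => L (u' x)) := by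
  refine ⟨⟨L.integrable_comp hu.1.1, L.integrable_comp hu.1.2⟩, fun x hx => ?_⟩
  rw [L.intervalIntegral_comp_comm (hu.intervalIntegrable hx)]
  simp only [hu.2 x hx, map_add]

theorem const (c : E) : IsPrimitive (fun _ => c) (fun _ => (0 : E)) :=
  ⟨intervalIntegrable_const, fun x _ => by simp⟩

theorem sum {ι : Type*} (s : Finset ι) {u u' : ι → ℝ → E}
    (h : ∀ i ∈ s, IsPrimitive (u i) (u' i)) :
    IsPrimitive (fun x => ∑ i ∈ s, u i x) (fun x => ∑ i ∈ s, u' i x) := by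
  classical
  induction s using Finset.induction_on with
  | empty => simpa using const (0 : E)
  | insert a s ha ih =>
    simp only [Finset.sum_insert ha]
    exact (h a (Finset.mem_insert_self _ _)).add
      (ih fun i hi => h i (Finset.mem_insert_of_mem hi))

theorem pi_iff {ι : Type*} [Fintype ι] [CompleteSpace E] {u u' : ℝ → ι → E} :
    IsPrimitive u u' ↔ ∀ i, IsPrimitive (fun x => u x i) (fun x => u' x i) := by
  classical
  constructor
  · intro h i
    exact h.clm_comp (ContinuousLinearMap.proj (R := ℝ) (φ := fun _ : ι => E) i)
  · intro h
    have := sum Finset.univ (fun i _ => (h i).clm_comp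
      (ContinuousLinearMap.single ℝ (fun _ : ι => E) i))
    convert this using 2 with x x
    all_goals
      ext j
      simp [Finset.sum_apply, Pi.single_apply]

theorem continuousOn (h : IsPrimitive u u') : ContinuousOn u (Icc 0 1) := by
  have h1 : ContinuousOn (fun x => u 0 + ∫ t in (0 : ℝ)..x, u' t) (Icc 0 1) := by
    have := intervalIntegral.continuousOn_primitive_interval'
      (μ := volume) (b₁ := 0) (b₂ := 1) (a := 0) h.1 (by simp)
    rw [uIcc_of_le zero_le_one] at this
    exact continuousOn_const.add this
  exact h1.congr h.2

theorem of_hasDerivWithinAt [CompleteSpace E]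
    (h : ∀ x ∈ Icc (0 : ℝ) 1, HasDerivWithinAt u (u' x) (Icc 0 1) x)
    (hc : ContinuousOn u' (Icc 0 1)) : IsPrimitive u u' := by
  have hi : IntervalIntegrable u' volume 0 1 := by
    apply ContinuousOn.intervalIntegrable
    rwa [uIcc_of_le zero_le_one]
  refine ⟨hi, fun x hx => ?_⟩
  rw [intervalIntegral.integral_eq_sub_of_hasDeriv_right_of_le (f := u) hx.1
    (fun t ht => ((h t ⟨ht.1, ht.2.trans hx.2⟩).continuousWithinAt).mono
      (Icc_subset_Icc_right hx.2)) (fun t ht => ?_) (hi.mono_set ?_)]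
  · abel
  · rw [uIcc_of_le hx.1, uIcc_of_le zero_le_one]; exact Icc_subset_Icc_right hx.2
  · have ht1 : t < 1 := lt_of_lt_of_le ht.2 hx.2
    exact (h t ⟨ht.1.le, ht1.le⟩).mono_of_mem_nhdsWithin
      (mem_of_superset (Icc_mem_nhdsGT ht1) (Icc_subset_Icc_left ht.1.le))

theorem absolutelyContinuousOnInterval {u u' : ℝ → ℝ} (h : IsPrimitive u u') :
    AbsolutelyContinuousOnInterval (fun x => u 0 + ∫ t in (0 : ℝ)..x, u' t) 0 1 := by
  have h1 := h.1.absolutelyContinuousOnInterval_intervalIntegral (c := 0) (by simp)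
  have h2 : AbsolutelyContinuousOnInterval (fun _ : ℝ => u 0) 0 1 :=
    ((LipschitzWith.const (u 0)).lipschitzOnWith (s := uIcc 0 1)).absolutelyContinuousOnInterval
  exact h2.add h1

/-- The product rule, which rests on integration by parts for absolutely continuous functions. -/
theorem mul {u u' v v' : ℝ → ℝ} (hu : IsPrimitive u u') (hv : IsPrimitive v v') :
    IsPrimitive (fun x => u x * v x) (fun x => u' x * v x + u x * v' x) := by
  have hI : uIcc (0 : ℝ) 1 = Icc 0 1 := uIcc_of_le zero_le_one
  have hint : IntervalIntegrable (fun x => u' x * v x + u x * v' x) volume 0 1 :=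
    (hu.1.mul_continuousOn (by rw [hI]; exact hv.continuousOn)).add
      (hv.1.continuousOn_mul (by rw [hI]; exact hu.continuousOn))
  refine ⟨hint, fun x hx => ?_⟩
  have hsub : uIcc (0 : ℝ) x ⊆ uIcc 0 1 := by
    rw [hI, uIcc_of_le hx.1]; exact Icc_subset_Icc_right hx.2
  have key := AbsolutelyContinuousOnInterval.integral_deriv_mul_eq_sub
    (hu.absolutelyContinuousOnInterval.mono hsub) (hv.absolutelyContinuousOnInterval.mono hsub)
  simp only [intervalIntegral.integral_same, add_zero] at key
  rw [← hu.2 x hx, ← hv.2 x hx] at key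
  have h2 : ∫ t in (0 : ℝ)..x, (u' t * v t + u t * v' t) = u x * v x - u 0 * v 0 := by
    rw [← key]
    apply intervalIntegral.integral_congr_ae
    filter_upwards [hu.1.ae_hasDerivAt_integral, hv.1.ae_hasDerivAt_integral] with t htu htv ht
    have ht' : t ∈ uIcc (0 : ℝ) 1 := hsub (uIoc_subset_uIcc ht)
    have htI : t ∈ Icc (0 : ℝ) 1 := hI ▸ ht'
    rw [((htu ht' 0 (by simp)).const_add (u 0)).deriv, ((htv ht' 0 (by simp)).const_add (v 0)).deriv,
      hu.2 t htI, hv.2 t htI]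
  rw [h2]; ring

theorem dotProduct {ι : Type*} [Fintype ι] {u u' v v' : ℝ → ι → ℝ} (hu : IsPrimitive u u')
    (hv : IsPrimitive v v') :
    IsPrimitive (fun x => u x ⬝ᵥ v x) (fun x => u' x ⬝ᵥ v x + u x ⬝ᵥ v' x) := by
  have := sum Finset.univ (fun i _ => (pi_iff.1 hu i).mul (pi_iff.1 hv i))
  simpa only [_root_.dotProduct, Finset.sum_add_distrib] using this

theorem mulVec {ι κ : Type*} [Fintype ι] [Fintype κ] {M M' : ℝ → Matrix ι κ ℝ}
    {v v' : ℝ → κ → ℝ} (hM : ∀ i j, IsPrimitive (fun x => M x i j) (fun x => M' x i j))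
    (hv : IsPrimitive v v') :
    IsPrimitive (fun x => M x *ᵥ v x) (fun x => M' x *ᵥ v x + M x *ᵥ v' x) := by
  rw [pi_iff]
  intro i
  exact dotProduct (u := fun x => M x i) (u' := fun x => M' x i) (pi_iff.2 fun j => hM i j) hv

end IsPrimitive

theorem IsPrimitive.hasDerivWithinAt {E : Type*} [NormedAddCommGroup E] [NormedSpace ℝ E]
    [CompleteSpace E] {u u' : ℝ → E} (h : IsPrimitive u u') (hc : ContinuousOn u' (Icc 0 1)) {x : ℝ}
    (hx : x ∈ Icc (0 : ℝ) 1) : HasDerivWithinAt u (u' x) (Icc 0 1) x := by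
  set g : C(Icc (0 : ℝ) 1, E) := ⟨_, hc.domRestrict⟩
  have hg : ∀ t ∈ Icc (0 : ℝ) 1, extendCurve g t = u' t := fun t ht => extendCurve_coe g ⟨t, ht⟩
  have h1 : HasDerivWithinAt (fun x => u 0 + ∫ t in (0 : ℝ)..x, extendCurve g t) (u' x)
      (Icc 0 1) x := by
    rw [← hg x hx]
    exact (((continuous_extendCurve g).integral_hasStrictDerivAt 0 x).hasDerivAt.const_add
      _).hasDerivWithinAt
  have h2 : ∀ x ∈ Icc (0 : ℝ) 1, u x = u 0 + ∫ t in (0 : ℝ)..x, extendCurve g t := by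
    intro x hx
    refine (h.2 x hx).trans (congrArg _ (intervalIntegral.integral_congr fun t ht => ?_))
    rw [uIcc_of_le hx.1] at ht
    exact (hg t ⟨ht.1, ht.2.trans hx.2⟩).symm
  exact h1.congr h2 (h2 x hx)

/-! ### Positivity on compact sets -/

/-- If `f ≥ 0` on a compact set and `h > 0` wherever `f = 0`, then `f + ε h > 0` for all small
`ε > 0`. -/
theorem IsCompact.exists_pos_add_mul {X : Type*} [TopologicalSpace X] {k : Set X}
    (hk : IsCompact k) {f h : X → ℝ} (hf : Continuous f) (hh : Continuous h)
    (hf0 : ∀ x ∈ k, 0 ≤ f x) (hh0 : ∀ x ∈ k, f x = 0 → 0 < h x) :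
    ∃ ε₀ > (0 : ℝ), ∀ ε, 0 < ε → ε ≤ ε₀ → ∀ x ∈ k, 0 < f x + ε * h x := by
  have hk' : IsCompact (k ∩ {x | h x ≤ 0}) := hk.inter_right (isClosed_le hh continuous_const)
  obtain ⟨M, hM⟩ := hk.exists_bound_of_continuousOn hh.continuousOn
  rcases (k ∩ {x | h x ≤ 0}).eq_empty_or_nonempty with he | hne
  · refine ⟨1, one_pos, fun ε hε _ x hx => ?_⟩
    have : 0 < h x := by
      by_contra hc
      have : x ∈ k ∩ {x | h x ≤ 0} := ⟨hx, not_lt.1 hc⟩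
      simp [he] at this
    have := mul_pos hε this
    have := hf0 x hx
    linarith
  · obtain ⟨x₀, hx₀, hmin⟩ := hk'.exists_isMinOn hne hf.continuousOn
    have hfx₀ : 0 < f x₀ := lt_of_le_of_ne (hf0 x₀ hx₀.1)
      fun h0 => absurd (hh0 x₀ hx₀.1 h0.symm) (not_lt.2 hx₀.2)
    have hM0 : 0 ≤ M := (norm_nonneg _).trans (hM x₀ hx₀.1)
    refine ⟨f x₀ / (M + 1), by positivity, fun ε hε hε' x hx => ?_⟩
    by_cases hc : h x ≤ 0
    · have h1 : f x₀ ≤ f x := hmin ⟨hx, hc⟩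
      have h2 : -M ≤ h x := (abs_le.1 (hM x hx)).1
      have h3 : ε * (M + 1) ≤ f x₀ := (le_div_iff₀ (by positivity)).1 hε'
      nlinarith
    · have := mul_pos hε (not_le.1 hc)
      have := hf0 x hx
      linarith

/-- A continuous function positive on `{l₀} × k`, `k` compact, is bounded below by a positive
constant on `{l} × k` for all `l` near `l₀`. -/
theorem IsCompact.exists_pos_eventually_forall_lt {Λ X : Type*} [TopologicalSpace Λ]
    [TopologicalSpace X] {k : Set X} (hk : IsCompact k) {F : Λ × X → ℝ} (hF : Continuous F)
    {l₀ : Λ} (h0 : ∀ x ∈ k, 0 < F (l₀, x)) :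
    ∃ c > (0 : ℝ), ∀ᶠ l in 𝓝 l₀, ∀ x ∈ k, c < F (l, x) := by
  obtain ⟨c, hc, hck⟩ : ∃ c > (0 : ℝ), ∀ x ∈ k, c < F (l₀, x) := by
    rcases k.eq_empty_or_nonempty with he | hne
    · exact ⟨1, one_pos, by simp [he]⟩
    · obtain ⟨x₀, hx₀, hmin⟩ := hk.exists_isMinOn hne
        (f := fun x => F (l₀, x)) (by fun_prop)
      have := h0 x₀ hx₀
      exact ⟨F (l₀, x₀) / 2, by linarith, fun x hx => by
        have : F (l₀, x₀) ≤ F (l₀, x) := hmin hx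
        linarith⟩
  refine ⟨c, hc, ?_⟩
  obtain ⟨u, v, hu, -, hlu, hkv, huv⟩ := generalized_tube_lemma (isCompact_singleton (x := l₀)) hk
    (isOpen_lt continuous_const hF : IsOpen {p | c < F p}) (by
      rintro ⟨l, x⟩ ⟨rfl, hx⟩
      exact hck x hx)
  filter_upwards [hu.mem_nhds (hlu rfl)] with l hl x hx
  exact huv (mk_mem_prod hl (hkv hx))

/-! ### The block structure of the linearized flux -/

/-- The state `(0, p)`. -/
def embII {r m : ℕ} (p : Fin m → ℝ) : BlockVec ℝ r m := Sum.elim 0 p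

@[simp] theorem partII_embII {r m : ℕ} (p : Fin m → ℝ) :
    partII (embII p : BlockVec ℝ r m) = p := rfl

namespace ViscousSystem

variable {r m : ℕ}

/-- The real matrix `dB(U) V = ∑ₖ Vₖ ∂ₖB(U)`. -/
def dBReal (s : ViscousSystem r m) (U V : BlockVec ℝ r m) :
    Matrix (Fin r ⊕ Fin m) (Fin r ⊕ Fin m) ℝ :=
  Matrix.of fun i j => ∑ k, V k * fderiv ℝ (fun U' => s.B U' i j) U (Pi.single k 1)

/-- The linearized flux `B(U) q + (dB(U) V) ξ - A(U) V`, for real states. -/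
def realFlux (s : ViscousSystem r m) (U ξ V q : BlockVec ℝ r m) : BlockVec ℝ r m :=
  s.B U *ᵥ q + s.dBReal U V *ᵥ ξ - s.A U *ᵥ V

/-- A smooth block diagonal symmetrizer `S = diag(S₁₁, S₂₂)`, in the form used by the energy method:
`S A` is symmetric, `S₁₁ A₁₁` and the symmetric part of `S₂₂ B₂₂` are positive definite. The last
two properties are stated through the quadratic forms of `S A` and `S B` on states `(V_I, 0)` and
`(0, p)`. -/
structure IsSymmetrizer (s : ViscousSystem r m)
    (S : BlockVec ℝ r m → Matrix (Fin r ⊕ Fin m) (Fin r ⊕ Fin m) ℝ) : Prop where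
  contDiff : ∀ i j, ContDiff ℝ ∞ fun U => S U i j
  isSymm : ∀ U, (S U).IsSymm
  inl_inr : ∀ U i j, S U (Sum.inl i) (Sum.inr j) = 0
  nonneg : ∀ U (v : BlockVec ℝ r m), 0 ≤ v ⬝ᵥ S U *ᵥ v
  mul_isSymm : ∀ U, (S U * s.A U).IsSymm
  hyperbolic_pos : ∀ U (v : BlockVec ℝ r m), partII v = 0 → v ≠ 0 → 0 < v ⬝ᵥ (S U * s.A U) *ᵥ v
  parabolic_pos : ∀ U (p : Fin m → ℝ), p ≠ 0 →
    0 < (embII p : BlockVec ℝ r m) ⬝ᵥ S U *ᵥ (s.B U *ᵥ embII p)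

theorem B_mulVec_inl (s : ViscousSystem r m) (U q : BlockVec ℝ r m) (i : Fin r) :
    (s.B U *ᵥ q) (Sum.inl i) = 0 := by
  simp [B, Matrix.mulVec, dotProduct]

theorem B_mulVec_inr (s : ViscousSystem r m) (U q : BlockVec ℝ r m) (i : Fin m) :
    (s.B U *ᵥ q) (Sum.inr i) = (s.B₂₂ U *ᵥ partII q) i := by
  simp [B, Matrix.mulVec, dotProduct, partII]

theorem B_mulVec_embII (s : ViscousSystem r m) (U q : BlockVec ℝ r m) :
    s.B U *ᵥ embII (partII q) = s.B U *ᵥ q := by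
  ext (i | i)
  · simp [B_mulVec_inl]
  · simp [B_mulVec_inr]

theorem dBReal_inl (s : ViscousSystem r m) (U V : BlockVec ℝ r m) (i : Fin r) (j) :
    s.dBReal U V (Sum.inl i) j = 0 := by
  rcases j with j | j <;> simp [dBReal, B]

theorem dBReal_mulVec_inl (s : ViscousSystem r m) (U V ξ : BlockVec ℝ r m) (i : Fin r) :
    (s.dBReal U V *ᵥ ξ) (Sum.inl i) = 0 := by
  simp [Matrix.mulVec, dotProduct, dBReal_inl]

theorem H0.contDiff_B {s : ViscousSystem r m} (h : s.H0) (i j) :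
    ContDiff ℝ ∞ fun U => s.B U i j := by
  rcases i with i | i <;> rcases j with j | j <;> simp only [B, Matrix.fromBlocks_apply₁₁,
    Matrix.fromBlocks_apply₁₂, Matrix.fromBlocks_apply₂₁, Matrix.fromBlocks_apply₂₂,
    Matrix.zero_apply] <;> first | exact contDiff_const | exact h.2 i j

theorem H0.contDiff_A {s : ViscousSystem r m} (h : s.H0) (i j) :
    ContDiff ℝ ∞ fun U => s.A U i j := by
  have h1 : ContDiff ℝ ∞ (fun U => fderiv ℝ s.f U (Pi.single j 1)) :=
    (h.1.fderiv_right (m := ∞) (by simp)).clm_apply contDiff_const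
  exact contDiff_pi.1 h1 i

theorem A_mulVec {s : ViscousSystem r m} (U V : BlockVec ℝ r m) :
    s.A U *ᵥ V = fderiv ℝ s.f U V := by
  have : V = ∑ j, V j • (Pi.single j (1 : ℝ) : BlockVec ℝ r m) := by
    ext i; simp [Finset.sum_apply, Pi.single_apply]
  conv_rhs => rw [this]
  ext i
  simp only [map_sum, map_smul, A, Matrix.mulVec, dotProduct, Matrix.of_apply, Finset.sum_apply,
    Pi.smul_apply, smul_eq_mul]
  exact Finset.sum_congr rfl fun j _ => mul_comm _ _

/-- Only the second blocks of `v` and `w` matter for `v · S w` if the first block of `w` is zero. -/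
theorem IsSymmetrizer.dotProduct_of_partI_eq_zero {s : ViscousSystem r m}
    {S : BlockVec ℝ r m → Matrix (Fin r ⊕ Fin m) (Fin r ⊕ Fin m) ℝ} (hS : s.IsSymmetrizer S)
    (U v w : BlockVec ℝ r m) (hw : ∀ i, w (Sum.inl i) = 0) :
    v ⬝ᵥ S U *ᵥ w = (embII (partII v) : BlockVec ℝ r m) ⬝ᵥ S U *ᵥ w := by
  simp [dotProduct, Matrix.mulVec, hw, hS.inl_inr, embII, partII]

theorem IsSymmetrizer.dotProduct_comm {s : ViscousSystem r m}
    {S : BlockVec ℝ r m → Matrix (Fin r ⊕ Fin m) (Fin r ⊕ Fin m) ℝ} (hS : s.IsSymmetrizer S)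
    (U v w : BlockVec ℝ r m) : v ⬝ᵥ S U *ᵥ w = w ⬝ᵥ S U *ᵥ v := by
  rw [Matrix.dotProduct_mulVec, ← Matrix.mulVec_transpose, (hS.isSymm U).eq, _root_.dotProduct_comm]
end ViscousSystem

/-! ### The weighted energy form -/

namespace ViscousSystem

variable {r m : ℕ}

/-- The entrywise derivative of a matrix valued function `S` at `U` in the direction `ξ`. -/
def dMat (S : BlockVec ℝ r m → Matrix (Fin r ⊕ Fin m) (Fin r ⊕ Fin m) ℝ) (U ξ : BlockVec ℝ r m) :
    Matrix (Fin r ⊕ Fin m) (Fin r ⊕ Fin m) ℝ :=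
  Matrix.of fun i j => fderiv ℝ (fun U' => S U' i j) U ξ

/-- The quadratic form in `(V, p)`, `p = V_II'`, which is the derivative of the energy density
`(1 - κ x)(V · S P + ½ V · S A V) + η x |V_II|²` along a solution of the linearized equation, up
to the term `(1 - κ x) V · S P'`; here `P` is the linearized flux and `U`, `ξ` stand for the steady
state and its derivative at `x`. -/
def energyForm (s : ViscousSystem r m)
    (S : BlockVec ℝ r m → Matrix (Fin r ⊕ Fin m) (Fin r ⊕ Fin m) ℝ) (κ η x : ℝ)
    (U ξ V : BlockVec ℝ r m) (p : Fin m → ℝ) : ℝ :=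
  (1 - κ * x) * ((embII p : BlockVec ℝ r m) ⬝ᵥ S U *ᵥ (s.B U *ᵥ embII p + s.dBReal U V *ᵥ ξ)
      + V ⬝ᵥ dMat S U ξ *ᵥ s.realFlux U ξ V (embII p)
      + 1 / 2 * (V ⬝ᵥ dMat (fun U => S U * s.A U) U ξ *ᵥ V))
    - κ * (V ⬝ᵥ S U *ᵥ s.realFlux U ξ V (embII p) + 1 / 2 * (V ⬝ᵥ (S U * s.A U) *ᵥ V))
    + η * (partII V ⬝ᵥ partII V + 2 * x * (partII V ⬝ᵥ p))

theorem IsSymmetrizer.contDiff_mul {s : ViscousSystem r m} (h : s.H0)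
    {S : BlockVec ℝ r m → Matrix (Fin r ⊕ Fin m) (Fin r ⊕ Fin m) ℝ} (hS : s.IsSymmetrizer S) (i j) :
    ContDiff ℝ ∞ fun U => (S U * s.A U) i j := by
  simp only [Matrix.mul_apply]
  exact ContDiff.sum fun k _ => (hS.contDiff i k).mul (h.contDiff_A k j)

theorem continuous_dMat {S : BlockVec ℝ r m → Matrix (Fin r ⊕ Fin m) (Fin r ⊕ Fin m) ℝ}
    (hS : ∀ i j, ContDiff ℝ ∞ fun U => S U i j) :
    Continuous fun q : BlockVec ℝ r m × BlockVec ℝ r m => dMat S q.1 q.2 := by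
  refine continuous_matrix fun i j => ?_
  exact (((hS i j).continuous_fderiv (by simp)).comp continuous_fst).clm_apply continuous_snd

theorem continuous_dBReal {s : ViscousSystem r m} (h : s.H0) :
    Continuous fun q : BlockVec ℝ r m × BlockVec ℝ r m => s.dBReal q.1 q.2 := by
  refine continuous_matrix fun i j => ?_
  simp only [dBReal, Matrix.of_apply]
  have := (h.contDiff_B i j).continuous_fderiv (by simp)
  fun_prop

theorem continuous_embII : Continuous (embII : (Fin m → ℝ) → BlockVec ℝ r m) := by
  refine continuous_pi fun i => ?_
  rcases i with i | i
  · exact continuous_const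
  · exact continuous_apply i

theorem continuous_partII : Continuous (partII : BlockVec ℝ r m → Fin m → ℝ) := by
  unfold partII
  fun_prop

theorem continuous_realFlux {s : ViscousSystem r m} (h : s.H0) {X : Type*} [TopologicalSpace X]
    {U ξ V q : X → BlockVec ℝ r m} (hU : Continuous U) (hξ : Continuous ξ) (hV : Continuous V)
    (hq : Continuous q) : Continuous fun x => s.realFlux (U x) (ξ x) (V x) (q x) := by
  have hB : Continuous s.B := continuous_matrix fun i j => (h.contDiff_B i j).continuous
  have hA : Continuous s.A := continuous_matrix fun i j => (h.contDiff_A i j).continuous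
  have hd : Continuous fun x => s.dBReal (U x) (V x) :=
    (continuous_dBReal h).comp (hU.prodMk hV)
  exact (((hB.comp hU).matrix_mulVec hq).add (hd.matrix_mulVec hξ)).sub
    ((hA.comp hU).matrix_mulVec hV)

theorem continuous_energyForm {s : ViscousSystem r m} (h : s.H0)
    {S : BlockVec ℝ r m → Matrix (Fin r ⊕ Fin m) (Fin r ⊕ Fin m) ℝ} (hS : s.IsSymmetrizer S)
    (κ η : ℝ) {X : Type*} [TopologicalSpace X] {x : X → ℝ} {U ξ V : X → BlockVec ℝ r m}
    {p : X → Fin m → ℝ} (hx : Continuous x) (hU : Continuous U) (hξ : Continuous ξ)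
    (hV : Continuous V) (hp : Continuous p) :
    Continuous fun a => s.energyForm S κ η (x a) (U a) (ξ a) (V a) (p a) := by
  have hB : Continuous fun a => s.B (U a) :=
    (continuous_matrix fun i j => (h.contDiff_B i j).continuous).comp hU
  have hSc : Continuous fun a => S (U a) :=
    (continuous_matrix fun i j => (hS.contDiff i j).continuous : Continuous S).comp hU
  have hH : Continuous fun a => S (U a) * s.A (U a) :=
    (continuous_matrix fun i j => (hS.contDiff_mul h i j).continuous :
      Continuous fun U => S U * s.A U).comp hU
  have hdS : Continuous fun a => dMat S (U a) (ξ a) :=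
    (continuous_dMat hS.contDiff).comp (hU.prodMk hξ)
  have hdH : Continuous fun a => dMat (fun U => S U * s.A U) (U a) (ξ a) :=
    (continuous_dMat (hS.contDiff_mul h)).comp (hU.prodMk hξ)
  have hd : Continuous fun a => s.dBReal (U a) (V a) :=
    (continuous_dBReal h).comp (hU.prodMk hV)
  have he : Continuous fun a => (embII (p a) : BlockVec ℝ r m) := continuous_embII.comp hp
  have hF := continuous_realFlux h hU hξ hV he
  have hV2 : Continuous fun a => partII (V a) := continuous_partII.comp hV
  have dm : ∀ {v w : X → BlockVec ℝ r m} {M : X → Matrix (Fin r ⊕ Fin m) (Fin r ⊕ Fin m) ℝ},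
      Continuous v → Continuous M → Continuous w → Continuous fun a => v a ⬝ᵥ M a *ᵥ w a :=
    fun hv hM hw => hv.dotProduct (hM.matrix_mulVec hw)
  have h1 := dm he hSc ((hB.matrix_mulVec he).add (hd.matrix_mulVec hξ))
  have h2 := dm hV hdS hF
  have h3 := dm hV hdH hV
  have h4 := dm hV hSc hF
  have h5 := dm hV hH hV
  have h6 := hV2.dotProduct hV2
  have h7 := hV2.dotProduct hp
  exact (((continuous_const.sub (continuous_const.mul hx)).mul
    ((h1.add h2).add (continuous_const.mul h3))).sub
    (continuous_const.mul (h4.add (continuous_const.mul h5)))).add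
    (continuous_const.mul (h6.add ((continuous_const.mul hx).mul h7)))

theorem embII_smul (t : ℝ) (p : Fin m → ℝ) :
    (embII (t • p) : BlockVec ℝ r m) = t • embII p := by
  ext (i | i) <;> simp [embII]

theorem partII_smul (t : ℝ) (V : BlockVec ℝ r m) : partII (t • V) = t • partII V := rfl

theorem dBReal_smul (s : ViscousSystem r m) (t : ℝ) (U V : BlockVec ℝ r m) :
    s.dBReal U (t • V) = t • s.dBReal U V := by
  ext i j
  simp only [dBReal, Matrix.of_apply, Matrix.smul_apply, Pi.smul_apply, smul_eq_mul,
    Finset.mul_sum, mul_assoc]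

theorem realFlux_smul (s : ViscousSystem r m) (t : ℝ) (U ξ V q : BlockVec ℝ r m) :
    s.realFlux U ξ (t • V) (t • q) = t • s.realFlux U ξ V q := by
  simp only [realFlux, Matrix.mulVec_smul, dBReal_smul, Matrix.smul_mulVec, smul_add, smul_sub]

theorem energyForm_smul (s : ViscousSystem r m)
    (S : BlockVec ℝ r m → Matrix (Fin r ⊕ Fin m) (Fin r ⊕ Fin m) ℝ) (κ η x t : ℝ)
    (U ξ V : BlockVec ℝ r m) (p : Fin m → ℝ) :
    s.energyForm S κ η x U ξ (t • V) (t • p) = t ^ 2 * s.energyForm S κ η x U ξ V p := by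
  simp only [energyForm, embII_smul, realFlux_smul, partII_smul, dBReal_smul, Matrix.mulVec_smul,
    Matrix.smul_mulVec, ← smul_add, smul_dotProduct, dotProduct_smul, smul_eq_mul]
  ring

theorem dMat_zero (S : BlockVec ℝ r m → Matrix (Fin r ⊕ Fin m) (Fin r ⊕ Fin m) ℝ)
    (U : BlockVec ℝ r m) : dMat S U 0 = 0 := by
  ext i j
  simp [dMat]

/-- The energy form at a constant state. -/
theorem energyForm_const (s : ViscousSystem r m)
    (S : BlockVec ℝ r m → Matrix (Fin r ⊕ Fin m) (Fin r ⊕ Fin m) ℝ) (κ η x : ℝ)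
    (U V : BlockVec ℝ r m) (p : Fin m → ℝ) :
    s.energyForm S κ η x U 0 V p =
      ((embII p : BlockVec ℝ r m) ⬝ᵥ S U *ᵥ (s.B U *ᵥ embII p) +
        η * (partII V ⬝ᵥ partII V + 2 * x * (partII V ⬝ᵥ p))) +
      κ * (1 / 2 * (V ⬝ᵥ (S U * s.A U) *ᵥ V) - V ⬝ᵥ S U *ᵥ (s.B U *ᵥ embII p) -
        x * ((embII p : BlockVec ℝ r m) ⬝ᵥ S U *ᵥ (s.B U *ᵥ embII p))) := by
  simp only [energyForm, dMat_zero, Matrix.zero_mulVec, Matrix.zero_mul, realFlux,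
    Matrix.mulVec_zero, add_zero, Matrix.mulVec_sub, Matrix.mulVec_mulVec, dotProduct_sub, dotProduct_zero, mul_zero]
  ring

/-- For suitable weights the energy form at a constant state is positive definite: the viscosity
controls `p`, the weight `η x` adds control of `V_II`, and the decreasing weight `1 - κ x` adds
control of `V_I`, because `S A` is positive on the states with `V_II = 0`. Both weights are taken
small, so that their indefinite cross terms are absorbed by what is already controlled. -/
theorem IsSymmetrizer.exists_energyForm_const_pos {s : ViscousSystem r m}
    {S : BlockVec ℝ r m → Matrix (Fin r ⊕ Fin m) (Fin r ⊕ Fin m) ℝ} (hS : s.IsSymmetrizer S)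
    (U₀ : BlockVec ℝ r m) :
    ∃ κ η : ℝ, 0 < κ ∧ κ < 1 ∧ ∀ x ∈ Icc (0 : ℝ) 1, ∀ (V : BlockVec ℝ r m) (p : Fin m → ℝ),
      ‖(V, p)‖ = 1 → 0 < s.energyForm S κ η x U₀ 0 V p := by
  have hpar : ∀ p : Fin m → ℝ, 0 ≤ (embII p : BlockVec ℝ r m) ⬝ᵥ S U₀ *ᵥ (s.B U₀ *ᵥ embII p) := by
    intro p
    by_cases hp : p = 0
    · subst hp
      have : (embII (0 : Fin m → ℝ) : BlockVec ℝ r m) = 0 := by ext (i | i) <;> rfl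
      simp [this]
    · exact (hS.parabolic_pos U₀ p hp).le
  have hemb : Continuous (embII : (Fin m → ℝ) → BlockVec ℝ r m) := continuous_embII
  have hpII : Continuous (partII : BlockVec ℝ r m → Fin m → ℝ) := continuous_partII
  -- The weight `η`, chosen on the sphere of pairs `(V_II, p)`.
  obtain ⟨η, hη, hηpos⟩ := (((isCompact_Icc (a := (0 : ℝ)) (b := 1)).prod
    (isCompact_sphere (0 : (Fin m → ℝ) × (Fin m → ℝ)) 1)).exists_pos_add_mul
    (f := fun q => (embII q.2.2 : BlockVec ℝ r m) ⬝ᵥ S U₀ *ᵥ (s.B U₀ *ᵥ embII q.2.2))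
    (h := fun q => q.2.1 ⬝ᵥ q.2.1 + 2 * q.1 * (q.2.1 ⬝ᵥ q.2.2))
    (by fun_prop) (by fun_prop) (fun q _ => hpar _) (by
      rintro ⟨x, v, p⟩ ⟨-, hvp⟩ h0
      have hp : p = 0 := by
        by_contra hp
        exact absurd h0 (hS.parabolic_pos U₀ p hp).ne'
      subst hp
      have hv : v ≠ 0 := by
        rintro rfl
        simp at hvp
      have : v ⬝ᵥ v ≠ 0 := fun h => hv (dotProduct_self_eq_zero.1 h)
      have h2 : 0 ≤ v ⬝ᵥ v := Finset.sum_nonneg fun i _ => mul_self_nonneg _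
      simpa using lt_of_le_of_ne h2 this.symm))
  have hηpos' : ∀ x ∈ Icc (0 : ℝ) 1, ∀ v p : Fin m → ℝ, (v, p) ≠ 0 →
      0 < (embII p : BlockVec ℝ r m) ⬝ᵥ S U₀ *ᵥ (s.B U₀ *ᵥ embII p) +
        η * (v ⬝ᵥ v + 2 * x * (v ⬝ᵥ p)) := by
    intro x hx v p hvp
    have hn : 0 < ‖(v, p)‖ := norm_pos_iff.2 hvp
    have := hηpos η hη le_rfl (x, ‖(v, p)‖⁻¹ • (v, p)) ⟨hx, by
      rw [mem_sphere_zero_iff_norm, norm_smul, norm_inv, norm_norm, inv_mul_cancel₀ hn.ne']⟩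
    simp only [Prod.smul_mk, embII_smul, Matrix.mulVec_smul, smul_dotProduct, dotProduct_smul,
      smul_eq_mul] at this
    have h2 : 0 < ‖(v, p)‖⁻¹ ^ 2 := by positivity
    refine pos_of_mul_pos_right (lt_of_lt_of_eq this ?_) h2.le
    ring
  -- The weight `κ`, chosen on the sphere of pairs `(V, p)`.
  obtain ⟨κ, hκ, hκpos⟩ := (((isCompact_Icc (a := (0 : ℝ)) (b := 1)).prod
    (isCompact_sphere (0 : BlockVec ℝ r m × (Fin m → ℝ)) 1)).exists_pos_add_mul
    (f := fun q => (embII q.2.2 : BlockVec ℝ r m) ⬝ᵥ S U₀ *ᵥ (s.B U₀ *ᵥ embII q.2.2) +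
        η * (partII q.2.1 ⬝ᵥ partII q.2.1 + 2 * q.1 * (partII q.2.1 ⬝ᵥ q.2.2)))
    (h := fun q => 1 / 2 * (q.2.1 ⬝ᵥ (S U₀ * s.A U₀) *ᵥ q.2.1)
        - q.2.1 ⬝ᵥ S U₀ *ᵥ (s.B U₀ *ᵥ embII q.2.2) -
        q.1 * ((embII q.2.2 : BlockVec ℝ r m) ⬝ᵥ S U₀ *ᵥ (s.B U₀ *ᵥ embII q.2.2)))
    (by fun_prop) (by fun_prop) (by
      rintro ⟨x, V, p⟩ ⟨hx, -⟩
      by_cases hvp : (partII V, p) = 0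
      · obtain ⟨hv, rfl⟩ := Prod.mk_eq_zero.1 hvp
        simpa [hv] using hpar 0
      · exact (hηpos' x hx _ _ hvp).le) (by
      rintro ⟨x, V, p⟩ ⟨hx, hVp⟩ h0
      have hvp : (partII V, p) = 0 := by
        by_contra hvp
        exact absurd h0 (hηpos' x hx _ _ hvp).ne'
      obtain ⟨hv, rfl⟩ := Prod.mk_eq_zero.1 hvp
      have hV : V ≠ 0 := by
        rintro rfl
        simp at hVp
      have he : (embII (0 : Fin m → ℝ) : BlockVec ℝ r m) = 0 := by ext (i | i) <;> rfl
      have := hS.hyperbolic_pos U₀ V hv hV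
      simp only [he, Matrix.mulVec_zero, dotProduct_zero]
      linarith))
  refine ⟨min κ (1 / 2), η, by positivity, by
    exact lt_of_le_of_lt (min_le_right _ _) (by norm_num), fun x hx V p hVp => ?_⟩
  rw [energyForm_const]
  exact hκpos _ (by positivity) (min_le_left _ _) (x, V, p)
    ⟨hx, by rw [mem_sphere_zero_iff_norm]; exact hVp⟩

/-- The energy form is uniformly positive definite near a constant state, by compactness of the unit
sphere and homogeneity. -/
theorem IsSymmetrizer.exists_energyForm_lower_bound {s : ViscousSystem r m} (h : s.H0)
    {S : BlockVec ℝ r m → Matrix (Fin r ⊕ Fin m) (Fin r ⊕ Fin m) ℝ} (hS : s.IsSymmetrizer S)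
    (U₀ : BlockVec ℝ r m) :
    ∃ κ η c ρ : ℝ, 0 < κ ∧ κ < 1 ∧ 0 < c ∧ 0 < ρ ∧ ∀ x ∈ Icc (0 : ℝ) 1, ∀ U ξ : BlockVec ℝ r m,
      ‖U - U₀‖ ≤ ρ → ‖ξ‖ ≤ ρ → ∀ (V : BlockVec ℝ r m) (p : Fin m → ℝ),
        c * ‖(V, p)‖ ^ 2 ≤ s.energyForm S κ η x U ξ V p := by
  obtain ⟨κ, η, hκ, hκ1, hpos⟩ := hS.exists_energyForm_const_pos U₀
  obtain ⟨c, hc, hev⟩ := (((isCompact_Icc (a := (0 : ℝ)) (b := 1)).prod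
    (isCompact_sphere (0 : BlockVec ℝ r m × (Fin m → ℝ)) 1)).exists_pos_eventually_forall_lt
    (Λ := BlockVec ℝ r m × BlockVec ℝ r m) (l₀ := (U₀, 0))
    (F := fun q => s.energyForm S κ η q.2.1 q.1.1 q.1.2 q.2.2.1 q.2.2.2)
    (continuous_energyForm h hS κ η (by fun_prop) (by fun_prop) (by fun_prop) (by fun_prop)
      (by fun_prop)) (by
      rintro ⟨x, V, p⟩ ⟨hx, hVp⟩
      exact hpos x hx V p (by rwa [mem_sphere_zero_iff_norm] at hVp)))
  obtain ⟨ρ, hρ, hball⟩ := Metric.nhds_basis_closedBall.eventually_iff.1 hev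
  refine ⟨κ, η, c, ρ, hκ, hκ1, hc, hρ, fun x hx U ξ hU hξ V p => ?_⟩
  by_cases hVp : (V, p) = 0
  · obtain ⟨rfl, rfl⟩ := Prod.mk_eq_zero.1 hVp
    have := energyForm_smul s S κ η x 0 U ξ 0 0
    simp only [smul_zero] at this
    rw [this]
    simp
  · have hn : 0 < ‖(V, p)‖ := norm_pos_iff.2 hVp
    have := hball (x := (U, ξ)) (by
      rw [mem_closedBall_iff_norm, Prod.mk_sub_mk, sub_zero]
      exact max_le hU hξ) (x, ‖(V, p)‖⁻¹ • (V, p)) ⟨hx, by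
      rw [mem_sphere_zero_iff_norm, norm_smul, norm_inv, norm_norm, inv_mul_cancel₀ hn.ne']⟩
    simp only [Prod.smul_mk, energyForm_smul] at this
    rw [inv_pow, ← div_eq_inv_mul, lt_div_iff₀ (by positivity)] at this
    exact this.le

end ViscousSystem

/-! ### The energy inequality -/

namespace ViscousSystem

variable {r m : ℕ}

theorem hasDerivWithinAt_dx {E : Type} [NormedAddCommGroup E] [NormedSpace ℝ E] {W : ℝ → E}
    {n : WithTop ℕ∞} (hW : ContDiffOn ℝ n W (Icc 0 1)) (hn : n ≠ 0) {x : ℝ}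
    (hx : x ∈ Icc (0 : ℝ) 1) : HasDerivWithinAt W (dx W x) (Icc 0 1) x :=
  ((hW.differentiableOn hn) x hx).hasDerivWithinAt

theorem continuousOn_dx {E : Type} [NormedAddCommGroup E] [NormedSpace ℝ E] {W : ℝ → E}
    {n : WithTop ℕ∞} (hW : ContDiffOn ℝ n W (Icc 0 1)) (hn : 1 ≤ n) :
    ContinuousOn (dx W) (Icc 0 1) :=
  hW.continuousOn_derivWithin (uniqueDiffOn_Icc zero_lt_one) hn

/-- Smooth functions of a `C¹` curve are primitives. -/
theorem isPrimitive_comp {F : BlockVec ℝ r m → ℝ} (hF : ContDiff ℝ ∞ F) {W : ℝ → BlockVec ℝ r m}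
    (hW : ContDiffOn ℝ 1 W (Icc 0 1)) :
    IsPrimitive (fun x => F (W x)) (fun x => fderiv ℝ F (W x) (dx W x)) := by
  refine IsPrimitive.of_hasDerivWithinAt (fun x hx => ?_) ?_
  · exact ((hF.differentiable (by simp)) (W x)).hasFDerivAt.comp_hasDerivWithinAt x
      (hasDerivWithinAt_dx hW one_ne_zero hx)
  · exact ((hF.continuous_fderiv (by simp)).comp_continuousOn hW.continuousOn).clm_apply
      (continuousOn_dx hW le_rfl)

/-- The energy form is the derivative of the energy density: the right hand side is what the product
rule gives for it when `V'` is the derivative of `V` and `g` that of the linearized flux. -/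
theorem IsSymmetrizer.energyForm_add_eq {s : ViscousSystem r m}
    {S : BlockVec ℝ r m → Matrix (Fin r ⊕ Fin m) (Fin r ⊕ Fin m) ℝ} (hS : s.IsSymmetrizer S)
    (κ η x : ℝ) (U ξ V V' g : BlockVec ℝ r m) :
    s.energyForm S κ η x U ξ V (partII V') + (1 - κ * x) * (V ⬝ᵥ S U *ᵥ g) =
      (-κ * (V ⬝ᵥ S U *ᵥ s.realFlux U ξ V V' + 1 / 2 * (V ⬝ᵥ (S U * s.A U) *ᵥ V)) +
        (1 - κ * x) * ((V' ⬝ᵥ S U *ᵥ s.realFlux U ξ V V' +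
          V ⬝ᵥ (dMat S U ξ *ᵥ s.realFlux U ξ V V' + S U *ᵥ g)) +
          1 / 2 * (V' ⬝ᵥ (S U * s.A U) *ᵥ V +
            V ⬝ᵥ (dMat (fun U => S U * s.A U) U ξ *ᵥ V + (S U * s.A U) *ᵥ V')))) +
      (η * (partII V ⬝ᵥ partII V) +
        η * x * (partII V' ⬝ᵥ partII V + partII V ⬝ᵥ partII V')) := by
  have hflux : s.realFlux U ξ V (embII (partII V')) = s.realFlux U ξ V V' := by
    simp only [realFlux, B_mulVec_embII]
  have h1 : (embII (partII V') : BlockVec ℝ r m) ⬝ᵥ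
      S U *ᵥ (s.B U *ᵥ embII (partII V') + s.dBReal U V *ᵥ ξ) =
      V' ⬝ᵥ S U *ᵥ s.realFlux U ξ V V' + V' ⬝ᵥ (S U * s.A U) *ᵥ V := by
    rw [B_mulVec_embII, ← hS.dotProduct_of_partI_eq_zero U V' _ (fun i => by
      simp [B_mulVec_inl, dBReal_mulVec_inl]), realFlux, Matrix.mulVec_sub, dotProduct_sub,
      Matrix.mulVec_mulVec]
    ring
  have h2 : V ⬝ᵥ (S U * s.A U) *ᵥ V' = V' ⬝ᵥ (S U * s.A U) *ᵥ V := by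
    rw [Matrix.dotProduct_mulVec, ← Matrix.mulVec_transpose, (hS.mul_isSymm U).eq,
      _root_.dotProduct_comm]
  have h3 : partII V ⬝ᵥ partII V' = partII V' ⬝ᵥ partII V := _root_.dotProduct_comm _ _
  simp only [energyForm, hflux, h1, dotProduct_add, h2, h3]
  ring

/-- At the right end point, where `V_II = 0`, the energy density is nonpositive. -/
theorem IsSymmetrizer.boundary_nonpos {s : ViscousSystem r m}
    {S : BlockVec ℝ r m → Matrix (Fin r ⊕ Fin m) (Fin r ⊕ Fin m) ℝ} (hS : s.IsSymmetrizer S)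
    (U ξ V V' : BlockVec ℝ r m) (hV : partII V = 0) :
    V ⬝ᵥ S U *ᵥ s.realFlux U ξ V V' + 1 / 2 * (V ⬝ᵥ (S U * s.A U) *ᵥ V) ≤ 0 := by
  have he : (embII (0 : Fin m → ℝ) : BlockVec ℝ r m) = 0 := by ext (i | i) <;> rfl
  have h1 : V ⬝ᵥ S U *ᵥ s.realFlux U ξ V V' = -(V ⬝ᵥ (S U * s.A U) *ᵥ V) := by
    rw [realFlux, Matrix.mulVec_sub, dotProduct_sub, Matrix.mulVec_mulVec,
      hS.dotProduct_of_partI_eq_zero U V _ (fun i => by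
        simp [B_mulVec_inl, dBReal_mulVec_inl]), hV, he, zero_dotProduct, zero_sub]
  have h2 : 0 ≤ V ⬝ᵥ (S U * s.A U) *ᵥ V := by
    by_cases h0 : V = 0
    · simp [h0]
    · exact (hS.hyperbolic_pos U V hV h0).le
  rw [h1]
  linarith

theorem intervalIntegrable_dotProduct_mulVec {ι κ : Type*} [Fintype ι] [Fintype κ]
    {v : ℝ → ι → ℝ} {M : ℝ → Matrix ι κ ℝ} {g : ℝ → κ → ℝ} (hv : ContinuousOn v (Icc 0 1))
    (hM : ∀ i j, ContinuousOn (fun x => M x i j) (Icc 0 1)) (hg : IntervalIntegrable g volume 0 1) :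
    IntervalIntegrable (fun x => v x ⬝ᵥ M x *ᵥ g x) volume 0 1 := by
  have hI : uIcc (0 : ℝ) 1 = Icc 0 1 := uIcc_of_le zero_le_one
  have hgj : ∀ j, IntervalIntegrable (fun x => g x j) volume 0 1 := fun j =>
    let L := ContinuousLinearMap.proj (R := ℝ) (φ := fun _ : κ => ℝ) j
    ⟨L.integrable_comp hg.1, L.integrable_comp hg.2⟩
  have : (fun x => v x ⬝ᵥ M x *ᵥ g x) = ∑ i, ∑ j, fun x => v x i * (M x i j * g x j) := by
    ext x
    simp only [dotProduct, Matrix.mulVec, Finset.sum_apply, Finset.mul_sum]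
  rw [this]
  refine IntervalIntegrable.sum _ fun i _ => IntervalIntegrable.sum _ fun j _ => ?_
  exact ((hgj j).continuousOn_mul (by rw [hI]; exact hM i j)).continuousOn_mul
    (by rw [hI]; exact (continuousOn_pi.1 hv) i)

/-- The energy inequality for the linearized equation `P' = g` about a curve `W` close to the
constant `U₀`, where `P` is the linearized flux of `V`: the integral over `[0,1]` of the derivative
of the energy density is the value of the density at `x = 1`, which is nonpositive. -/
theorem IsSymmetrizer.exists_energy_inequality {s : ViscousSystem r m} (h : s.H0)
    {S : BlockVec ℝ r m → Matrix (Fin r ⊕ Fin m) (Fin r ⊕ Fin m) ℝ} (hS : s.IsSymmetrizer S)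
    (U₀ : BlockVec ℝ r m) :
    ∃ κ c ρ : ℝ, 0 < κ ∧ κ < 1 ∧ 0 < c ∧ 0 < ρ ∧ ∀ W : ℝ → BlockVec ℝ r m,
      ContDiffOn ℝ 1 W (Icc 0 1) →
      (∀ x ∈ Icc (0 : ℝ) 1, ‖W x - U₀‖ ≤ ρ) → (∀ x ∈ Icc (0 : ℝ) 1, ‖dx W x‖ ≤ ρ) →
      ∀ V V' g : ℝ → BlockVec ℝ r m, IsPrimitive V V' →
        IsPrimitive (fun x => s.realFlux (W x) (dx W x) (V x) (V' x)) g →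
        V 0 = 0 → partII (V 1) = 0 →
        ∫ x in (0 : ℝ)..1, (c * ‖V x‖ ^ 2 + (1 - κ * x) * (V x ⬝ᵥ S (W x) *ᵥ g x)) ≤ 0 := by
  obtain ⟨κ, η, c, ρ, hκ, hκ1, hc, hρ, hQ⟩ := hS.exists_energyForm_lower_bound h U₀
  refine ⟨κ, c, ρ, hκ, hκ1, hc, hρ, fun W hW hWU hWx V V' g hV hP hV0 hV1 => ?_⟩
  have hSp : ∀ i j, IsPrimitive (fun x => S (W x) i j) (fun x => dMat S (W x) (dx W x) i j) :=
    fun i j => isPrimitive_comp (hS.contDiff i j) hW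
  have hHp : ∀ i j, IsPrimitive (fun x => (S (W x) * s.A (W x)) i j)
      (fun x => dMat (fun U => S U * s.A U) (W x) (dx W x) i j) :=
    fun i j => isPrimitive_comp (hS.contDiff_mul h i j) hW
  have hωp : IsPrimitive (fun x => 1 - κ * x) (fun _ => -κ) :=
    IsPrimitive.of_hasDerivWithinAt (fun x _ => by
      simpa using (((hasDerivAt_id x).const_mul κ).const_sub 1).hasDerivWithinAt)
      continuousOn_const
  have hηp : IsPrimitive (fun x => η * x) (fun _ => η) :=
    IsPrimitive.of_hasDerivWithinAt (fun x _ => by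
      simpa using ((hasDerivAt_id x).const_mul η).hasDerivWithinAt) continuousOn_const
  have hVII : IsPrimitive (fun x => partII (V x)) (fun x => partII (V' x)) :=
    IsPrimitive.pi_iff.2 fun i => IsPrimitive.pi_iff.1 hV (Sum.inr i)
  have hhalf : IsPrimitive (fun _ : ℝ => (1 / 2 : ℝ)) (fun _ => 0) := IsPrimitive.const _
  have hq := (hωp.mul ((hV.dotProduct (IsPrimitive.mulVec hSp hP)).add
    (hhalf.mul (hV.dotProduct (IsPrimitive.mulVec hHp hV))))).add
    (hηp.mul (hVII.dotProduct hVII))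
  have hint := hq.integral_eq
  have hcont : ∀ i j, ContinuousOn (fun x => S (W x) i j) (Icc 0 1) := fun i j =>
    (hSp i j).continuousOn
  have hgc : IntervalIntegrable
      (fun x => c * ‖V x‖ ^ 2 + (1 - κ * x) * (V x ⬝ᵥ S (W x) *ᵥ g x)) volume 0 1 := by
    refine IntervalIntegrable.add (ContinuousOn.intervalIntegrable ?_) ?_
    · rw [uIcc_of_le zero_le_one]
      exact continuousOn_const.mul (hV.continuousOn.norm.pow 2)
    · exact (intervalIntegrable_dotProduct_mulVec hV.continuousOn hcont hP.1).continuousOn_mul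
        (by fun_prop)
  refine (intervalIntegral.integral_mono_on zero_le_one hgc hq.1 fun x hx => ?_).trans
    (hint.trans_le ?_)
  · have hQx := hQ x hx (W x) (dx W x) (hWU x hx) (hWx x hx) (V x) (partII (V' x))
    have hn : c * ‖V x‖ ^ 2 ≤ c * ‖(V x, partII (V' x))‖ ^ 2 := by
      gcongr
      exact norm_fst_le (V x, partII (V' x))
    have := hS.energyForm_add_eq κ η x (W x) (dx W x) (V x) (V' x) (g x)
    rw [zero_mul, zero_add, ← this]
    linarith
  · have hb := hS.boundary_nonpos (W 1) (dx W 1) (V 1) (V' 1) hV1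
    have hb' := mul_nonpos_of_nonneg_of_nonpos (show 0 ≤ 1 - κ * 1 by linarith) hb
    simp only [hV0, hV1, zero_dotProduct, mul_zero, zero_mul, add_zero, sub_zero]
    exact hb'

end ViscousSystem

/-! ### Consequences of the structural hypotheses -/

open scoped MatrixOrder in
theorem Matrix.PosDef.exists_isUnit_conjTranspose_mul_self {n : Type*} [Fintype n] [DecidableEq n]
    {S : Matrix n n ℝ} (hS : S.PosDef) : ∃ C : Matrix n n ℝ, IsUnit C ∧ Cᴴ * C = S := by
  obtain ⟨C, hC⟩ := CStarAlgebra.nonneg_iff_eq_star_mul_self.mp hS.posSemidef.nonneg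
  refine ⟨C, ?_, hC.symm⟩
  have h1 := hS.isUnit
  rw [hC, Matrix.isUnit_iff_isUnit_det, Matrix.det_mul] at h1
  rw [Matrix.isUnit_iff_isUnit_det]
  exact isUnit_of_mul_isUnit_right h1

/-- If `S` is positive definite, `S M` is symmetric and all complex eigenvalues of `M` are positive,
then `S M` is positive definite: with `S = Cᵀ C`, the matrix `C M C⁻¹` is symmetric and has the
spectrum of `M`. -/
theorem Matrix.PosDef.mul_posDef_of_spectrum {n : Type*} [Fintype n] [DecidableEq n]
    {S M : Matrix n n ℝ} (hS : S.PosDef) (hSM : (S * M).IsSymm)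
    (hM : ∀ μ ∈ spectrum ℂ (M.map ((↑) : ℝ → ℂ)), 0 < μ.re) : (S * M).PosDef := by
  obtain ⟨C, hC, rfl⟩ : ∃ C : Matrix n n ℝ, IsUnit C ∧ Cᴴ * C = S :=
    hS.exists_isUnit_conjTranspose_mul_self
  obtain ⟨c, rfl⟩ := hC
  set D : Matrix n n ℝ := ((c⁻¹ : (Matrix n n ℝ)ˣ) : Matrix n n ℝ) with hD
  have hCD : (c : Matrix n n ℝ) * D = 1 := c.mul_inv
  have hDC : D * (c : Matrix n n ℝ) = 1 := c.inv_mul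
  set K : Matrix n n ℝ := (c : Matrix n n ℝ) * M * D with hK
  have hfac : (c : Matrix n n ℝ)ᴴ * c * M = (c : Matrix n n ℝ)ᴴ * K * c := by
    rw [hK]
    simp only [Matrix.mul_assoc, hDC, Matrix.mul_one]
  have hKs : K.IsHermitian := by
    have h1 : K = Dᴴ * ((c : Matrix n n ℝ)ᴴ * c * M) * D := by
      rw [hfac]
      simp only [Matrix.mul_assoc, hCD, Matrix.mul_one]
      rw [← Matrix.mul_assoc, ← Matrix.conjTranspose_mul, hCD, Matrix.conjTranspose_one,
        Matrix.one_mul]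
    have h2 : ((c : Matrix n n ℝ)ᴴ * c * M).IsHermitian := by
      rw [Matrix.IsHermitian, Matrix.conjTranspose_eq_transpose_of_trivial]
      exact hSM
    rw [h1]
    exact Matrix.isHermitian_conjTranspose_mul_mul _ h2
  have hKp : K.PosDef := by
    rw [hKs.posDef_iff_eigenvalues_pos]
    intro i
    have h1 : hKs.eigenvalues i ∈ spectrum ℝ K := hKs.eigenvalues_mem_spectrum_real i
    have h2 : hKs.eigenvalues i ∈ spectrum ℝ M := by
      have h : spectrum ℝ K = spectrum ℝ M := spectrum.units_conjugate
      rwa [h] at h1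
    have h3 : ((hKs.eigenvalues i : ℝ) : ℂ) ∈ spectrum ℂ (M.map ((↑) : ℝ → ℂ)) := by
      rw [spectrum.mem_iff, Matrix.isUnit_iff_isUnit_det, isUnit_iff_ne_zero, not_not] at h2 ⊢
      have : (algebraMap ℂ (Matrix n n ℂ)) (hKs.eigenvalues i : ℝ) - M.map ((↑) : ℝ → ℂ) =
          ((algebraMap ℝ (Matrix n n ℝ)) (hKs.eigenvalues i) - M).map (Complex.ofRealHom) := by
        ext a b
        by_cases hab : a = b <;> simp [Matrix.algebraMap_matrix_apply, hab]
      rw [this, ← RingHom.mapMatrix_apply, ← RingHom.map_det, h2, map_zero]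
    simpa using hM _ h3
  rw [hfac]
  exact (Matrix.IsUnit.posDef_star_left_conjugate_iff c.isUnit).2 hKp

namespace ViscousSystem

variable {r m : ℕ}

theorem dotProduct_embII_mulVec (S₁₁ : Matrix (Fin r) (Fin r) ℝ) (S₂₂ : Matrix (Fin m) (Fin m) ℝ)
    (p : Fin m → ℝ) (w : BlockVec ℝ r m) :
    (embII p : BlockVec ℝ r m) ⬝ᵥ Matrix.fromBlocks S₁₁ 0 0 S₂₂ *ᵥ w = p ⬝ᵥ S₂₂ *ᵥ partII w := by
  simp [dotProduct, Matrix.mulVec, embII, partII]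

theorem dotProduct_self_mulVec_pos {n : Type*} [Fintype n] {M : Matrix n n ℝ}
    (h : (M + Mᵀ).PosDef) {p : n → ℝ} (hp : p ≠ 0) : 0 < p ⬝ᵥ M *ᵥ p := by
  have := h.dotProduct_mulVec_pos hp
  rw [star_trivial, Matrix.add_mulVec, dotProduct_add, Matrix.mulVec_transpose,
    dotProduct_comm p (p ᵥ* M), ← Matrix.dotProduct_mulVec] at this
  linarith

/-- The symmetrizer of (H3) has the properties required by the energy method; (H2) enters through the
positivity of `S₁₁ A₁₁`. -/
theorem exists_isSymmetrizer {s : ViscousSystem r m} (h2 : s.H2) (h3 : s.H3) :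
    ∃ S, s.IsSymmetrizer S := by
  obtain ⟨S₁₁, S₂₂, hs1, hs2, h⟩ := h3
  refine ⟨fun U => Matrix.fromBlocks (S₁₁ U) 0 0 (S₂₂ U), ?_, fun U => ?_, fun U i j => rfl,
    fun U v => ?_, fun U => (h U).2.1, fun U v hv hv0 => ?_, fun U p hp => ?_⟩
  · rintro (i | i) (j | j)
    · exact hs1 i j
    · exact contDiff_const
    · exact contDiff_const
    · exact hs2 i j
  · have := (h U).1.1
    rwa [Matrix.IsHermitian, Matrix.conjTranspose_eq_transpose_of_trivial] at this
  · simpa using (h U).1.posSemidef.dotProduct_mulVec_nonneg v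
  · have hS11 : (S₁₁ U).PosDef := by
      have := (h U).1.submatrix (e := Sum.inl) Sum.inl_injective
      exact this
    have hblock : (S₁₁ U * (s.A U).toBlocks₁₁) =
        (Matrix.fromBlocks (S₁₁ U) 0 0 (S₂₂ U) * s.A U).submatrix Sum.inl Sum.inl := by
      ext i j
      simp [Matrix.mul_apply, Matrix.toBlocks₁₁]
    have hsymm : (S₁₁ U * (s.A U).toBlocks₁₁).IsSymm := by
      rw [hblock]
      exact (h U).2.1.submatrix _
    have hpd := hS11.mul_posDef_of_spectrum hsymm fun μ hμ => (h2 U μ hμ).1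
    have hI : partI v ≠ 0 := by
      intro hI
      apply hv0
      ext (i | i)
      · exact congrFun hI i
      · exact congrFun hv i
    have := hpd.dotProduct_mulVec_pos hI
    rw [star_trivial, hblock] at this
    refine this.trans_le (le_of_eq ?_)
    have hvi : ∀ i, v (Sum.inr i) = 0 := fun i => congrFun hv i
    simp [dotProduct, Matrix.mulVec, hvi, partI]
  · rw [dotProduct_embII_mulVec]
    have hw : partII (s.B U *ᵥ embII p) = s.B₂₂ U *ᵥ p := by
      ext i
      exact B_mulVec_inr s U (embII p) i
    rw [hw, Matrix.mulVec_mulVec]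
    exact dotProduct_self_mulVec_pos (h U).2.2 hp

theorem H1.isUnit_det {s : ViscousSystem r m} (h : s.H1) (U : BlockVec ℝ r m) :
    IsUnit (s.B₂₂ U).det := by
  rw [← Matrix.isUnit_iff_isUnit_det, ← Matrix.mulVec_injective_iff_isUnit]
  intro p q hpq
  by_contra hne
  have := dotProduct_self_mulVec_pos (h U) (sub_ne_zero.2 hne)
  rw [Matrix.mulVec_sub, hpq, sub_self, dotProduct_zero] at this
  exact lt_irrefl _ this

theorem H2.isUnit_det {s : ViscousSystem r m} (h : s.H2) (U : BlockVec ℝ r m) :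
    IsUnit ((s.A U).toBlocks₁₁).det := by
  rw [isUnit_iff_ne_zero]
  intro h0
  have : (0 : ℂ) ∈ spectrum ℂ ((s.A U).toBlocks₁₁.map ((↑) : ℝ → ℂ)) := by
    rw [spectrum.zero_mem_iff, Matrix.isUnit_iff_isUnit_det, isUnit_iff_ne_zero, not_not]
    have := RingHom.map_det Complex.ofRealHom (s.A U).toBlocks₁₁
    rw [h0, map_zero] at this
    exact this.symm
  simpa using (h U 0 this).1

end ViscousSystem

/-! ### The profile equation as an ordinary differential equation -/

theorem ContDiff.matrix_det {E n : Type*} [NormedAddCommGroup E] [NormedSpace ℝ E] [Fintype n]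
    [DecidableEq n] {k : WithTop ℕ∞} {M : E → Matrix n n ℝ}
    (hM : ∀ i j, ContDiff ℝ k fun x => M x i j) : ContDiff ℝ k fun x => (M x).det := by
  simp only [Matrix.det_apply]
  exact ContDiff.sum fun σ _ => (contDiff_prod fun i _ => hM _ _).const_smul _

theorem ContDiff.matrix_inv {E n : Type*} [NormedAddCommGroup E] [NormedSpace ℝ E] [Fintype n]
    [DecidableEq n] {k : WithTop ℕ∞} {M : E → Matrix n n ℝ}
    (hM : ∀ i j, ContDiff ℝ k fun x => M x i j) (hdet : ∀ x, IsUnit (M x).det) (i j : n) :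
    ContDiff ℝ k fun x => (M x)⁻¹ i j := by
  simp only [Matrix.inv_def, Ring.inverse_eq_inv', Matrix.smul_apply, smul_eq_mul,
    Matrix.adjugate_apply]
  refine ((ContDiff.matrix_det hM).inv fun x => (hdet x).ne_zero).mul (ContDiff.matrix_det ?_)
  intro a b
  by_cases h : a = j
  · simp only [Matrix.updateRow_apply, h, if_true]
    exact contDiff_const
  · simp only [Matrix.updateRow_apply, h, if_false]
    exact hM a b

namespace ViscousSystem

variable {r m : ℕ}

/-- The matrix that recovers `W'` from `B₂₂(W) W_II'` when `A₁₁ W_I' + A₁₂ W_II' = 0`. -/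
def slopeMatrix (s : ViscousSystem r m) (U : BlockVec ℝ r m) :
    Matrix (Fin r ⊕ Fin m) (Fin m) ℝ :=
  Matrix.fromRows (-((s.A U).toBlocks₁₁⁻¹ * (s.A U).toBlocks₁₂ * (s.B₂₂ U)⁻¹)) (s.B₂₂ U)⁻¹

/-- The vector field `(U, C) ↦ W'` of the profile problem solved for `W'`. -/
def profileField (s : ViscousSystem r m) (U₀ U : BlockVec ℝ r m) (C : Fin m → ℝ) : BlockVec ℝ r m :=
  s.slopeMatrix U *ᵥ (partII (s.f U) - partII (s.f U₀) + s.B₂₂ U₀ *ᵥ C)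

theorem partII_slopeMatrix_mulVec (s : ViscousSystem r m) (U : BlockVec ℝ r m) (k : Fin m → ℝ) :
    partII (s.slopeMatrix U *ᵥ k) = (s.B₂₂ U)⁻¹ *ᵥ k := by
  ext i
  simp only [partII, slopeMatrix, Matrix.fromRows_mulVec, Sum.elim_inr]

theorem partI_slopeMatrix_mulVec (s : ViscousSystem r m) (U : BlockVec ℝ r m) (k : Fin m → ℝ) :
    partI (s.slopeMatrix U *ᵥ k) =
      -((s.A U).toBlocks₁₁⁻¹ *ᵥ ((s.A U).toBlocks₁₂ *ᵥ ((s.B₂₂ U)⁻¹ *ᵥ k))) := by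
  simp only [Matrix.mulVec_mulVec, ← Matrix.neg_mulVec]
  ext i
  simp only [partI, slopeMatrix, Matrix.fromRows_mulVec, Sum.elim_inl, Matrix.mul_assoc]

theorem partI_mulVec (M : Matrix (Fin r ⊕ Fin m) (Fin r ⊕ Fin m) ℝ) (V : BlockVec ℝ r m) :
    partI (M *ᵥ V) = M.toBlocks₁₁ *ᵥ partI V + M.toBlocks₁₂ *ᵥ partII V := by
  ext i
  simp [partI, partII, Matrix.mulVec, dotProduct, Matrix.toBlocks₁₁, Matrix.toBlocks₁₂]

/-- The vector `slopeMatrix U k` is characterized by `(A V)_I = 0` and `B₂₂ V_II = k`. -/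
theorem eq_slopeMatrix_mulVec_iff {s : ViscousSystem r m} (h1 : s.H1) (h2 : s.H2)
    (U V : BlockVec ℝ r m) (k : Fin m → ℝ) :
    V = s.slopeMatrix U *ᵥ k ↔ partI (s.A U *ᵥ V) = 0 ∧ s.B₂₂ U *ᵥ partII V = k := by
  have hA := h2.isUnit_det U
  have hB := h1.isUnit_det U
  constructor
  · rintro rfl
    rw [partI_mulVec, partI_slopeMatrix_mulVec, partII_slopeMatrix_mulVec, Matrix.mulVec_neg,
      Matrix.mulVec_mulVec, Matrix.mul_nonsing_inv _ hA, Matrix.one_mulVec, Matrix.mulVec_mulVec,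
      Matrix.mulVec_mulVec, Matrix.mul_nonsing_inv _ hB, Matrix.one_mulVec]
    simp
  · rintro ⟨hI, rfl⟩
    rw [partI_mulVec] at hI
    have e1 : partII V = partII (s.slopeMatrix U *ᵥ (s.B₂₂ U *ᵥ partII V)) := by
      rw [partII_slopeMatrix_mulVec, Matrix.mulVec_mulVec, Matrix.nonsing_inv_mul _ hB,
        Matrix.one_mulVec]
    have e2 : partI V = partI (s.slopeMatrix U *ᵥ (s.B₂₂ U *ᵥ partII V)) := by
      rw [partI_slopeMatrix_mulVec, Matrix.mulVec_mulVec (M := (s.B₂₂ U)⁻¹),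
        Matrix.nonsing_inv_mul _ hB, Matrix.one_mulVec, eq_neg_of_add_eq_zero_right hI,
        Matrix.mulVec_neg, neg_neg, Matrix.mulVec_mulVec, Matrix.nonsing_inv_mul _ hA,
        Matrix.one_mulVec]
    ext (i | i)
    · exact congrFun e2 i
    · exact congrFun e1 i

theorem contDiff_slopeMatrix {s : ViscousSystem r m} (h0 : s.H0) (h1 : s.H1) (h2 : s.H2) (i j) :
    ContDiff ℝ ∞ fun U => s.slopeMatrix U i j := by
  have hB : ∀ i j, ContDiff ℝ ∞ fun U => (s.B₂₂ U)⁻¹ i j :=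
    ContDiff.matrix_inv h0.2 h1.isUnit_det
  have hA : ∀ i j, ContDiff ℝ ∞ fun U => ((s.A U).toBlocks₁₁)⁻¹ i j :=
    ContDiff.matrix_inv (fun i j => h0.contDiff_A _ _) h2.isUnit_det
  rcases i with i | i
  · simp only [slopeMatrix, Matrix.fromRows_apply_inl, Matrix.neg_apply, Matrix.mul_apply,
      Finset.sum_mul]
    refine ContDiff.neg (ContDiff.sum fun a _ => ContDiff.sum fun b _ => ?_)
    exact ((hA _ _).mul (h0.contDiff_A _ _)).mul (hB _ _)
  · simp only [slopeMatrix, Matrix.fromRows_apply_inr]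
    exact hB i j

theorem contDiff_profileField {s : ViscousSystem r m} (h0 : s.H0) (h1 : s.H1) (h2 : s.H2)
    (U₀ : BlockVec ℝ r m) :
    ContDiff ℝ ∞ fun q : BlockVec ℝ r m × (Fin m → ℝ) => s.profileField U₀ q.1 q.2 := by
  rw [contDiff_pi]
  intro i
  simp only [profileField, Matrix.mulVec, dotProduct, Pi.add_apply, Pi.sub_apply]
  refine ContDiff.sum fun j _ => ((contDiff_slopeMatrix h0 h1 h2 i j).comp contDiff_fst).mul
    (((((contDiff_pi.1 h0.1 (Sum.inr j))).comp contDiff_fst).sub contDiff_const).add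
      (ContDiff.sum fun k _ => contDiff_const.mul ?_))
  exact (contDiff_pi.1 contDiff_snd k)

theorem contDiff_profileField_left {s : ViscousSystem r m} (h0 : s.H0) (h1 : s.H1) (h2 : s.H2)
    (U₀ : BlockVec ℝ r m) (C : Fin m → ℝ) : ContDiff ℝ ∞ fun U => s.profileField U₀ U C :=
  ContDiff.comp (g := fun q : BlockVec ℝ r m × (Fin m → ℝ) => s.profileField U₀ q.1 q.2)
    (f := fun U => (U, C)) (contDiff_profileField h0 h1 h2 U₀) (contDiff_id.prodMk contDiff_const)

theorem dx_eq {E : Type} [NormedAddCommGroup E] [NormedSpace ℝ E] {W : ℝ → E} {D : E} {x : ℝ}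
    (hx : x ∈ Icc (0 : ℝ) 1) (h : HasDerivWithinAt W D (Icc 0 1) x) : dx W x = D :=
  h.derivWithin (uniqueDiffOn_Icc zero_lt_one x hx)

theorem hasDerivWithinAt_partII {W : ℝ → BlockVec ℝ r m} {D : BlockVec ℝ r m} {x : ℝ} {t : Set ℝ}
    (h : HasDerivWithinAt W D t x) : HasDerivWithinAt (fun y => partII (W y)) (partII D) t x := by
  rw [hasDerivWithinAt_pi] at h ⊢
  exact fun i => h (Sum.inr i)

theorem hasDerivWithinAt_f {s : ViscousSystem r m} (h0 : s.H0) {W : ℝ → BlockVec ℝ r m}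
    {D : BlockVec ℝ r m} {x : ℝ} {t : Set ℝ} (h : HasDerivWithinAt W D t x) :
    HasDerivWithinAt (fun y => s.f (W y)) (s.A (W x) *ᵥ D) t x := by
  rw [A_mulVec]
  exact ((h0.1.differentiable (by simp)) (W x)).hasFDerivAt.comp_hasDerivWithinAt x h

/-- A function with vanishing derivative on `(0,1)`, continuous on `[0,1]`, is constant. -/
theorem eq_left_of_deriv_eq_zero {E : Type*} [NormedAddCommGroup E] [NormedSpace ℝ E]
    [CompleteSpace E] {u : ℝ → E} (hc : ContinuousOn u (Icc 0 1))
    (hd : ∀ x ∈ Ioo (0 : ℝ) 1, HasDerivAt u 0 x) {x : ℝ} (hx : x ∈ Icc (0 : ℝ) 1) : u x = u 0 := by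
  have := intervalIntegral.integral_eq_sub_of_hasDerivAt_of_le (a := 0) (b := x) hx.1
    (hc.mono (Icc_subset_Icc_right hx.2)) (f' := fun _ => (0 : E))
    (fun t ht => hd t ⟨ht.1, lt_of_lt_of_le ht.2 hx.2⟩) intervalIntegrable_const
  rw [intervalIntegral.integral_zero] at this
  exact sub_eq_zero.1 this.symm

/-- A continuous curve on which `f_I` is constant and whose second block is differentiable is itself
differentiable, by the inverse function theorem for `U ↦ (f_I(U), U_II)`. -/
theorem IsProfile.differentiableWithinAt {s : ViscousSystem r m} (h0 : s.H0) (h2 : s.H2)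
    {U₀ : BlockVec ℝ r m} {C : Fin m → ℝ} {W : ℝ → BlockVec ℝ r m} (hW : s.IsProfile U₀ C W)
    {x : ℝ} (hx : x ∈ Icc (0 : ℝ) 1) : DifferentiableWithinAt ℝ W (Icc 0 1) x := by
  set G : BlockVec ℝ r m → BlockVec ℝ r m := fun U => Sum.elim (partI (s.f U)) (partII U) with hG
  have hGc : ContDiff ℝ 1 G := by
    rw [contDiff_pi]
    rintro (i | i)
    · exact (contDiff_pi.1 h0.1 (Sum.inl i)).of_le (by simp)
    · exact contDiff_apply ℝ ℝ (Sum.inr i)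
  have hGs : HasStrictFDerivAt G (fderiv ℝ G (W x)) (W x) :=
    hGc.contDiffAt.hasStrictFDerivAt one_ne_zero
  have hcomp : ∀ V i, fderiv ℝ G (W x) V (Sum.inl i) = (s.A (W x) *ᵥ V) (Sum.inl i) := by
    intro V i
    rw [A_mulVec]
    have e1 := (hasFDerivAt_pi'.1 hGs.hasFDerivAt) (Sum.inl i)
    have e2 := (hasFDerivAt_pi'.1 ((h0.1.differentiable (by simp)) (W x)).hasFDerivAt) (Sum.inl i)
    exact DFunLike.congr_fun (e1.unique e2) V
  have hcomp2 : ∀ V i, fderiv ℝ G (W x) V (Sum.inr i) = V (Sum.inr i) := by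
    intro V i
    have e1 := (hasFDerivAt_pi'.1 hGs.hasFDerivAt) (Sum.inr i)
    have e2 := (hasFDerivAt_pi'.1 (hasFDerivAt_id (𝕜 := ℝ) (W x))) (Sum.inr i)
    exact DFunLike.congr_fun (e1.unique e2) V
  have hinj : Function.Injective (fderiv ℝ G (W x)) := by
    rw [injective_iff_map_eq_zero]
    intro V hV
    have hII : partII V = 0 := by
      ext i
      rw [partII, ← hcomp2 V i, hV]
      rfl
    have hI : partI (s.A (W x) *ᵥ V) = 0 := by
      ext i
      rw [partI, ← hcomp V i, hV]
      rfl
    rw [partI_mulVec, hII, Matrix.mulVec_zero, add_zero] at hI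
    have hI' : partI V = 0 := by
      have := congrArg (fun w => ((s.A (W x)).toBlocks₁₁)⁻¹ *ᵥ w) hI
      simpa [Matrix.mulVec_mulVec, Matrix.nonsing_inv_mul _ (h2.isUnit_det (W x))] using this
    ext (i | i)
    · exact congrFun hI' i
    · exact congrFun hII i
  let e : BlockVec ℝ r m ≃L[ℝ] BlockVec ℝ r m :=
    (LinearEquiv.ofInjectiveEndo (fderiv ℝ G (W x) : BlockVec ℝ r m →ₗ[ℝ] BlockVec ℝ r m)
      hinj).toContinuousLinearEquiv
  have he : (e : BlockVec ℝ r m →L[ℝ] BlockVec ℝ r m) = fderiv ℝ G (W x) := by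
    ext V i
    rfl
  rw [← he] at hGs
  have hGW : DifferentiableWithinAt ℝ (fun y => G (W y)) (Icc 0 1) x := by
    rw [differentiableWithinAt_pi]
    rintro (i | i)
    · have : DifferentiableWithinAt ℝ (fun _ : ℝ => s.f U₀ (Sum.inl i)) (Icc 0 1) x := by fun_prop
      exact this.congr (fun y hy => congrFun (hW.constraint y hy) i)
        (congrFun (hW.constraint x hx) i)
    · exact (differentiableWithinAt_pi.1 (hW.differentiableOn x hx)) i
  have hinv := hGs.eventually_left_inverse
  have hev : ∀ᶠ y in 𝓝[Icc 0 1] x, hGs.localInverse _ _ _ (G (W y)) = W y :=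
    (hW.continuousOn x hx).eventually hinv
  have hd : DifferentiableWithinAt ℝ (fun y => hGs.localInverse _ _ _ (G (W y))) (Icc 0 1) x :=
    (hGs.to_localInverse.hasFDerivAt.differentiableAt).comp_differentiableWithinAt x hGW
  exact hd.congr_of_eventuallyEq (hev.mono fun y hy => hy.symm) (hGs.localInverse_apply_image).symm

/-- The profile problem is an initial value problem. -/
theorem isProfile_iff {s : ViscousSystem r m} (h0 : s.H0) (h1 : s.H1) (h2 : s.H2)
    {U₀ : BlockVec ℝ r m} {C : Fin m → ℝ} {W : ℝ → BlockVec ℝ r m} :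
    s.IsProfile U₀ C W ↔ W 0 = U₀ ∧
      ∀ x ∈ Icc (0 : ℝ) 1, HasDerivWithinAt W (s.profileField U₀ (W x) C) (Icc 0 1) x := by
  constructor
  · intro hW
    refine ⟨hW.init, fun x hx => ?_⟩
    have hd := (hW.differentiableWithinAt h0 h2 hx).hasDerivWithinAt
    have key : derivWithin W (Icc 0 1) x = s.profileField U₀ (W x) C := by
      rw [profileField, eq_slopeMatrix_mulVec_iff h1 h2]
      refine ⟨?_, ?_⟩
      · have hf := hasDerivWithinAt_f h0 hd
        rw [hasDerivWithinAt_pi] at hf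
        ext i
        have h3 := hf (Sum.inl i)
        have h4 : HasDerivWithinAt (fun y => s.f (W y) (Sum.inl i)) 0 (Icc 0 1) x :=
          (hasDerivWithinAt_const x _ (s.f U₀ (Sum.inl i))).congr
            (fun y hy => congrFun (hW.constraint y hy) i) (congrFun (hW.constraint x hx) i)
        exact (dx_eq hx h3).symm.trans (dx_eq hx h4)
      · rw [← hW.ode x hx, dx_eq hx (hasDerivWithinAt_partII hd)]
    rw [← key]
    exact hd
  · rintro ⟨hi, hd⟩
    have hc : ContinuousOn W (Icc 0 1) := fun x hx => (hd x hx).continuousWithinAt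
    refine ⟨hc, fun x hx => (hasDerivWithinAt_partII (hd x hx)).differentiableWithinAt, hi,
      fun x hx => ?_, fun x hx => ?_⟩
    · ext i
      have hc' : ContinuousOn (fun y => s.f (W y) (Sum.inl i)) (Icc 0 1) :=
        ((contDiff_pi.1 h0.1 (Sum.inl i)).continuous).comp_continuousOn hc
      have := eq_left_of_deriv_eq_zero hc' (fun t ht => ?_) hx
      · rw [hi] at this
        exact this
      · have h3 := hasDerivWithinAt_f h0 (hd t (Ioo_subset_Icc_self ht))
        rw [hasDerivWithinAt_pi] at h3
        have h4 := (h3 (Sum.inl i)).hasDerivAt (Icc_mem_nhds ht.1 ht.2)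
        have h5 := ((eq_slopeMatrix_mulVec_iff h1 h2 (W t) _ _).1
          (rfl : s.profileField U₀ (W t) C = _)).1
        have h6 := congrFun h5 i
        simp only [partI] at h6
        rwa [h6] at h4
    · rw [dx_eq hx (hasDerivWithinAt_partII (hd x hx))]
      exact ((eq_slopeMatrix_mulVec_iff h1 h2 (W x) _ _).1
        (rfl : s.profileField U₀ (W x) C = _)).2

theorem IsProfile.eqOn {s : ViscousSystem r m} (h0 : s.H0) (h1 : s.H1) (h2 : s.H2)
    {U₀ : BlockVec ℝ r m} {C : Fin m → ℝ} {W W' : ℝ → BlockVec ℝ r m} (hW : s.IsProfile U₀ C W)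
    (hW' : s.IsProfile U₀ C W') : EqOn W W' (Icc 0 1) := by
  rw [isProfile_iff h0 h1 h2] at hW hW'
  have hg : ContDiff ℝ 1 fun U => s.profileField U₀ U C :=
    (contDiff_profileField_left h0 h1 h2 U₀ C).of_le (by simp)
  exact ode_eqOn hg hW.2 hW'.2 (hW.1.trans hW'.1.symm)

theorem IsProfile.dx_eq_profileField {s : ViscousSystem r m} (h0 : s.H0) (h1 : s.H1) (h2 : s.H2)
    {U₀ : BlockVec ℝ r m} {C : Fin m → ℝ} {W : ℝ → BlockVec ℝ r m} (hW : s.IsProfile U₀ C W)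
    {x : ℝ} (hx : x ∈ Icc (0 : ℝ) 1) : dx W x = s.profileField U₀ (W x) C :=
  dx_eq hx (((isProfile_iff h0 h1 h2).1 hW).2 x hx)

theorem partII_profileField_self {s : ViscousSystem r m} (h1 : s.H1) (U₀ : BlockVec ℝ r m)
    (C : Fin m → ℝ) : partII (s.profileField U₀ U₀ C) = C := by
  rw [profileField, partII_slopeMatrix_mulVec, sub_self, zero_add, Matrix.mulVec_mulVec,
    Matrix.nonsing_inv_mul _ (h1.isUnit_det U₀), Matrix.one_mulVec]

/-- The parameter of a profile is its initial slope `W_II'(0)`. -/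
theorem IsProfile.partII_dx_zero {s : ViscousSystem r m} (h0 : s.H0) (h1 : s.H1) (h2 : s.H2)
    {U₀ : BlockVec ℝ r m} {C : Fin m → ℝ} {W : ℝ → BlockVec ℝ r m} (hW : s.IsProfile U₀ C W) :
    partII (dx W 0) = C := by
  rw [hW.dx_eq_profileField h0 h1 h2 (by simp), hW.init, partII_profileField_self h1]

theorem IsProfile.contDiffOn {s : ViscousSystem r m} (h0 : s.H0) (h1 : s.H1) (h2 : s.H2)
    {U₀ : BlockVec ℝ r m} {C : Fin m → ℝ} {W : ℝ → BlockVec ℝ r m} (hW : s.IsProfile U₀ C W) :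
    ContDiffOn ℝ 2 W (Icc 0 1) := by
  have hg := contDiff_profileField_left h0 h1 h2 U₀ C
  have hd := ((isProfile_iff h0 h1 h2).1 hW).2
  have hU := uniqueDiffOn_Icc (zero_lt_one (α := ℝ))
  have hdiff : DifferentiableOn ℝ W (Icc 0 1) := fun x hx => (hd x hx).differentiableWithinAt
  have hC1 : ContDiffOn ℝ 1 W (Icc 0 1) := by
    have := (contDiffOn_succ_iff_derivWithin (n := 0) hU).2 ⟨hdiff, by simp, by
      rw [contDiffOn_zero]
      exact (hg.continuous.comp_continuousOn hW.continuousOn).congr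
        fun x hx => hW.dx_eq_profileField h0 h1 h2 hx⟩
    simpa using this
  have hg1 : ContDiff ℝ 1 fun U => s.profileField U₀ U C := hg.of_le (by simp)
  have hd1 : ContDiffOn ℝ 1 (fun x => s.profileField U₀ (W x) C) (Icc 0 1) :=
    hg1.comp_contDiffOn hC1
  have := (contDiffOn_succ_iff_derivWithin (n := 1) hU).2 ⟨hdiff, by simp,
    hd1.congr fun x hx => hW.dx_eq_profileField h0 h1 h2 hx⟩
  exact this.of_le (by norm_num)

/-- Profiles hitting the right boundary datum are steady solutions. -/
theorem IsProfile.isSteadySolution {s : ViscousSystem r m} (h0 : s.H0) (h1 : s.H1) (h2 : s.H2)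
    {U₀ : BlockVec ℝ r m} {C U₁ : Fin m → ℝ} {W : ℝ → BlockVec ℝ r m} (hW : s.IsProfile U₀ C W)
    (h : partII (W 1) = U₁) : s.IsSteadySolution U₀ U₁ W := by
  refine ⟨hW.contDiffOn h0 h1 h2, hW.init, h, fun x hx => ?_⟩
  set c : BlockVec ℝ r m := s.f U₀ - s.B U₀ *ᵥ embII C with hc
  have hev : (fun y => s.B (W y) *ᵥ dx W y) =ᶠ[𝓝 x] fun y => s.f (W y) - c := by
    filter_upwards [Icc_mem_nhds hx.1 hx.2] with y hy
    have hd := ((isProfile_iff h0 h1 h2).1 hW).2 y hy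
    ext (i | i)
    · rw [B_mulVec_inl, Pi.sub_apply, hc, Pi.sub_apply, B_mulVec_inl]
      have := congrFun (hW.constraint y hy) i
      simp only [partI] at this
      rw [this]
      simp
    · rw [B_mulVec_inr, Pi.sub_apply, hc, Pi.sub_apply, B_mulVec_inr, dx_eq hy hd,
        ← dx_eq hy (hasDerivWithinAt_partII hd), hW.ode y hy]
      simp only [Pi.add_apply, Pi.sub_apply, partII, partII_embII]
      ring_nf
  rw [hev.deriv_eq, deriv_sub_const]

/-- Integrating the steady equation once, steady solutions are profiles with parameter `W_II'(0)`. -/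
theorem IsSteadySolution.isProfile {s : ViscousSystem r m} (h0 : s.H0)
    {U₀ : BlockVec ℝ r m} {U₁ : Fin m → ℝ} {W : ℝ → BlockVec ℝ r m}
    (hW : s.IsSteadySolution U₀ U₁ W) : s.IsProfile U₀ (partII (dx W 0)) W := by
  have hd : ∀ x ∈ Icc (0 : ℝ) 1, HasDerivWithinAt W (dx W x) (Icc 0 1) x := fun x hx =>
    hasDerivWithinAt_dx hW.contDiffOn (by simp) hx
  have hdxC : ContDiffOn ℝ 1 (dx W) (Icc 0 1) :=
    ((contDiffOn_succ_iff_derivWithin (n := 1) (uniqueDiffOn_Icc (zero_lt_one (α := ℝ)))).1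
      (hW.contDiffOn.of_le (by norm_num))).2.2
  have hf : ContDiffOn ℝ 1 (fun y => s.f (W y)) (Icc 0 1) :=
    (h0.1.of_le (by simp)).comp_contDiffOn (hW.contDiffOn.of_le (by norm_num))
  have hB : ContDiffOn ℝ 1 (fun y => s.B (W y) *ᵥ dx W y) (Icc 0 1) := by
    rw [contDiffOn_pi]
    intro i
    simp only [Matrix.mulVec, dotProduct]
    refine ContDiffOn.sum fun j _ => ContDiffOn.mul ?_ ((contDiffOn_pi.1 hdxC) j)
    exact ((h0.contDiff_B i j).of_le (by simp)).comp_contDiffOn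
      (hW.contDiffOn.of_le (by norm_num))
  have hconst : ∀ x ∈ Icc (0 : ℝ) 1, s.f (W x) - s.B (W x) *ᵥ dx W x =
      s.f U₀ - s.B U₀ *ᵥ dx W 0 := by
    intro x hx
    have := eq_left_of_deriv_eq_zero (u := fun y => s.f (W y) - s.B (W y) *ᵥ dx W y)
      (hf.continuousOn.sub hB.continuousOn) (fun t ht => ?_) hx
    · simpa [hW.left_bc] using this
    · have hn := Icc_mem_nhds ht.1 ht.2
      have h1 := ((hf.differentiableOn one_ne_zero t
        (Ioo_subset_Icc_self ht)).differentiableAt hn).hasDerivAt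
      have h2 := ((hB.differentiableOn one_ne_zero t
        (Ioo_subset_Icc_self ht)).differentiableAt hn).hasDerivAt
      have h3 := h1.sub h2
      rwa [hW.equation t ht, sub_self] at h3
  refine ⟨hW.contDiffOn.continuousOn, fun x hx =>
    (hasDerivWithinAt_partII (hd x hx)).differentiableWithinAt, hW.left_bc, fun x hx => ?_,
    fun x hx => ?_⟩
  · ext i
    have := congrFun (hconst x hx) (Sum.inl i)
    simp only [Pi.sub_apply, B_mulVec_inl, sub_zero] at this
    exact this
  · rw [dx_eq hx (hasDerivWithinAt_partII (hd x hx))]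
    ext i
    have := congrFun (hconst x hx) (Sum.inr i)
    simp only [Pi.sub_apply, B_mulVec_inr] at this
    simp only [Pi.add_apply, Pi.sub_apply, partII] at this ⊢
    linarith

end ViscousSystem

/-! ### The shooting map -/

/-- Near a point where the strict derivative is invertible, a map is injective and its derivatives,
where they exist, are invertible. -/
theorem HasStrictFDerivAt.exists_ball_injOn_and_equiv {F : Type*} [NormedAddCommGroup F]
    [NormedSpace ℝ F] [FiniteDimensional ℝ F] {e : F → F} {D : F →L[ℝ] F} {a : F}
    (he : HasStrictFDerivAt e D a) (hD : Function.Injective D)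
    (hd : ∀ᶠ b in 𝓝 a, DifferentiableAt ℝ e b) :
    ∃ ρ > (0 : ℝ), InjOn e (Metric.ball a ρ) ∧ (∀ b ∈ Metric.ball a ρ,
      ∃ L : F ≃L[ℝ] F, HasFDerivAt e (L : F →L[ℝ] F) b) ∧ map e (𝓝 a) = 𝓝 (e a) := by
  have equiv_of_inj : ∀ D' : F →L[ℝ] F, Function.Injective D' →
      ∃ L : F ≃L[ℝ] F, (L : F →L[ℝ] F) = D' := fun D' hD' =>
    ⟨(LinearEquiv.ofInjectiveEndo (D' : F →ₗ[ℝ] F) hD').toContinuousLinearEquiv, by ext v; rfl⟩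
  have : CompleteSpace F := FiniteDimensional.complete ℝ F
  obtain ⟨L, rfl⟩ := equiv_of_inj D hD
  have hmap := he.map_nhds_eq_of_equiv
  rcases subsingleton_or_nontrivial F with hF | hF
  · refine ⟨1, one_pos, fun b _ b' _ _ => Subsingleton.elim _ _, fun b _ => ⟨L, ?_⟩, hmap⟩
    convert hasFDerivAt_of_subsingleton (𝕜 := ℝ) e b
    ext v
    exact Subsingleton.elim _ _
  · obtain ⟨c, hc0, hcN⟩ : ∃ c : NNReal, 0 < c ∧ c < ‖(L.symm : F →L[ℝ] F)‖₊⁻¹ :=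
      exists_between (inv_pos.2 L.nnnorm_symm_pos)
    obtain ⟨t, ht, hct⟩ := he.approximates_deriv_on_nhds (Or.inr hc0)
    obtain ⟨ρ, hρ, hball⟩ := Metric.mem_nhds_iff.1 (inter_mem ht hd)
    refine ⟨ρ, hρ, (hct.mono_set fun b hb => (hball hb).1).injOn (Or.inr hcN), fun b hb => ?_, hmap⟩
    obtain ⟨D', hD'⟩ := (hball hb).2
    have hlip : LipschitzOnWith c (e - ⇑(L : F →L[ℝ] F)) (Metric.ball a ρ) :=
      lipschitzOnWith_iff_restrict.2 (hct.mono_set fun b hb => (hball hb).1).lipschitz_sub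
    have hn : ‖D' - (L : F →L[ℝ] F)‖ ≤ c :=
      (hD'.sub (L : F →L[ℝ] F).hasFDerivAt).le_of_lipschitzOn (Metric.isOpen_ball.mem_nhds hb) hlip
    have hinj : Function.Injective D' := by
      rw [injective_iff_map_eq_zero]
      intro v hv
      by_contra hv0
      have hvpos : 0 < ‖v‖ := norm_pos_iff.2 hv0
      have h1 : ‖L v‖ ≤ c * ‖v‖ := by
        have := (D' - (L : F →L[ℝ] F)).le_of_opNorm_le hn v
        simpa [hv] using this
      have h2 : ‖v‖ ≤ ‖(L.symm : F →L[ℝ] F)‖ * ‖L v‖ := by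
        simpa using (L.symm : F →L[ℝ] F).le_opNorm (L v)
      have h3 : (c : ℝ) * ‖(L.symm : F →L[ℝ] F)‖ < 1 := by
        have hp : 0 < ‖(L.symm : F →L[ℝ] F)‖₊ := L.nnnorm_symm_pos
        have := (lt_inv_comm₀ hc0 hp).1 hcN
        have h4 : c * ‖(L.symm : F →L[ℝ] F)‖₊ < 1 := by
          calc c * ‖(L.symm : F →L[ℝ] F)‖₊ < c * c⁻¹ := by gcongr
            _ = 1 := mul_inv_cancel₀ hc0.ne'
        exact_mod_cast h4
      have h5 : ‖v‖ ≤ (c * ‖(L.symm : F →L[ℝ] F)‖) * ‖v‖ := by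
        refine h2.trans ?_
        calc ‖(L.symm : F →L[ℝ] F)‖ * ‖L v‖ ≤ ‖(L.symm : F →L[ℝ] F)‖ * (c * ‖v‖) := by gcongr
          _ = _ := by ring
      nlinarith
    obtain ⟨L', hL'⟩ := equiv_of_inj D' hinj
    exact ⟨L', hL' ▸ hD'⟩

namespace ViscousSystem

variable {r m : ℕ} {s : ViscousSystem r m}

/-- The profile equation with the constant parameter `C` as an additional unknown. -/
def augmentedField (s : ViscousSystem r m) (U₀ : BlockVec ℝ r m)
    (q : BlockVec ℝ r m × (Fin m → ℝ)) : BlockVec ℝ r m × (Fin m → ℝ) :=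
  (s.profileField U₀ q.1 q.2, 0)

theorem contDiff_augmentedField (h0 : s.H0) (h1 : s.H1) (h2 : s.H2) (U₀ : BlockVec ℝ r m) :
    ContDiff ℝ 1 (s.augmentedField U₀) :=
  ((contDiff_profileField h0 h1 h2 U₀).prodMk contDiff_const).of_le (by simp)

theorem profileField_self_zero (U₀ : BlockVec ℝ r m) : s.profileField U₀ U₀ 0 = 0 := by
  simp [profileField]

/-- The derivative of the vector field at the equilibrium: the factor vanishing there is the only one
that has to be differentiated. -/
theorem fderiv_augmentedField_apply (h0 : s.H0) (h1 : s.H1) (h2 : s.H2) (U₀ : BlockVec ℝ r m)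
    (V : BlockVec ℝ r m) (h : Fin m → ℝ) :
    fderiv ℝ (s.augmentedField U₀) (U₀, 0) (V, h) =
      (s.slopeMatrix U₀ *ᵥ (partII (s.A U₀ *ᵥ V) + s.B₂₂ U₀ *ᵥ h), 0) := by
  have hd : HasFDerivAt (s.augmentedField U₀) (fderiv ℝ (s.augmentedField U₀) (U₀, 0)) (U₀, 0) :=
    ((contDiff_augmentedField h0 h1 h2 U₀).differentiable one_ne_zero _).hasFDerivAt
  have hline : HasDerivAt (fun t : ℝ => ((U₀ + t • V, t • h) : BlockVec ℝ r m × (Fin m → ℝ)))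
      (V, h) 0 := by
    have e1 : HasDerivAt (fun t : ℝ => U₀ + t • V) V 0 := by
      simpa using ((hasDerivAt_id (0 : ℝ)).smul_const V).const_add U₀
    have e2 : HasDerivAt (fun t : ℝ => t • h) h 0 := by
      simpa using (hasDerivAt_id (0 : ℝ)).smul_const h
    exact e1.prodMk e2
  have hcomp : HasDerivAt (fun t : ℝ => s.augmentedField U₀ (U₀ + t • V, t • h))
      (fderiv ℝ (s.augmentedField U₀) (U₀, 0) (V, h)) 0 := by
    have hd' : HasFDerivAt (s.augmentedField U₀) (fderiv ℝ (s.augmentedField U₀) (U₀, 0))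
        (U₀ + (0 : ℝ) • V, (0 : ℝ) • h) := by simpa using hd
    exact hd'.comp_hasDerivAt (0 : ℝ) hline
  have hk : HasDerivAt (fun t : ℝ => partII (s.f (U₀ + t • V)) - partII (s.f U₀) +
      s.B₂₂ U₀ *ᵥ (t • h)) (partII (s.A U₀ *ᵥ V) + s.B₂₂ U₀ *ᵥ h) 0 := by
    have e1 : HasDerivAt (fun t : ℝ => U₀ + t • V) V 0 := by
      simpa using ((hasDerivAt_id (0 : ℝ)).smul_const V).const_add U₀
    have e1' : HasDerivWithinAt (fun t : ℝ => U₀ + t • V) V univ 0 := e1.hasDerivWithinAt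
    have e2 := hasDerivWithinAt_partII (hasDerivWithinAt_f h0 e1')
    rw [hasDerivWithinAt_univ] at e2
    have e3 : HasDerivAt (fun t : ℝ => s.B₂₂ U₀ *ᵥ (t • h)) (s.B₂₂ U₀ *ᵥ h) 0 := by
      simp only [Matrix.mulVec_smul]
      simpa using (hasDerivAt_id (0 : ℝ)).smul_const (s.B₂₂ U₀ *ᵥ h)
    simpa using (e2.sub_const (partII (s.f U₀))).fun_add e3
  have hM : ∀ i j, DifferentiableAt ℝ (fun t : ℝ => s.slopeMatrix (U₀ + t • V) i j) 0 := by
    intro i j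
    have := ((contDiff_slopeMatrix h0 h1 h2 i j).differentiable (by simp)) (U₀ + (0 : ℝ) • V)
    exact this.comp (0 : ℝ) (f := fun t : ℝ => U₀ + t • V) (by fun_prop)
  have hprof : HasDerivAt (fun t : ℝ => s.profileField U₀ (U₀ + t • V) (t • h))
      (s.slopeMatrix U₀ *ᵥ (partII (s.A U₀ *ᵥ V) + s.B₂₂ U₀ *ᵥ h)) 0 := by
    rw [hasDerivAt_pi]
    intro i
    simp only [profileField, Matrix.mulVec, dotProduct]
    refine HasDerivAt.fun_sum fun j _ => ?_
    have := (hM i j).hasDerivAt.fun_mul ((hasDerivAt_pi.1 hk) j)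
    simpa [Matrix.mulVec, dotProduct] using this
  exact hcomp.unique (hprof.prodMk (hasDerivAt_const _ _))

theorem snd_eq_left_of_hasDerivWithinAt {g : BlockVec ℝ r m × (Fin m → ℝ) → BlockVec ℝ r m}
    {u : ℝ → BlockVec ℝ r m × (Fin m → ℝ)}
    (h : ∀ x ∈ Icc (0 : ℝ) 1, HasDerivWithinAt u (g (u x), 0) (Icc 0 1) x) {x : ℝ}
    (hx : x ∈ Icc (0 : ℝ) 1) : (u x).2 = (u 0).2 :=
  eq_left_of_deriv_eq_zero (u := fun x => (u x).2)
    (fun t ht => ((h t ht).continuousWithinAt).snd)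
    (fun t ht => ((h t (Ioo_subset_Icc_self ht)).hasDerivAt (Icc_mem_nhds ht.1 ht.2)).snd) hx

/-- A solution of the augmented equation through `(U₀, C)` consists of the profile with parameter `C`
and the constant `C`. -/
theorem isProfile_of_odeDefect (h0 : s.H0) (h1 : s.H1) (h2 : s.H2) {U₀ : BlockVec ℝ r m}
    {C : Fin m → ℝ} {u : C(Icc (0 : ℝ) 1, BlockVec ℝ r m × (Fin m → ℝ))}
    (hu : odeDefect (contDiff_augmentedField h0 h1 h2 U₀) u = ContinuousMap.const _ (U₀, C)) :
    s.IsProfile U₀ C (fun x => (extendCurve u x).1) ∧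
      ∀ x ∈ Icc (0 : ℝ) 1, (extendCurve u x).2 = C := by
  rw [odeDefect_eq_const_iff_hasDerivWithinAt] at hu
  have hC : ∀ x ∈ Icc (0 : ℝ) 1, (extendCurve u x).2 = C := fun x hx => by
    rw [snd_eq_left_of_hasDerivWithinAt (g := fun q => s.profileField U₀ q.1 q.2) hu.2 hx, hu.1]
  refine ⟨(isProfile_iff h0 h1 h2).2 ⟨congrArg Prod.fst hu.1, fun x hx => ?_⟩, hC⟩
  have := (hu.2 x hx).fst
  rw [← hC x hx]
  exact this

theorem odeDefect_constCurve (h0 : s.H0) (h1 : s.H1) (h2 : s.H2) (U₀ : BlockVec ℝ r m) :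
    odeDefect (contDiff_augmentedField h0 h1 h2 U₀) (constCurve (U₀, 0)) =
      ContinuousMap.const _ (U₀, 0) := by
  rw [odeDefect_eq_const_iff_hasDerivWithinAt]
  refine ⟨rfl, fun x _ => ?_⟩
  have : s.augmentedField U₀ (extendCurve (constCurve (U₀, (0 : Fin m → ℝ))) x) = 0 := by
    change s.augmentedField U₀ (U₀, 0) = 0
    rw [augmentedField, profileField_self_zero]
    rfl
  rw [this]
  exact hasDerivWithinAt_const x _ (U₀, (0 : Fin m → ℝ))

/-- The evaluation of the second block of the state at `x = 1`. -/
def endpointCLM (r m : ℕ) :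
    C(Icc (0 : ℝ) 1, BlockVec ℝ r m × (Fin m → ℝ)) →L[ℝ] (Fin m → ℝ) :=
  ContinuousLinearMap.pi fun i => ContinuousLinearMap.proj (Sum.inr i) ∘L
    ContinuousLinearMap.fst ℝ (BlockVec ℝ r m) (Fin m → ℝ) ∘L
      ContinuousMap.evalCLM ℝ (1 : Icc (0 : ℝ) 1)

theorem endpointCLM_apply (u : C(Icc (0 : ℝ) 1, BlockVec ℝ r m × (Fin m → ℝ))) :
    endpointCLM r m u = partII (u 1).1 := rfl

/-- Nonresonance: if the linearization at the constant state `U₀` has a solution `(y, h)` with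
`y(0) = 0` and `y_II(1) = 0`, then the parameter `h` vanishes, by the energy inequality. -/
theorem parameter_eq_zero_of_linearized (h0 : s.H0) (h1 : s.H1) (h2 : s.H2) (h3 : s.H3)
    (U₀ : BlockVec ℝ r m) {h : Fin m → ℝ} {y : ℝ → BlockVec ℝ r m}
    (hy : ∀ x ∈ Icc (0 : ℝ) 1, HasDerivWithinAt y
      (s.slopeMatrix U₀ *ᵥ (partII (s.A U₀ *ᵥ y x) + s.B₂₂ U₀ *ᵥ h)) (Icc 0 1) x)
    (hy0 : y 0 = 0) (hy1 : partII (y 1) = 0) : h = 0 := by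
  obtain ⟨S, hS⟩ := exists_isSymmetrizer h2 h3
  obtain ⟨κ, c, ρ, hκ, hκ1, hc, hρ, hE⟩ := hS.exists_energy_inequality h0 U₀
  set y' : ℝ → BlockVec ℝ r m := fun x =>
    s.slopeMatrix U₀ *ᵥ (partII (s.A U₀ *ᵥ y x) + s.B₂₂ U₀ *ᵥ h) with hy'
  have hyc : ContinuousOn y (Icc 0 1) := fun x hx => (hy x hx).continuousWithinAt
  have hcc : Continuous fun V : BlockVec ℝ r m =>
      s.slopeMatrix U₀ *ᵥ (partII (s.A U₀ *ᵥ V) + s.B₂₂ U₀ *ᵥ h) := by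
    have := continuous_partII (r := r) (m := m)
    fun_prop
  have hyp : IsPrimitive y y' := IsPrimitive.of_hasDerivWithinAt hy (hcc.comp_continuousOn hyc)
  have hchar : ∀ x, partI (s.A U₀ *ᵥ y' x) = 0 ∧
      s.B₂₂ U₀ *ᵥ partII (y' x) = partII (s.A U₀ *ᵥ y x) + s.B₂₂ U₀ *ᵥ h := fun x =>
    (eq_slopeMatrix_mulVec_iff h1 h2 U₀ (y' x) _).1 rfl
  have hdx : ∀ x ∈ Icc (0 : ℝ) 1, dx (fun _ : ℝ => U₀) x = 0 := fun x hx =>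
    dx_eq hx (hasDerivWithinAt_const x _ U₀)
  have hAI : ∀ x ∈ Icc (0 : ℝ) 1, partI (s.A U₀ *ᵥ y x) = 0 := by
    intro x hx
    have hp : IsPrimitive (fun x => s.A U₀ *ᵥ y x) (fun x => s.A U₀ *ᵥ y' x) := by
      simpa using IsPrimitive.mulVec (M := fun _ => s.A U₀) (M' := fun _ => 0)
        (fun i j => IsPrimitive.const _) hyp
    ext i
    have := (IsPrimitive.pi_iff.1 hp (Sum.inl i)).2 x hx
    have hz : ∀ t, (s.A U₀ *ᵥ y' t) (Sum.inl i) = 0 := fun t => congrFun (hchar t).1 i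
    simp only [hz, hy0, Matrix.mulVec_zero, intervalIntegral.integral_zero] at this
    rw [Pi.zero_apply, zero_add] at this
    exact this
  have hflux : EqOn (fun x => s.realFlux U₀ (dx (fun _ : ℝ => U₀) x) (y x) (y' x))
      (fun _ => embII (s.B₂₂ U₀ *ᵥ h)) (Icc 0 1) := by
    intro x hx
    simp only [hdx x hx, realFlux, Matrix.mulVec_zero, add_zero]
    ext (i | i)
    · have := congrFun (hAI x hx) i
      simp only [partI, Pi.zero_apply] at this
      simp [B_mulVec_inl, this, embII]
    · have := congrFun (hchar x).2 i
      simp only [Pi.add_apply, partII] at this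
      rw [Pi.sub_apply, B_mulVec_inr]
      simp only [embII, Sum.elim_inr]
      rw [show (s.B₂₂ U₀ *ᵥ partII (y' x)) i = _ from this]
      ring
  -- the flux is constant, so that the energy inequality holds with zero source and gives `y = 0`
  have hEy := hE (fun _ => U₀) contDiffOn_const (fun x _ => by simpa using hρ.le)
    (fun x hx => by rw [hdx x hx]; simpa using hρ.le) y y' (fun _ => 0) hyp
    ((IsPrimitive.const _).congr hflux) hy0 hy1
  simp only [Matrix.mulVec_zero, dotProduct_zero, mul_zero, add_zero] at hEy
  have hcont : ContinuousOn (fun x => c * ‖y x‖ ^ 2) (Icc 0 1) :=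
    continuousOn_const.mul (hyc.norm.pow 2)
  have hyzero : ∀ x ∈ Icc (0 : ℝ) 1, y x = 0 := by
    intro x hx
    by_contra hne
    have hpos := intervalIntegral.integral_pos zero_lt_one hcont
      (fun t _ => by positivity) ⟨x, hx, by have := norm_pos_iff.2 hne; positivity⟩
    linarith
  have hd0 : HasDerivWithinAt y 0 (Icc 0 1) 0 :=
    (hasDerivWithinAt_const (0 : ℝ) _ (0 : BlockVec ℝ r m)).congr hyzero hy0
  have hy'0 : y' 0 = 0 := (dx_eq (by simp) (hy 0 (by simp))).symm.trans (dx_eq (by simp) hd0)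
  have h4 := (hchar 0).2
  have hz : partII (0 : BlockVec ℝ r m) = 0 := rfl
  rw [hy'0, hy0, Matrix.mulVec_zero, hz, Matrix.mulVec_zero, zero_add] at h4
  have := congrArg (fun w => (s.B₂₂ U₀)⁻¹ *ᵥ w) h4
  simpa [Matrix.mulVec_mulVec, Matrix.nonsing_inv_mul _ (h1.isUnit_det U₀)] using this.symm

/-- The shooting map `C ↦ W_II(1)` near `C = 0`: profiles exist, depend differentiably on `C`, stay
close to `U₀`, and `C ↦ W_II(1)` is a local diffeomorphism. -/
theorem exists_shooting (h0 : s.H0) (h1 : s.H1) (h2 : s.H2) (h3 : s.H3) (U₀ : BlockVec ℝ r m) :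
    ∃ (ρ : ℝ) (w : (Fin m → ℝ) → ℝ → BlockVec ℝ r m), 0 < ρ ∧
      (∀ C, ‖C‖ < ρ → s.IsProfile U₀ C (w C)) ∧
      InjOn (fun C => partII (w C 1)) (Metric.ball 0 ρ) ∧
      (∀ C, ‖C‖ < ρ → ∃ L : (Fin m → ℝ) ≃L[ℝ] (Fin m → ℝ),
        HasFDerivAt (fun C => partII (w C 1)) (L : (Fin m → ℝ) →L[ℝ] (Fin m → ℝ)) C) ∧
      (∀ τ > (0 : ℝ), ∃ δ > (0 : ℝ), ∀ U₁ : Fin m → ℝ, ‖U₁ - partII U₀‖ ≤ δ →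
        ∃ C, ‖C‖ < τ ∧ partII (w C 1) = U₁) ∧
      (∀ ε > (0 : ℝ), ∃ τ > (0 : ℝ), ∀ C, ‖C‖ < τ → ∀ x ∈ Icc (0 : ℝ) 1,
        ‖w C x - U₀‖ ≤ ε ∧ ‖dx (w C) x‖ ≤ ε) := by
  have hG := contDiff_augmentedField h0 h1 h2 U₀
  have hbase := odeDefect_constCurve h0 h1 h2 U₀
  set σ : (Fin m → ℝ) → C(Icc (0 : ℝ) 1, BlockVec ℝ r m × (Fin m → ℝ)) :=
    fun C => solutionCurve hG (U₀, C) with hσ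
  set w : (Fin m → ℝ) → ℝ → BlockVec ℝ r m := fun C x => (extendCurve (σ C) x).1 with hw
  have hw1 : (fun C => partII (w C 1)) = fun C => endpointCLM r m (σ C) := by
    ext C : 1
    rw [endpointCLM_apply, ← extendCurve_coe]
    rfl
  have hσ0 : σ 0 = constCurve (U₀, 0) := solutionCurve_eq hG hbase
  -- strict differentiability at every parameter whose profile reaches `x = 1`
  have hstrict : ∀ C, odeDefect hG (σ C) = ContinuousMap.const _ (U₀, C) →
      HasStrictFDerivAt σ ((((volterraEquiv ((⟨fderiv ℝ (s.augmentedField U₀),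
        hG.continuous_fderiv one_ne_zero⟩ : C(_, _)).comp (σ C))).symm :
        C(Icc (0 : ℝ) 1, BlockVec ℝ r m × (Fin m → ℝ)) →L[ℝ] _) ∘L constCurve) ∘L
          ContinuousLinearMap.inr ℝ (BlockVec ℝ r m) (Fin m → ℝ)) C := fun C hC =>
    HasStrictFDerivAt.comp C (hasStrictFDerivAt_solutionCurve hG hC).2
      ((hasStrictFDerivAt_const U₀ C).prodMk (hasStrictFDerivAt_id C))
  have hbase' : odeDefect hG (σ 0) = ContinuousMap.const _ (U₀, 0) := by rw [hσ0]; exact hbase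
  have hex : ∀ᶠ C in 𝓝 (0 : Fin m → ℝ), odeDefect hG (σ C) = ContinuousMap.const _ (U₀, C) :=
    (Continuous.tendsto (f := fun C : Fin m → ℝ => ((U₀, C) : BlockVec ℝ r m × (Fin m → ℝ)))
      (by fun_prop) 0).eventually (hasStrictFDerivAt_solutionCurve hG hbase).1
  have he0 := (endpointCLM r m).hasStrictFDerivAt.comp (0 : Fin m → ℝ) (hstrict 0 hbase')
  -- the kernel of the derivative at `C = 0` consists of solutions of the linearized profile equation
  have hinj : Function.Injective (endpointCLM r m ∘L
      ((((volterraEquiv ((⟨fderiv ℝ (s.augmentedField U₀),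
        hG.continuous_fderiv one_ne_zero⟩ : C(_, _)).comp (σ 0))).symm :
        C(Icc (0 : ℝ) 1, BlockVec ℝ r m × (Fin m → ℝ)) →L[ℝ] _) ∘L constCurve) ∘L
          ContinuousLinearMap.inr ℝ (BlockVec ℝ r m) (Fin m → ℝ))) := by
    rw [injective_iff_map_eq_zero]
    intro h hh
    set M := ((⟨fderiv ℝ (s.augmentedField U₀),
        hG.continuous_fderiv one_ne_zero⟩ : C(_, _)).comp (σ 0)) with hM
    set y := (volterraEquiv M).symm (constCurve ((0 : BlockVec ℝ r m), h)) with hy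
    have hyend : partII (y 1).1 = 0 := hh
    have heq : y - integrateCurve (applyCurve M y) = constCurve ((0 : BlockVec ℝ r m), h) := by
      have := (volterraEquiv M).apply_symm_apply (constCurve ((0 : BlockVec ℝ r m), h))
      rw [← hy] at this
      rw [← this]
      exact (DFunLike.congr_fun (coe_volterraEquiv M) y).symm
    have hMx : ∀ (x : Icc (0 : ℝ) 1) V k, M x (V, k) =
        (s.slopeMatrix U₀ *ᵥ (partII (s.A U₀ *ᵥ V) + s.B₂₂ U₀ *ᵥ k), 0) := by
      intro x V k
      rw [← fderiv_augmentedField_apply h0 h1 h2 U₀ V k, hM, ContinuousMap.comp_apply, hσ0]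
      rfl
    have hint : ∀ x ∈ Icc (0 : ℝ) 1, extendCurve y x = ((0 : BlockVec ℝ r m), h) +
        ∫ t in (0 : ℝ)..x, extendCurve (applyCurve M y) t := by
      intro x hx
      have := DFunLike.congr_fun heq ⟨x, hx⟩
      rw [ContinuousMap.sub_apply, integrateCurve_apply, sub_eq_iff_eq_add] at this
      rw [extendCurve, IccExtend_of_mem _ _ hx, this]
      rfl
    have hder : ∀ x ∈ Icc (0 : ℝ) 1, HasDerivWithinAt (extendCurve y)
        (s.slopeMatrix U₀ *ᵥ (partII (s.A U₀ *ᵥ (extendCurve y x).1) +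
          s.B₂₂ U₀ *ᵥ (extendCurve y x).2), 0) (Icc 0 1) x := by
      intro x hx
      have hc := continuous_extendCurve (applyCurve M y)
      have h5 : HasDerivAt (fun x => ((0 : BlockVec ℝ r m), h) +
          ∫ t in (0 : ℝ)..x, extendCurve (applyCurve M y) t)
          (extendCurve (applyCurve M y) x) x :=
        (intervalIntegral.integral_hasDerivAt_right (hc.intervalIntegrable _ _)
          (hc.stronglyMeasurableAtFilter _ _) hc.continuousAt).const_add _
      have h6 : extendCurve (applyCurve M y) x =
          (s.slopeMatrix U₀ *ᵥ (partII (s.A U₀ *ᵥ (extendCurve y x).1) +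
          s.B₂₂ U₀ *ᵥ (extendCurve y x).2), 0) := hMx _ _ _
      rw [← h6]
      exact h5.hasDerivWithinAt.congr hint (hint x hx)
    have hy0 : extendCurve y 0 = ((0 : BlockVec ℝ r m), h) := by
      simpa using hint 0 (by simp)
    have hsnd : ∀ x ∈ Icc (0 : ℝ) 1, (extendCurve y x).2 = h := fun x hx => by
      rw [snd_eq_left_of_hasDerivWithinAt (g := fun q => s.slopeMatrix U₀ *ᵥ (partII (s.A U₀ *ᵥ q.1) +
          s.B₂₂ U₀ *ᵥ q.2)) hder hx, hy0]
    refine parameter_eq_zero_of_linearized h0 h1 h2 h3 U₀ (y := fun x => (extendCurve y x).1)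
      (fun x hx => ?_) (by rw [hy0]) ?_
    · have := (hder x hx).fst
      rwa [hsnd x hx] at this
    · rw [← hyend, ← extendCurve_coe]
      rfl
  have hdiff : ∀ᶠ C in 𝓝 (0 : Fin m → ℝ),
      DifferentiableAt ℝ (fun C => endpointCLM r m (σ C)) C :=
    hex.mono fun C hC => ((endpointCLM r m).hasStrictFDerivAt.comp C
      (hstrict C hC)).hasFDerivAt.differentiableAt
  obtain ⟨ρ₁, hρ₁, hinjOn, hequiv, hmap⟩ := he0.exists_ball_injOn_and_equiv hinj hdiff
  obtain ⟨ρ₂, hρ₂, hball₂⟩ := Metric.eventually_nhds_iff_ball.1 hex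
  have hend0 : endpointCLM r m (σ 0) = partII U₀ := by rw [hσ0]; rfl
  have hprofile : ∀ C, ‖C‖ < ρ₂ → s.IsProfile U₀ C (w C) ∧
      ∀ x ∈ Icc (0 : ℝ) 1, (extendCurve (σ C) x).2 = C := fun C hC =>
    isProfile_of_odeDefect h0 h1 h2 (hball₂ C (by simpa using hC))
  refine ⟨min ρ₁ ρ₂, w, lt_min hρ₁ hρ₂, fun C hC =>
    (hprofile C (hC.trans_le (min_le_right _ _))).1, ?_, fun C hC => ?_, fun τ hτ => ?_,
    fun ε hε => ?_⟩
  · rw [hw1]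
    exact hinjOn.mono (Metric.ball_subset_ball (min_le_left _ _))
  · rw [hw1]
    exact hequiv C (by simpa using hC.trans_le (min_le_left _ _))
  · have h5 : (fun C => endpointCLM r m (σ C)) '' Metric.ball 0 τ ∈ 𝓝 (partII U₀) := by
      rw [← hend0]
      have := image_mem_map (m := fun C => endpointCLM r m (σ C)) (Metric.ball_mem_nhds 0 hτ)
      rw [← hmap]
      exact this
    obtain ⟨δ, hδ, hsub⟩ := Metric.nhds_basis_closedBall.mem_iff.1 h5
    refine ⟨δ, hδ, fun U₁ hU₁ => ?_⟩
    obtain ⟨C, hC, hCe⟩ := hsub (by rwa [mem_closedBall_iff_norm])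
    exact ⟨C, by simpa using hC, (congrFun hw1 C).trans hCe⟩
  · have hf0 : Tendsto (s.augmentedField U₀) (𝓝 (U₀, 0)) (𝓝 0) := by
      have := hG.continuous.tendsto (U₀, (0 : Fin m → ℝ))
      rwa [augmentedField, profileField_self_zero] at this
    obtain ⟨τ₁, hτ₁, hball₁⟩ := Metric.eventually_nhds_iff_ball.1
      (hf0.eventually (Metric.closedBall_mem_nhds 0 hε))
    have hσc : ContinuousAt σ 0 := (hstrict 0 hbase').hasFDerivAt.continuousAt
    have hmin : 0 < min τ₁ ε := lt_min hτ₁ hε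
    obtain ⟨τ, hτ, hballτ⟩ := Metric.eventually_nhds_iff_ball.1
      (hσc.eventually (Metric.ball_mem_nhds (σ 0) hmin))
    refine ⟨min τ ρ₂, lt_min hτ hρ₂, fun C hC x hx => ?_⟩
    obtain ⟨hprof, hsnd⟩ := hprofile C (hC.trans_le (min_le_right _ _))
    have h6 : dist (σ C) (σ 0) < min τ₁ ε :=
      hballτ C (by simpa using hC.trans_le (min_le_left _ _))
    have h7 : dist (w C x, C) (U₀, (0 : Fin m → ℝ)) < min τ₁ ε := by
      refine lt_of_le_of_lt ?_ h6
      have h8 := ContinuousMap.dist_apply_le_dist (f := σ C) (g := σ 0) ⟨x, hx⟩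
      rw [hσ0] at h8 ⊢
      have h9 : (w C x, C) = σ C ⟨x, hx⟩ := by
        rw [← extendCurve_coe]
        exact Prod.ext rfl (hsnd x hx).symm
      rw [h9]
      exact h8
    refine ⟨?_, ?_⟩
    · rw [← dist_eq_norm]
      exact (le_max_left _ _).trans (h7.le.trans (min_le_right _ _))
    · rw [hprof.dx_eq_profileField h0 h1 h2 hx]
      have h10 := hball₁ (w C x, C) (h7.trans_le (min_le_left _ _))
      rw [dist_zero_right] at h10
      exact (norm_fst_le (s.augmentedField U₀ (w C x, C))).trans h10

end ViscousSystem

/-! ### Complex valued `H¹` functions on `(0,1)` -/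

instance : IsFiniteMeasure ViscousSystem.unitMeasure := by
  unfold ViscousSystem.unitMeasure
  infer_instance

namespace ViscousSystem

variable {r m : ℕ} {s : ViscousSystem r m}

theorem intervalIntegrable_iff_integrable_unitMeasure {E : Type*} [NormedAddCommGroup E]
    {u : ℝ → E} : IntervalIntegrable u volume 0 1 ↔ Integrable u unitMeasure := by
  rw [intervalIntegrable_iff_integrableOn_Ioo_of_le zero_le_one]
  rfl

theorem intervalIntegral_eq_unitMeasure {E : Type*} [NormedAddCommGroup E] [NormedSpace ℝ E]
    (u : ℝ → E) : ∫ x in (0 : ℝ)..1, u x = ∫ x, u x ∂unitMeasure := by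
  rw [intervalIntegral.integral_of_le zero_le_one, integral_Ioc_eq_integral_Ioo]
  rfl

theorem ae_unitMeasure_of_forall {P : ℝ → Prop} (h : ∀ x ∈ Icc (0 : ℝ) 1, P x) :
    ∀ᵐ x ∂unitMeasure, P x :=
  (ae_restrict_mem measurableSet_Ioo).mono fun x hx => h x (Ioo_subset_Icc_self hx)

theorem memLp_of_continuousOn {E : Type*} [NormedAddCommGroup E] {p : ENNReal}
    [SecondCountableTopologyEither ℝ E] {u : ℝ → E} (hu : ContinuousOn u (Icc 0 1)) :
    MemLp u p unitMeasure := by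
  obtain ⟨C, hC⟩ := isCompact_Icc.exists_bound_of_continuousOn hu
  exact MemLp.of_bound ((hu.mono Ioo_subset_Icc_self).aestronglyMeasurable measurableSet_Ioo) C
    (ae_unitMeasure_of_forall hC)

theorem HasH1Deriv.isPrimitive {ι : Type} [Fintype ι] {u u' : ℝ → ι → ℂ} (h : HasH1Deriv u u') :
    IsPrimitive u u' :=
  ⟨intervalIntegrable_iff_integrable_unitMeasure.2 (h.1.integrable (by norm_num)), h.2⟩

theorem HasH1Deriv.congr {ι : Type} [Fintype ι] {u u' v : ℝ → ι → ℂ} (h : HasH1Deriv u u')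
    (hv : EqOn v u (Icc 0 1)) : HasH1Deriv v u' :=
  ⟨h.1, (h.isPrimitive.congr hv).2⟩

theorem HasH1Deriv.add {ι : Type} [Fintype ι] {u u' v v' : ℝ → ι → ℂ} (hu : HasH1Deriv u u')
    (hv : HasH1Deriv v v') : HasH1Deriv (fun x => u x + v x) (fun x => u' x + v' x) :=
  ⟨hu.1.add hv.1, (hu.isPrimitive.add hv.isPrimitive).2⟩

theorem HasH1Deriv.const_smul {ι : Type} [Fintype ι] {u u' : ℝ → ι → ℂ} (hu : HasH1Deriv u u')
    (c : ℂ) : HasH1Deriv (fun x => c • u x) (fun x => c • u' x) := by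
  refine ⟨hu.1.const_smul c, fun x hx => ?_⟩
  rw [intervalIntegral.integral_smul, ← smul_add, ← hu.2 x hx]

/-- `u` is the continuous representative of a scalar `H¹(0,1)` function. -/
def IsH1 (u : ℝ → ℂ) : Prop := ∃ u', MemLp u' 2 unitMeasure ∧ IsPrimitive u u'

theorem hasH1Deriv_iff {ι : Type} [Fintype ι] {u u' : ℝ → ι → ℂ} :
    HasH1Deriv u u' ↔
      ∀ i, MemLp (fun x => u' x i) 2 unitMeasure ∧ IsPrimitive (fun x => u x i) (fun x => u' x i) := by
  constructor
  · exact fun h i => ⟨MemLp.eval h.1 i, IsPrimitive.pi_iff.1 h.isPrimitive i⟩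
  · exact fun h => ⟨MemLp.of_eval fun i => (h i).1, (IsPrimitive.pi_iff.2 fun i => (h i).2).2⟩

theorem HasH1Deriv.isH1 {ι : Type} [Fintype ι] {u u' : ℝ → ι → ℂ} (h : HasH1Deriv u u') (i : ι) :
    IsH1 (fun x => u x i) := ⟨_, hasH1Deriv_iff.1 h i⟩

theorem exists_hasH1Deriv {ι : Type} [Fintype ι] {u : ℝ → ι → ℂ} (h : ∀ i, IsH1 fun x => u x i) :
    ∃ u', HasH1Deriv u u' := by
  choose u' h' using h
  exact ⟨fun x i => u' i x, hasH1Deriv_iff.2 h'⟩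

theorem IsH1.add {u v : ℝ → ℂ} (hu : IsH1 u) (hv : IsH1 v) : IsH1 fun x => u x + v x := by
  obtain ⟨u', h1, h2⟩ := hu
  obtain ⟨v', h3, h4⟩ := hv
  exact ⟨_, h1.add h3, h2.add h4⟩

theorem IsH1.sum {ι : Type*} (t : Finset ι) {u : ι → ℝ → ℂ} (h : ∀ i ∈ t, IsH1 (u i)) :
    IsH1 fun x => ∑ i ∈ t, u i x := by
  choose! u' h1 h2 using h
  exact ⟨fun x => ∑ i ∈ t, u' i x, memLp_finsetSum t h1, IsPrimitive.sum t h2⟩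

theorem isPrimitive_of_re_im {u u' : ℝ → ℂ} (hre : IsPrimitive (fun x => (u x).re) fun x => (u' x).re)
    (him : IsPrimitive (fun x => (u x).im) fun x => (u' x).im) : IsPrimitive u u' := by
  have h1 := hre.clm_comp Complex.ofRealCLM
  have h2 := him.clm_comp (ContinuousLinearMap.smulRight (1 : ℝ →L[ℝ] ℝ) Complex.I)
  have key : ∀ w : ℂ, Complex.ofRealCLM w.re +
      ContinuousLinearMap.smulRight (1 : ℝ →L[ℝ] ℝ) Complex.I w.im = w := fun w => by
    simp [Complex.re_add_im]
  simpa only [key] using h1.add h2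

/-- Multiplication by a real `C¹` function preserves `H¹(0,1)`. -/
theorem IsH1.real_mul {c : ℝ → ℝ} {u : ℝ → ℂ} (hc : ContDiffOn ℝ 1 c (Icc 0 1)) (hu : IsH1 u) :
    IsH1 fun x => (c x : ℂ) * u x := by
  obtain ⟨u', h1, h2⟩ := hu
  have hcp : IsPrimitive c (dx c) := IsPrimitive.of_hasDerivWithinAt
    (fun x hx => hasDerivWithinAt_dx hc one_ne_zero hx) (continuousOn_dx hc le_rfl)
  refine ⟨fun x => ((dx c x : ℝ) : ℂ) * u x + (c x : ℂ) * u' x, ?_, isPrimitive_of_re_im ?_ ?_⟩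
  · refine MemLp.add (memLp_of_continuousOn ?_) ?_
    · exact (Complex.continuous_ofReal.comp_continuousOn (continuousOn_dx hc le_rfl)).mul
        h2.continuousOn
    · have hcc : ContinuousOn (fun x => (c x : ℂ)) (Icc 0 1) :=
        Complex.continuous_ofReal.comp_continuousOn hc.continuousOn
      exact h1.mul (memLp_of_continuousOn (p := ⊤) hcc)
  · simpa using hcp.mul (h2.clm_comp Complex.reCLM)
  · simpa using hcp.mul (h2.clm_comp Complex.imCLM)

theorem isH1_mulVec {ι κ : Type*} [Fintype κ] {M : ℝ → Matrix ι κ ℝ} {u : ℝ → κ → ℂ}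
    (hM : ∀ i j, ContDiffOn ℝ 1 (fun x => M x i j) (Icc 0 1)) (hu : ∀ j, IsH1 fun x => u x j)
    (i : ι) : IsH1 fun x => ((M x).map ((↑) : ℝ → ℂ) *ᵥ u x) i :=
  IsH1.sum _ fun j _ => (hu j).real_mul (hM i j)

/-! ### The linearized flux of complex states -/

/-- The real matrix of `V ↦ A(U) V - (dB(U) V) ξ`. -/
def fluxMatrix (s : ViscousSystem r m) (U ξ : BlockVec ℝ r m) :
    Matrix (Fin r ⊕ Fin m) (Fin r ⊕ Fin m) ℝ :=
  Matrix.of fun i k => s.A U i k - ∑ j, fderiv ℝ (fun U' => s.B U' i j) U (Pi.single k 1) * ξ j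

theorem linearizedFlux_eq (s : ViscousSystem r m) (W : ℝ → BlockVec ℝ r m)
    (v v' : ℝ → BlockVec ℂ r m) (x : ℝ) :
    s.linearizedFlux W v v' x = (s.B (W x)).map ((↑) : ℝ → ℂ) *ᵥ v' x -
      (s.fluxMatrix (W x) (dx W x)).map ((↑) : ℝ → ℂ) *ᵥ v x := by
  have h : s.dB (W x) (v x) *ᵥ (fun j => ((dx W x j : ℝ) : ℂ)) -
      (s.A (W x)).map ((↑) : ℝ → ℂ) *ᵥ v x =
      -((s.fluxMatrix (W x) (dx W x)).map ((↑) : ℝ → ℂ) *ᵥ v x) := by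
    ext i
    simp only [Matrix.mulVec, dotProduct, dB, Matrix.of_apply, fluxMatrix, Matrix.map_apply,
      Pi.sub_apply, Pi.neg_apply, Complex.ofReal_sub, Complex.ofReal_sum, Complex.ofReal_mul,
      sub_mul, Finset.sum_sub_distrib, Finset.sum_mul]
    rw [Finset.sum_comm]
    simp only [neg_sub, sub_left_inj]
    refine Finset.sum_congr rfl fun a _ => Finset.sum_congr rfl fun b _ => ?_
    ring
  rw [linearizedFlux, add_sub_assoc, h, sub_eq_add_neg]

theorem re_mulVec {ι κ : Type*} [Fintype κ] (M : Matrix ι κ ℝ) (u : κ → ℂ) :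
    (fun i => ((M.map ((↑) : ℝ → ℂ) *ᵥ u) i).re) = M *ᵥ fun j => (u j).re := by
  ext i
  simp [Matrix.mulVec, dotProduct, Complex.re_sum]

theorem im_mulVec {ι κ : Type*} [Fintype κ] (M : Matrix ι κ ℝ) (u : κ → ℂ) :
    (fun i => ((M.map ((↑) : ℝ → ℂ) *ᵥ u) i).im) = M *ᵥ fun j => (u j).im := by
  ext i
  simp [Matrix.mulVec, dotProduct, Complex.im_sum]

theorem realFlux_eq (s : ViscousSystem r m) (U ξ V q : BlockVec ℝ r m) :
    s.realFlux U ξ V q = s.B U *ᵥ q - s.fluxMatrix U ξ *ᵥ V := by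
  have h : s.dBReal U V *ᵥ ξ - s.A U *ᵥ V = -(s.fluxMatrix U ξ *ᵥ V) := by
    ext i
    simp only [Matrix.mulVec, dotProduct, dBReal, Matrix.of_apply, fluxMatrix,
      Pi.sub_apply, Pi.neg_apply, sub_mul, Finset.sum_sub_distrib, Finset.sum_mul]
    rw [Finset.sum_comm]
    simp only [neg_sub, sub_left_inj]
    refine Finset.sum_congr rfl fun a _ => Finset.sum_congr rfl fun b _ => ?_
    ring
  rw [realFlux, add_sub_assoc, h, sub_eq_add_neg]

theorem re_linearizedFlux (s : ViscousSystem r m) (W : ℝ → BlockVec ℝ r m)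
    (v v' : ℝ → BlockVec ℂ r m) (x : ℝ) :
    (fun i => (s.linearizedFlux W v v' x i).re) =
      s.realFlux (W x) (dx W x) (fun i => (v x i).re) (fun i => (v' x i).re) := by
  rw [linearizedFlux_eq, realFlux_eq, ← re_mulVec, ← re_mulVec]
  ext i
  simp

theorem im_linearizedFlux (s : ViscousSystem r m) (W : ℝ → BlockVec ℝ r m)
    (v v' : ℝ → BlockVec ℂ r m) (x : ℝ) :
    (fun i => (s.linearizedFlux W v v' x i).im) =
      s.realFlux (W x) (dx W x) (fun i => (v x i).im) (fun i => (v' x i).im) := by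
  rw [linearizedFlux_eq, realFlux_eq, ← im_mulVec, ← im_mulVec]
  ext i
  simp

end ViscousSystem

/-! ### The resolvent estimate -/

namespace ViscousSystem

variable {r m : ℕ} {s : ViscousSystem r m}

/-- The vector of real parts. -/
def reVec {ι : Type*} (u : ι → ℂ) : ι → ℝ := fun i => (u i).re

/-- The vector of imaginary parts. -/
def imVec {ι : Type*} (u : ι → ℂ) : ι → ℝ := fun i => (u i).im

theorem norm_reVec_le {ι : Type*} [Fintype ι] (u : ι → ℂ) : ‖reVec u‖ ≤ ‖u‖ :=
  (pi_norm_le_iff_of_nonneg (norm_nonneg _)).2 fun i =>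
    (Complex.abs_re_le_norm (u i)).trans (norm_le_pi_norm u i)

theorem norm_imVec_le {ι : Type*} [Fintype ι] (u : ι → ℂ) : ‖imVec u‖ ≤ ‖u‖ :=
  (pi_norm_le_iff_of_nonneg (norm_nonneg _)).2 fun i =>
    (Complex.abs_im_le_norm (u i)).trans (norm_le_pi_norm u i)

theorem norm_le_reVec_add_imVec {ι : Type*} [Fintype ι] (u : ι → ℂ) :
    ‖u‖ ≤ ‖reVec u‖ + ‖imVec u‖ :=
  (pi_norm_le_iff_of_nonneg (by positivity)).2 fun i =>
    (Complex.norm_le_abs_re_add_abs_im (u i)).trans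
      (add_le_add (norm_le_pi_norm (reVec u) i) (norm_le_pi_norm (imVec u) i))

theorem abs_dotProduct_mulVec_le {ι κ : Type*} [Fintype ι] [Fintype κ] (M : Matrix ι κ ℝ)
    (a : ι → ℝ) (b : κ → ℝ) : |a ⬝ᵥ M *ᵥ b| ≤ (∑ i, ∑ j, |M i j|) * ‖a‖ * ‖b‖ := by
  simp only [dotProduct, Matrix.mulVec, Finset.mul_sum, Finset.sum_mul]
  refine (Finset.abs_sum_le_sum_abs _ _).trans (Finset.sum_le_sum fun i _ => ?_)
  refine (Finset.abs_sum_le_sum_abs _ _).trans (Finset.sum_le_sum fun j _ => ?_)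
  rw [abs_mul, abs_mul]
  calc |a i| * (|M i j| * |b j|) ≤ ‖a‖ * (|M i j| * ‖b‖) := by
        gcongr
        · exact norm_le_pi_norm a i
        · exact norm_le_pi_norm b j
    _ = |M i j| * ‖a‖ * ‖b‖ := by ring

theorem _root_.IsPrimitive.reVec {ι : Type*} [Fintype ι] {u u' : ℝ → ι → ℂ} (h : IsPrimitive u u') :
    IsPrimitive (fun x => ViscousSystem.reVec (u x)) (fun x => ViscousSystem.reVec (u' x)) :=
  IsPrimitive.pi_iff.2 fun i => (IsPrimitive.pi_iff.1 h i).clm_comp Complex.reCLM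

theorem _root_.IsPrimitive.imVec {ι : Type*} [Fintype ι] {u u' : ℝ → ι → ℂ} (h : IsPrimitive u u') :
    IsPrimitive (fun x => ViscousSystem.imVec (u x)) (fun x => ViscousSystem.imVec (u' x)) :=
  IsPrimitive.pi_iff.2 fun i => (IsPrimitive.pi_iff.1 h i).clm_comp Complex.imCLM

/-- Pointwise form of the resolvent estimate: the two integrands of the energy inequality for the
real and imaginary parts of `v` add up, for `g = z v - F`, to something that controls `|v|²`. -/
theorem IsSymmetrizer.energy_integrand_lower_bound
    {S : BlockVec ℝ r m → Matrix (Fin r ⊕ Fin m) (Fin r ⊕ Fin m) ℝ} (hS : s.IsSymmetrizer S)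
    {c K θ : ℝ} (hc : 0 < c) (hθ0 : 0 ≤ θ) (hθ1 : θ ≤ 1) {U : BlockVec ℝ r m}
    (hK : ∑ i, ∑ j, |S U i j| ≤ K) {z : ℂ} (hz : 0 ≤ z.re) (v F : BlockVec ℂ r m) :
    c / 4 * ‖v‖ ^ 2 - 4 * K ^ 2 / c * ‖F‖ ^ 2 ≤
      (c * ‖reVec v‖ ^ 2 + θ * (reVec v ⬝ᵥ S U *ᵥ reVec (z • v - F))) +
        (c * ‖imVec v‖ ^ 2 + θ * (imVec v ⬝ᵥ S U *ᵥ imVec (z • v - F))) := by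
  have hre : reVec (z • v - F) = z.re • reVec v - z.im • imVec v - reVec F := by
    ext i; simp [reVec, imVec]
  have him : imVec (z • v - F) = z.re • imVec v + z.im • reVec v - imVec F := by
    ext i; simp [reVec, imVec]
  have hid : reVec v ⬝ᵥ S U *ᵥ reVec (z • v - F) + imVec v ⬝ᵥ S U *ᵥ imVec (z • v - F) =
      z.re * (reVec v ⬝ᵥ S U *ᵥ reVec v + imVec v ⬝ᵥ S U *ᵥ imVec v) -
        (reVec v ⬝ᵥ S U *ᵥ reVec F + imVec v ⬝ᵥ S U *ᵥ imVec F) := by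
    rw [hre, him]
    simp only [Matrix.mulVec_sub, Matrix.mulVec_add, Matrix.mulVec_smul, dotProduct_sub,
      dotProduct_add, dotProduct_smul, smul_eq_mul, hS.dotProduct_comm U (imVec v) (reVec v)]
    ring
  have hpos : 0 ≤ z.re * (reVec v ⬝ᵥ S U *ᵥ reVec v + imVec v ⬝ᵥ S U *ᵥ imVec v) :=
    mul_nonneg hz (add_nonneg (hS.nonneg U _) (hS.nonneg U _))
  have hK0 : 0 ≤ K := le_trans (Finset.sum_nonneg fun i _ => Finset.sum_nonneg fun j _ =>
    abs_nonneg _) hK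
  have hb : ∀ a b : BlockVec ℝ r m, ‖a‖ ≤ ‖v‖ → ‖b‖ ≤ ‖F‖ → a ⬝ᵥ S U *ᵥ b ≤ K * ‖v‖ * ‖F‖ := by
    intro a b ha hb
    refine (le_abs_self _).trans ((abs_dotProduct_mulVec_le _ _ _).trans ?_)
    gcongr
  have h1 := hb _ _ (norm_reVec_le v) (norm_reVec_le F)
  have h2 := hb _ _ (norm_imVec_le v) (norm_imVec_le F)
  have h3 : θ * (reVec v ⬝ᵥ S U *ᵥ reVec F + imVec v ⬝ᵥ S U *ᵥ imVec F) ≤ 2 * K * ‖v‖ * ‖F‖ := by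
    calc θ * (reVec v ⬝ᵥ S U *ᵥ reVec F + imVec v ⬝ᵥ S U *ᵥ imVec F)
        ≤ θ * (2 * K * ‖v‖ * ‖F‖) := by gcongr; linarith
      _ ≤ 1 * (2 * K * ‖v‖ * ‖F‖) := by gcongr
      _ = _ := one_mul _
  have h4 : ‖v‖ ^ 2 ≤ 2 * (‖reVec v‖ ^ 2 + ‖imVec v‖ ^ 2) := by
    have := norm_le_reVec_add_imVec v
    have h5 : ‖v‖ ^ 2 ≤ (‖reVec v‖ + ‖imVec v‖) ^ 2 := by gcongr
    nlinarith [sq_nonneg (‖reVec v‖ - ‖imVec v‖)]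
  -- Young's inequality
  have h5 : 2 * K * ‖v‖ * ‖F‖ ≤ c / 4 * ‖v‖ ^ 2 + 4 * K ^ 2 / c * ‖F‖ ^ 2 := by
    have h6 : c / 4 * ‖v‖ ^ 2 + 4 * K ^ 2 / c * ‖F‖ ^ 2 - 2 * K * ‖v‖ * ‖F‖ =
        (c * ‖v‖ - 4 * K * ‖F‖) ^ 2 / (4 * c) := by
      field_simp
      ring
    have h7 : 0 ≤ (c * ‖v‖ - 4 * K * ‖F‖) ^ 2 / (4 * c) := by positivity
    linarith
  have h6 := mul_nonneg hθ0 hpos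
  have h7 : θ * (reVec v ⬝ᵥ S U *ᵥ reVec (z • v - F)) + θ * (imVec v ⬝ᵥ S U *ᵥ imVec (z • v - F)) =
      θ * (z.re * (reVec v ⬝ᵥ S U *ᵥ reVec v + imVec v ⬝ᵥ S U *ᵥ imVec v)) -
        θ * (reVec v ⬝ᵥ S U *ᵥ reVec F + imVec v ⬝ᵥ S U *ᵥ imVec F) := by
    rw [← mul_add, hid, mul_sub]
  nlinarith

/-- The norm of `L²` integrates the sup norm of `ℂ^r × ℂ^m`. -/
theorem norm_sq_L2 (V : L2 r m) : ‖V‖ ^ 2 = ∫ x, ‖V x‖ ^ 2 ∂unitMeasure := by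
  have h := (Lp.memLp V).eLpNorm_eq_integral_rpow_norm (by norm_num) (by norm_num)
  rw [Lp.norm_def, h, ENNReal.toReal_ofReal (by positivity)]
  simp only [ENNReal.toReal_ofNat]
  rw [← Real.rpow_natCast, ← Real.rpow_mul (integral_nonneg fun x => by positivity)]
  norm_num

/-- The resolvent estimate in `Re z ≥ 0` for the linearized operator about a curve close to the
constant `U₀`: the energy inequality for the real and imaginary parts, which both solve the real
linearized equation, with `z V - F` for the derivative of the flux. -/
theorem IsSymmetrizer.exists_resolvent_estimate (h0 : s.H0)
    {S : BlockVec ℝ r m → Matrix (Fin r ⊕ Fin m) (Fin r ⊕ Fin m) ℝ} (hS : s.IsSymmetrizer S)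
    (U₀ : BlockVec ℝ r m) :
    ∃ ρ : ℝ, 0 < ρ ∧ ∀ W : ℝ → BlockVec ℝ r m, ContDiffOn ℝ 1 W (Icc 0 1) →
      (∀ x ∈ Icc (0 : ℝ) 1, ‖W x - U₀‖ ≤ ρ) → (∀ x ∈ Icc (0 : ℝ) 1, ‖dx W x‖ ≤ ρ) →
      ∃ K : ℝ, ∀ z : ℂ, 0 ≤ z.re → ∀ V G : L2 r m, (V, G) ∈ s.linearizedGraph W →
        ‖V‖ ≤ K * ‖z • V - G‖ := by
  obtain ⟨κ, c, ρ, hκ, hκ1, hc, hρ, hE⟩ := hS.exists_energy_inequality h0 U₀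
  refine ⟨ρ, hρ, fun W hW hWU hWx => ?_⟩
  have hScont : ∀ i j, ContinuousOn (fun x => S (W x) i j) (Icc 0 1) := fun i j =>
    (hS.contDiff i j).continuous.comp_continuousOn hW.continuousOn
  obtain ⟨K, hK⟩ : ∃ K, ∀ x ∈ Icc (0 : ℝ) 1, ∑ i, ∑ j, |S (W x) i j| ≤ K := by
    obtain ⟨K, hK⟩ := isCompact_Icc.exists_bound_of_continuousOn
      (f := fun x => ∑ i, ∑ j, |S (W x) i j|)
      (continuousOn_finsetSum _ fun i _ => continuousOn_finsetSum _ fun j _ => (hScont i j).abs)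
    exact ⟨K, fun x hx => (le_abs_self _).trans (hK x hx)⟩
  have hK0 : 0 ≤ K := le_trans (Finset.sum_nonneg fun i _ => Finset.sum_nonneg fun j _ =>
    abs_nonneg _) (hK 0 (by simp))
  refine ⟨4 * K / c, ?_⟩
  rintro z hz V G ⟨v, v', g, w, hVv, hGg, hv, -, hv0, hv1, hflux⟩
  simp only at hVv hGg
  have hre := hE W hW hWU hWx (fun x => reVec (v x)) (fun x => reVec (v' x)) (fun x => reVec (g x))
    (IsPrimitive.reVec hv.isPrimitive) (by
      have := IsPrimitive.reVec hflux.isPrimitive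
      rwa [show (fun x => reVec (s.linearizedFlux W v v' x)) = fun x =>
        s.realFlux (W x) (dx W x) (reVec (v x)) (reVec (v' x)) from
          funext (re_linearizedFlux s W v v')] at this)
    (by ext i; simp [reVec, hv0]) (by
      ext i; have := congrFun hv1 i; simp only [partII] at this; simp [partII, reVec, this])
  have him := hE W hW hWU hWx (fun x => imVec (v x)) (fun x => imVec (v' x)) (fun x => imVec (g x))
    (IsPrimitive.imVec hv.isPrimitive) (by
      have := IsPrimitive.imVec hflux.isPrimitive
      rwa [show (fun x => imVec (s.linearizedFlux W v v' x)) = fun x =>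
        s.realFlux (W x) (dx W x) (imVec (v x)) (imVec (v' x)) from
          funext (im_linearizedFlux s W v v')] at this)
    (by ext i; simp [imVec, hv0]) (by
      ext i; have := congrFun hv1 i; simp only [partII] at this; simp [partII, imVec, this])
  have hint : ∀ {V g : ℝ → BlockVec ℝ r m}, ContinuousOn V (Icc 0 1) →
      IntervalIntegrable g volume 0 1 → IntervalIntegrable
      (fun x => c * ‖V x‖ ^ 2 + (1 - κ * x) * (V x ⬝ᵥ S (W x) *ᵥ g x)) volume 0 1 := by
    intro V g hV hg
    refine IntervalIntegrable.add (ContinuousOn.intervalIntegrable ?_) ?_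
    · rw [uIcc_of_le zero_le_one]
      exact continuousOn_const.mul (hV.norm.pow 2)
    · exact (intervalIntegrable_dotProduct_mulVec hV hScont hg).continuousOn_mul (by fun_prop)
  have hire := hint (IsPrimitive.reVec hv.isPrimitive).continuousOn
    (IsPrimitive.reVec hflux.isPrimitive).1
  have hiim := hint (IsPrimitive.imVec hv.isPrimitive).continuousOn
    (IsPrimitive.imVec hflux.isPrimitive).1
  have hsum := add_nonpos hre him
  rw [← intervalIntegral.integral_add hire hiim, intervalIntegral_eq_unitMeasure] at hsum
  have hvI : Integrable (fun x => ‖V x‖ ^ 2) unitMeasure :=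
    (Lp.memLp V).integrable_norm_pow two_ne_zero
  have hFI : Integrable (fun x => ‖(z • V - G) x‖ ^ 2) unitMeasure :=
    (Lp.memLp (z • V - G)).integrable_norm_pow two_ne_zero
  have hFae : (z • V - G : L2 r m) =ᵐ[unitMeasure] fun x => z • v x - g x := by
    filter_upwards [Lp.coeFn_sub (z • V) G, Lp.coeFn_smul z V, hVv, hGg] with x e1 e2 e3 e4
    rw [e1, Pi.sub_apply, e2, Pi.smul_apply, e3, e4]
  have hmono := integral_mono_ae (μ := unitMeasure)
    (f := fun x => c / 4 * ‖V x‖ ^ 2 - 4 * K ^ 2 / c * ‖(z • V - G) x‖ ^ 2)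
    ((hvI.const_mul _).sub (hFI.const_mul _))
    (intervalIntegrable_iff_integrable_unitMeasure.1 (hire.add hiim)) (by
      filter_upwards [hVv, hFae, ae_unitMeasure_of_forall (P := fun x => x ∈ Icc (0 : ℝ) 1)
        (fun x hx => hx)] with x e1 e2 hx
      have := hS.energy_integrand_lower_bound hc (θ := 1 - κ * x) (by nlinarith [hx.1, hx.2])
        (by nlinarith [hx.1]) (hK x hx) hz (v x) (z • v x - g x)
      rw [sub_sub_cancel] at this
      simp only [e1, e2]
      exact this)
  rw [integral_sub (hvI.const_mul _) (hFI.const_mul _), integral_const_mul, integral_const_mul,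
    ← norm_sq_L2, ← norm_sq_L2] at hmono
  have hfin : c / 4 * ‖V‖ ^ 2 ≤ 4 * K ^ 2 / c * ‖z • V - G‖ ^ 2 := by linarith [hmono.trans hsum]
  have h8 : ‖V‖ ^ 2 ≤ (4 * K / c * ‖z • V - G‖) ^ 2 := by
    have : (4 * K / c * ‖z • V - G‖) ^ 2 = 4 / c * (4 * K ^ 2 / c * ‖z • V - G‖ ^ 2) := by
      field_simp
    rw [this]
    calc ‖V‖ ^ 2 = 4 / c * (c / 4 * ‖V‖ ^ 2) := by field_simp
      _ ≤ _ := by gcongr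
  exact (sq_le_sq₀ (norm_nonneg _) (by positivity)).1 h8

end ViscousSystem

/-! ### The resolvent equation as a first order system -/

namespace ViscousSystem

variable {r m : ℕ} {s : ViscousSystem r m}

theorem map_mulVec_inv_mulVec {n : Type*} [Fintype n] [DecidableEq n] {M : Matrix n n ℝ}
    (hM : IsUnit M.det) (u : n → ℂ) :
    M.map ((↑) : ℝ → ℂ) *ᵥ (M⁻¹.map ((↑) : ℝ → ℂ) *ᵥ u) = u := by
  have h : M.map ((↑) : ℝ → ℂ) * M⁻¹.map ((↑) : ℝ → ℂ) = (M * M⁻¹).map ((↑) : ℝ → ℂ) :=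
    (Matrix.map_mul (f := Complex.ofRealHom)).symm
  rw [Matrix.mulVec_mulVec, h, Matrix.mul_nonsing_inv _ hM,
    Matrix.map_one _ Complex.ofReal_zero Complex.ofReal_one, Matrix.one_mulVec]

/-- The state `v` determined by `v_II = a` and `(N v)_I = -P_I`, for `y = (a, P)`. Here `P` plays
the part of the linearized flux `B v_x - N v`. -/
def recoverState (N : Matrix (Fin r ⊕ Fin m) (Fin r ⊕ Fin m) ℝ)
    (y : (Fin m → ℂ) × BlockVec ℂ r m) : BlockVec ℂ r m :=
  Sum.elim (-(N.toBlocks₁₁⁻¹.map ((↑) : ℝ → ℂ) *ᵥ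
    (partI y.2 + N.toBlocks₁₂.map ((↑) : ℝ → ℂ) *ᵥ y.1))) y.1

/-- The slope `b` of `v_II` determined by `D b = P_II + (N v)_II`, for `y = (a, P)`. -/
def recoverSlope (N : Matrix (Fin r ⊕ Fin m) (Fin r ⊕ Fin m) ℝ) (D : Matrix (Fin m) (Fin m) ℝ)
    (y : (Fin m → ℂ) × BlockVec ℂ r m) : Fin m → ℂ :=
  D⁻¹.map ((↑) : ℝ → ℂ) *ᵥ (partII y.2 + partII (N.map ((↑) : ℝ → ℂ) *ᵥ recoverState N y))

theorem recoverState_add (N : Matrix (Fin r ⊕ Fin m) (Fin r ⊕ Fin m) ℝ)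
    (y y' : (Fin m → ℂ) × BlockVec ℂ r m) :
    recoverState N (y + y') = recoverState N y + recoverState N y' := by
  have h : partI (y + y').2 + N.toBlocks₁₂.map ((↑) : ℝ → ℂ) *ᵥ (y + y').1 =
      (partI y.2 + N.toBlocks₁₂.map ((↑) : ℝ → ℂ) *ᵥ y.1) +
        (partI y'.2 + N.toBlocks₁₂.map ((↑) : ℝ → ℂ) *ᵥ y'.1) := by
    rw [Prod.fst_add, Matrix.mulVec_add, add_add_add_comm]
    rfl
  ext (i | i)
  · simp only [recoverState, h, Matrix.mulVec_add, Sum.elim_inl, Pi.add_apply, Pi.neg_apply]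
    ring
  · rfl

theorem recoverState_smul (N : Matrix (Fin r ⊕ Fin m) (Fin r ⊕ Fin m) ℝ) (c : ℝ)
    (y : (Fin m → ℂ) × BlockVec ℂ r m) :
    recoverState N (c • y) = c • recoverState N y := by
  have h : partI (c • y).2 + N.toBlocks₁₂.map ((↑) : ℝ → ℂ) *ᵥ (c • y).1 =
      c • (partI y.2 + N.toBlocks₁₂.map ((↑) : ℝ → ℂ) *ᵥ y.1) := by
    rw [Prod.smul_fst, Matrix.mulVec_smul, smul_add]
    rfl
  ext (i | i)
  · simp only [recoverState, h, Matrix.mulVec_smul, Sum.elim_inl, Pi.smul_apply, Pi.neg_apply,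
      smul_neg]
  · rfl

theorem recoverSlope_add (N : Matrix (Fin r ⊕ Fin m) (Fin r ⊕ Fin m) ℝ)
    (D : Matrix (Fin m) (Fin m) ℝ) (y y' : (Fin m → ℂ) × BlockVec ℂ r m) :
    recoverSlope N D (y + y') = recoverSlope N D y + recoverSlope N D y' := by
  simp only [recoverSlope, recoverState_add, Matrix.mulVec_add (N.map _)]
  rw [← Matrix.mulVec_add (D⁻¹.map _), add_add_add_comm]
  rfl

theorem recoverSlope_smul (N : Matrix (Fin r ⊕ Fin m) (Fin r ⊕ Fin m) ℝ)
    (D : Matrix (Fin m) (Fin m) ℝ) (c : ℝ) (y : (Fin m → ℂ) × BlockVec ℂ r m) :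
    recoverSlope N D (c • y) = c • recoverSlope N D y := by
  simp only [recoverSlope, recoverState_smul, Matrix.mulVec_smul (N.map _)]
  rw [← Matrix.mulVec_smul (D⁻¹.map _), smul_add]
  rfl

/-- The right hand side of the resolvent equation `(z - L) v = 0`, written as the first order system
`a' = b`, `P' = z v` for the unknowns `a = v_II` and the flux `P`. -/
def firstOrderOp (N : Matrix (Fin r ⊕ Fin m) (Fin r ⊕ Fin m) ℝ) (D : Matrix (Fin m) (Fin m) ℝ)
    (z : ℂ) :
    ((Fin m → ℂ) × BlockVec ℂ r m) →L[ℝ] ((Fin m → ℂ) × BlockVec ℂ r m) :=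
  LinearMap.toContinuousLinearMap
    { toFun := fun y => (recoverSlope N D y, z • recoverState N y)
      map_add' := fun y y' => by
        refine Prod.ext ?_ ?_
        · exact recoverSlope_add N D y y'
        · simp only [recoverState_add, smul_add, Prod.snd_add]
      map_smul' := fun c y => by
        refine Prod.ext ?_ ?_
        · exact recoverSlope_smul N D c y
        · simp only [recoverState_smul, Prod.smul_snd, RingHom.id_apply]
          exact smul_comm _ _ _ }

/-- The flux of the recovered state is the component `P` of `y = (a, P)`. -/
theorem recover_flux {N : Matrix (Fin r ⊕ Fin m) (Fin r ⊕ Fin m) ℝ} {D : Matrix (Fin m) (Fin m) ℝ}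
    (hN : IsUnit N.toBlocks₁₁.det) (hD : IsUnit D.det) (y : (Fin m → ℂ) × BlockVec ℂ r m)
    {q : BlockVec ℂ r m} (hq : partII q = recoverSlope N D y) :
    (Matrix.fromBlocks 0 0 0 D).map ((↑) : ℝ → ℂ) *ᵥ q -
      N.map ((↑) : ℝ → ℂ) *ᵥ recoverState N y = y.2 := by
  ext (i | i)
  · have h1 : (N.map ((↑) : ℝ → ℂ) *ᵥ recoverState N y) (Sum.inl i) =
        (N.toBlocks₁₁.map ((↑) : ℝ → ℂ) *ᵥ partI (recoverState N y) +
          N.toBlocks₁₂.map ((↑) : ℝ → ℂ) *ᵥ y.1) i := by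
      simp [Matrix.mulVec, dotProduct, Matrix.toBlocks₁₁, Matrix.toBlocks₁₂, partI, recoverState]
    have h2 : partI (recoverState N y) = -(N.toBlocks₁₁⁻¹.map ((↑) : ℝ → ℂ) *ᵥ
      (partI y.2 + N.toBlocks₁₂.map ((↑) : ℝ → ℂ) *ᵥ y.1)) := rfl
    rw [Pi.sub_apply, h1, h2, Matrix.mulVec_neg, map_mulVec_inv_mulVec hN]
    simp [Matrix.mulVec, dotProduct, partI]
  · have h1 : ((Matrix.fromBlocks 0 0 0 D : Matrix (Fin r ⊕ Fin m) (Fin r ⊕ Fin m) ℝ).map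
        ((↑) : ℝ → ℂ) *ᵥ q) (Sum.inr i) = (D.map ((↑) : ℝ → ℂ) *ᵥ partII q) i := by
      simp [Matrix.mulVec, dotProduct, partII]
    rw [Pi.sub_apply, h1, hq, recoverSlope, map_mulVec_inv_mulVec hD]
    simp [partII]

theorem continuous_map_mulVec {X ι κ : Type*} [TopologicalSpace X] [Fintype κ] {M : X → Matrix ι κ ℝ}
    (hM : ∀ i j, Continuous fun x => M x i j) {u : X → κ → ℂ} (hu : Continuous u) :
    Continuous fun x => (M x).map ((↑) : ℝ → ℂ) *ᵥ u x := by
  refine continuous_pi fun i => continuous_finsetSum _ fun j _ => ?_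
  exact (Complex.continuous_ofReal.comp (hM i j)).mul ((continuous_apply j).comp hu)

/-- The coefficients of the first order form of a linearized operator on `[0,1]`: the matrix `N` of
the zeroth order part of the flux, and the viscosity `D`. -/
structure IsRegularPair (N : ℝ → Matrix (Fin r ⊕ Fin m) (Fin r ⊕ Fin m) ℝ)
    (D : ℝ → Matrix (Fin m) (Fin m) ℝ) : Prop where
  contDiffOn : ∀ i j, ContDiffOn ℝ 1 (fun x => N x i j) (Icc 0 1)
  contDiffOn_inv : ∀ i j, ContDiffOn ℝ 1 (fun x => (N x).toBlocks₁₁⁻¹ i j) (Icc 0 1)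
  contDiffOn_visc_inv : ∀ i j, ContDiffOn ℝ 1 (fun x => (D x)⁻¹ i j) (Icc 0 1)
  isUnit_det : ∀ x, IsUnit (N x).toBlocks₁₁.det
  isUnit_det_visc : ∀ x, IsUnit (D x).det

section Regularity

variable {N : ℝ → Matrix (Fin r ⊕ Fin m) (Fin r ⊕ Fin m) ℝ} {D : ℝ → Matrix (Fin m) (Fin m) ℝ}

theorem IsRegularPair.isH1_recoverState (h : IsRegularPair N D)
    {y : ℝ → (Fin m → ℂ) × BlockVec ℂ r m}
    (h1 : ∀ i, IsH1 fun x => (y x).1 i) (h2 : ∀ i, IsH1 fun x => (y x).2 i) (i) :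
    IsH1 fun x => recoverState (N x) (y x) i := by
  rcases i with i | i
  · have h3 : ∀ j, IsH1 fun x => (-(partI (y x).2 +
        (N x).toBlocks₁₂.map ((↑) : ℝ → ℂ) *ᵥ (y x).1)) j := fun j => by
      have := ((h2 (Sum.inl j)).add (isH1_mulVec (M := fun x => (N x).toBlocks₁₂)
        (fun i j => h.contDiffOn (Sum.inl i) (Sum.inr j)) h1 j)).real_mul
          (contDiffOn_const (c := (-1 : ℝ)))
      simpa [partI] using this
    have h4 := isH1_mulVec h.contDiffOn_inv h3 i
    simpa only [recoverState, Sum.elim_inl, Matrix.mulVec_neg] using h4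
  · exact h1 i

theorem IsRegularPair.isH1_recoverSlope (h : IsRegularPair N D)
    {y : ℝ → (Fin m → ℂ) × BlockVec ℂ r m}
    (h1 : ∀ i, IsH1 fun x => (y x).1 i) (h2 : ∀ i, IsH1 fun x => (y x).2 i) (i) :
    IsH1 fun x => recoverSlope (N x) (D x) (y x) i :=
  isH1_mulVec h.contDiffOn_visc_inv (fun j => (h2 (Sum.inr j)).add
    (isH1_mulVec h.contDiffOn (h.isH1_recoverState h1 h2) (Sum.inr j))) i

/-- The operators `firstOrderOp (N x) (D x) z` as a continuous family on `[0,1]`. -/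
def IsRegularPair.opCurve (h : IsRegularPair N D) (z : ℂ) : C(Icc (0 : ℝ) 1,
    ((Fin m → ℂ) × BlockVec ℂ r m) →L[ℝ] ((Fin m → ℂ) × BlockVec ℂ r m)) where
  toFun x := firstOrderOp (N x) (D x) z
  continuous_toFun := by
    have cN : ∀ i j, Continuous fun x : Icc (0 : ℝ) 1 => N x i j := fun i j =>
      (h.contDiffOn i j).continuousOn.domRestrict
    refine continuous_clm_apply.2 fun y => ?_
    have hv : Continuous fun x : Icc (0 : ℝ) 1 => recoverState (N x) y := by
      refine continuous_pi fun i => ?_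
      rcases i with i | i
      · refine ((continuous_apply i).comp (continuous_map_mulVec
          (fun i j => (h.contDiffOn_inv i j).continuousOn.domRestrict)
          (continuous_const.add (continuous_map_mulVec (fun i j => cN (Sum.inl i) (Sum.inr j))
            continuous_const)))).neg
      · exact continuous_const
    refine Continuous.prodMk (continuous_map_mulVec
      (fun i j => (h.contDiffOn_visc_inv i j).continuousOn.domRestrict) ?_) (hv.const_smul z)
    refine continuous_const.add (continuous_pi fun i => ?_)
    exact (continuous_apply (Sum.inr i)).comp (continuous_map_mulVec cN hv)

/-- A solution of the integrated first order system yields `V` in the domain of the operator, with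
flux `P`. -/
theorem IsRegularPair.exists_of_volterra (h : IsRegularPair N D) {z : ℂ}
    {Y k : C(Icc (0 : ℝ) 1, (Fin m → ℂ) × BlockVec ℂ r m)}
    (hY : Y - integrateCurve (applyCurve (h.opCurve z) Y) = k) {F : ℝ → BlockVec ℂ r m}
    (hF : MemLp F 2 unitMeasure) {P₀ : BlockVec ℂ r m}
    (hk : ∀ x : Icc (0 : ℝ) 1, k x = (0, P₀ - ∫ t in (0 : ℝ)..x, F t)) :
    ∃ (v v' : ℝ → BlockVec ℂ r m) (w : ℝ → Fin m → ℂ),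
      (∀ x : Icc (0 : ℝ) 1, v x = recoverState (N x) (Y x)) ∧
      (∀ x : Icc (0 : ℝ) 1, partII (v' x) = recoverSlope (N x) (D x) (Y x)) ∧
      HasH1Deriv v v' ∧ HasH1Deriv (fun x => partII (v' x)) w ∧
      HasH1Deriv (fun x => (Matrix.fromBlocks 0 0 0 (D x)).map ((↑) : ℝ → ℂ) *ᵥ v' x -
        (N x).map ((↑) : ℝ → ℂ) *ᵥ v x) (fun x => z • v x - F x) := by
  set y : ℝ → (Fin m → ℂ) × BlockVec ℂ r m := extendCurve Y with hy
  set q : ℝ → (Fin m → ℂ) × BlockVec ℂ r m := extendCurve (applyCurve (h.opCurve z) Y) with hq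
  have hyc : Continuous y := continuous_extendCurve _
  have hqc : Continuous q := continuous_extendCurve _
  have hqy : ∀ x ∈ Icc (0 : ℝ) 1, q x =
      (recoverSlope (N x) (D x) (y x), z • recoverState (N x) (y x)) := by
    intro x hx
    have e1 : q x = applyCurve (h.opCurve z) Y ⟨x, hx⟩ := extendCurve_coe _ ⟨x, hx⟩
    have e2 : y x = Y ⟨x, hx⟩ := extendCurve_coe _ ⟨x, hx⟩
    rw [e1, e2]
    rfl
  have hint : ∀ x ∈ Icc (0 : ℝ) 1, y x =
      (∫ t in (0 : ℝ)..x, q t) + (0, P₀ - ∫ t in (0 : ℝ)..x, F t) := by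
    intro x hx
    have e1 := DFunLike.congr_fun hY ⟨x, hx⟩
    rw [hk, ContinuousMap.sub_apply, integrateCurve_apply] at e1
    have e2 : y x = Y ⟨x, hx⟩ := extendCurve_coe _ ⟨x, hx⟩
    rw [e2]
    exact sub_eq_iff_eq_add'.1 e1
  have hy0 : y 0 = (0, P₀) := by
    have := hint 0 (by simp)
    simpa using this
  have hqi : ∀ x : ℝ, IntervalIntegrable q volume 0 x := fun x => hqc.intervalIntegrable _ _
  have hfst : ∀ x : ℝ, (∫ t in (0 : ℝ)..x, q t).1 = ∫ t in (0 : ℝ)..x, (q t).1 := fun x =>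
    ((ContinuousLinearMap.fst ℝ (Fin m → ℂ) (BlockVec ℂ r m)).intervalIntegral_comp_comm (hqi x)).symm
  have hsnd : ∀ x : ℝ, (∫ t in (0 : ℝ)..x, q t).2 = ∫ t in (0 : ℝ)..x, (q t).2 := fun x =>
    ((ContinuousLinearMap.snd ℝ (Fin m → ℂ) (BlockVec ℂ r m)).intervalIntegral_comp_comm (hqi x)).symm
  have hFi : IntervalIntegrable F volume 0 1 :=
    intervalIntegrable_iff_integrable_unitMeasure.2 (hF.integrable (by norm_num))
  -- the component `a` of the unknown
  have ha : HasH1Deriv (fun x => (y x).1) (fun x => (q x).1) := by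
    refine ⟨memLp_of_continuousOn hqc.fst.continuousOn, fun x hx => ?_⟩
    simp only [hint x hx, hy0, Prod.fst_add, hfst]
    abel
  -- the component `P` of the unknown
  have hP : HasH1Deriv (fun x => (y x).2) (fun x => (q x).2 - F x) := by
    refine ⟨(memLp_of_continuousOn hqc.snd.continuousOn).sub hF, fun x hx => ?_⟩
    simp only [hint x hx, hy0, Prod.snd_add, hsnd]
    rw [intervalIntegral.integral_sub
      (hqc.snd.intervalIntegrable _ _) (hFi.mono_set (by
        rw [uIcc_of_le hx.1, uIcc_of_le zero_le_one]; exact Icc_subset_Icc_right hx.2))]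
    abel
  have hv1 := h.isH1_recoverState (y := y) ha.isH1 hP.isH1
  obtain ⟨u', hu'⟩ := exists_hasH1Deriv hv1
  obtain ⟨w, hw⟩ := exists_hasH1Deriv (h.isH1_recoverSlope (y := y) ha.isH1 hP.isH1)
  refine ⟨fun x => recoverState (N x) (y x),
    fun x => Sum.elim (partI (u' x)) (recoverSlope (N x) (D x) (y x)), w, fun x => ?_, fun x => ?_,
    ?_, hw, ?_⟩
  · simp only [hy, extendCurve_coe]
  · simp only [hy, extendCurve_coe]
    rfl
  · rw [hasH1Deriv_iff] at hu' ha ⊢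
    rintro (i | i)
    · exact hu' (Sum.inl i)
    · have hb : ∀ x ∈ Icc (0 : ℝ) 1, (q x).1 i = recoverSlope (N x) (D x) (y x) i := fun x hx => by
        rw [hqy x hx]
      refine ⟨(memLp_congr_ae (ae_unitMeasure_of_forall hb)).1 (ha i).1, ?_⟩
      have h3 := hw.isPrimitive.continuousOn
      refine ⟨ContinuousOn.intervalIntegrable ?_, fun x hx => ?_⟩
      · rw [uIcc_of_le zero_le_one]
        exact (continuous_apply i).comp_continuousOn h3
      · refine ((ha i).2.2 x hx).trans ?_
        refine congrArg _ (intervalIntegral.integral_congr fun t ht => hb t ?_)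
        rw [uIcc_of_le hx.1] at ht
        exact ⟨ht.1, ht.2.trans hx.2⟩
  · have hPeq : ∀ x, (Matrix.fromBlocks 0 0 0 (D x)).map ((↑) : ℝ → ℂ) *ᵥ
        (Sum.elim (partI (u' x)) (recoverSlope (N x) (D x) (y x)) : BlockVec ℂ r m) -
        (N x).map ((↑) : ℝ → ℂ) *ᵥ recoverState (N x) (y x) = (y x).2 := fun x =>
      recover_flux (h.isUnit_det x) (h.isUnit_det_visc x) (y x) rfl
    simp only [hPeq]
    have he : ∀ x ∈ Icc (0 : ℝ) 1, (q x).2 - F x = z • recoverState (N x) (y x) - F x :=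
      fun x hx => by rw [hqy x hx]
    refine ⟨(memLp_congr_ae (ae_unitMeasure_of_forall he)).1 hP.1, fun x hx => ?_⟩
    refine (hP.2 x hx).trans ?_
    refine congrArg _ (intervalIntegral.integral_congr fun t ht => he t ?_)
    rw [uIcc_of_le hx.1] at ht
    exact ⟨ht.1, ht.2.trans hx.2⟩

end Regularity

end ViscousSystem

/-! ### Solvability of the resolvent equation -/

namespace ViscousSystem

variable {r m : ℕ} {s : ViscousSystem r m}

theorem fluxMatrix_inl (s : ViscousSystem r m) (U ξ : BlockVec ℝ r m) (i : Fin r) (k) :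
    s.fluxMatrix U ξ (Sum.inl i) k = s.A U (Sum.inl i) k := by
  have h : ∀ j, (fun U' => s.B U' (Sum.inl i) j) = fun _ => (0 : ℝ) := by
    rintro (j | j) <;> rfl
  simp [fluxMatrix, h]

theorem toBlocks₁₁_fluxMatrix (s : ViscousSystem r m) (U ξ : BlockVec ℝ r m) :
    (s.fluxMatrix U ξ).toBlocks₁₁ = (s.A U).toBlocks₁₁ := by
  ext i j
  exact s.fluxMatrix_inl U ξ i (Sum.inl j)

theorem contDiffOn_fluxMatrix (h0 : s.H0) {W : ℝ → BlockVec ℝ r m}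
    (hW : ContDiffOn ℝ 2 W (Icc 0 1)) (i k) :
    ContDiffOn ℝ 1 (fun x => s.fluxMatrix (W x) (dx W x) i k) (Icc 0 1) := by
  have hW1 : ContDiffOn ℝ 1 W (Icc 0 1) := hW.of_le (by norm_num)
  have hdx : ContDiffOn ℝ 1 (dx W) (Icc 0 1) :=
    hW.derivWithin (uniqueDiffOn_Icc zero_lt_one) (by norm_num)
  have hA : ContDiff ℝ 1 fun U => s.A U i k := (h0.contDiff_A i k).of_le (by exact_mod_cast le_top)
  have hB : ∀ j, ContDiff ℝ 1 fun U =>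
      fderiv ℝ (fun U' => s.B U' i j) U (Pi.single k 1) := fun j =>
    ((h0.contDiff_B i j).fderiv_right (m := 1)
      (by rw [one_add_one_eq_two]; exact WithTop.coe_le_coe.2 le_top)).clm_apply contDiff_const
  refine (hA.comp_contDiffOn hW1).sub (ContDiffOn.sum fun j _ => ?_)
  exact ((hB j).comp_contDiffOn hW1).mul (contDiffOn_pi.1 hdx j)

/-- The linearized operator about a `C²` curve has regular coefficients. -/
theorem isRegularPair (h0 : s.H0) (h1 : s.H1) (h2 : s.H2) {W : ℝ → BlockVec ℝ r m}
    (hW : ContDiffOn ℝ 2 W (Icc 0 1)) :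
    IsRegularPair (fun x => s.fluxMatrix (W x) (dx W x)) (fun x => s.B₂₂ (W x)) where
  contDiffOn := contDiffOn_fluxMatrix h0 hW
  contDiffOn_inv i j := by
    simp only [toBlocks₁₁_fluxMatrix]
    have h := ContDiff.matrix_inv (k := 1) (M := fun U => (s.A U).toBlocks₁₁)
      (fun i j => (h0.contDiff_A (Sum.inl i) (Sum.inl j)).of_le (by exact_mod_cast le_top))
      (fun U => h2.isUnit_det U) i j
    exact h.comp_contDiffOn (hW.of_le (by norm_num))
  contDiffOn_visc_inv i j := by
    have h := ContDiff.matrix_inv (k := 1) (M := fun U => s.B₂₂ U)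
      (fun i j => (h0.2 i j).of_le (by exact_mod_cast le_top)) (fun U => h1.isUnit_det U) i j
    exact h.comp_contDiffOn (hW.of_le (by norm_num))
  isUnit_det x := by
    rw [toBlocks₁₁_fluxMatrix]
    exact h2.isUnit_det _
  isUnit_det_visc x := h1.isUnit_det _

/-- The constant curve `(0, (0, p))`, the initial data of the first order system. -/
def initialCurve (r : ℕ) {m : ℕ} (p : Fin m → ℂ) :
    C(Icc (0 : ℝ) 1, (Fin m → ℂ) × BlockVec ℂ r m) :=
  ContinuousMap.const _ (0, Sum.elim 0 p)

/-- The curve `x ↦ (0, ∫₀ˣ F)`. -/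
def sourceCurve (F : L2 r m) : C(Icc (0 : ℝ) 1, (Fin m → ℂ) × BlockVec ℂ r m) where
  toFun x := (0, ∫ t in (0 : ℝ)..x, F t)
  continuous_toFun := by
    have h : IntervalIntegrable F volume 0 1 := intervalIntegrable_iff_integrable_unitMeasure.2
      ((Lp.memLp F).integrable (by norm_num))
    have h1 := intervalIntegral.continuousOn_primitive_interval'
      (μ := volume) (b₁ := 0) (b₂ := 1) (a := 0) h (by simp)
    rw [uIcc_of_le zero_le_one] at h1
    exact continuous_const.prodMk h1.domRestrict

/-- The solution of the first order system with flux `(0, p)` at `x = 0` gives an element of the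
graph as soon as its component `a` vanishes at `x = 1`. -/
theorem exists_mem_linearizedGraph_of_right_bc {W : ℝ → BlockVec ℝ r m}
    (h : IsRegularPair (fun x => s.fluxMatrix (W x) (dx W x)) (fun x => s.B₂₂ (W x))) {z : ℂ}
    (F : L2 r m) (p : Fin m → ℂ) {Y : C(Icc (0 : ℝ) 1, (Fin m → ℂ) × BlockVec ℂ r m)}
    (hY : volterraEquiv (h.opCurve z) Y = initialCurve r p - sourceCurve F) (hY1 : (Y 1).1 = 0) :
    ∃ (V : L2 r m) (v v' : ℝ → BlockVec ℂ r m) (w : ℝ → Fin m → ℂ),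
      V =ᵐ[unitMeasure] v ∧ (V, z • V - F) ∈ s.linearizedGraph W ∧
      HasH1Deriv v v' ∧ HasH1Deriv (fun x => partII (v' x)) w ∧
      (∀ x : Icc (0 : ℝ) 1, partII (v x) = (Y x).1) ∧
      (s.B₂₂ (W 0)).map ((↑) : ℝ → ℂ) *ᵥ partII (v' 0) = p := by
  obtain ⟨v, v', w, hv, hv', hvd, hw, hflux⟩ := h.exists_of_volterra (F := F) (Y := Y)
    (P₀ := Sum.elim 0 p) ((volterraEquiv_apply _ _).symm.trans hY) (Lp.memLp F) (fun x => by
      refine Prod.ext ?_ rfl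
      exact sub_zero _)
  have hY0 : Y 0 = (0, (Sum.elim 0 p : BlockVec ℂ r m)) := by
    have := DFunLike.congr_fun hY 0
    rw [volterraEquiv_apply, ContinuousMap.sub_apply, integrateCurve_apply] at this
    simpa [initialCurve, sourceCurve] using this
  have hs0 : recoverState (s.fluxMatrix (W 0) (dx W 0)) (0, (Sum.elim 0 p : BlockVec ℂ r m)) = 0 := by
    have h1 : partI (Sum.elim 0 p : BlockVec ℂ r m) = 0 := rfl
    ext (i | i)
    · simp [recoverState, h1]
    · rfl
  have hv0 : v 0 = 0 := by
    have := hv 0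
    rw [hY0] at this
    exact this.trans hs0
  have hII : ∀ x : Icc (0 : ℝ) 1, partII (v x) = (Y x).1 := fun x => by rw [hv x]; rfl
  have hvL : MemLp v 2 unitMeasure := memLp_of_continuousOn hvd.isPrimitive.continuousOn
  refine ⟨hvL.toLp v, v, v', w, hvL.coeFn_toLp, ⟨v, v', fun x => z • v x - F x, w,
    hvL.coeFn_toLp, ?_, hvd, hw, hv0, (hII 1).trans hY1, ?_⟩, hvd, hw, hII, ?_⟩
  · filter_upwards [Lp.coeFn_sub (z • hvL.toLp v) F, Lp.coeFn_smul z (hvL.toLp v),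
      hvL.coeFn_toLp] with x e1 e2 e3
    rw [e1, Pi.sub_apply, e2, Pi.smul_apply, e3]
  · refine hflux.congr fun x _ => ?_
    exact s.linearizedFlux_eq W v v' x
  · have h1 : partII (v' 0) = recoverSlope (s.fluxMatrix (W 0) (dx W 0)) (s.B₂₂ (W 0)) (Y 0) := hv' 0
    change (s.B₂₂ (W 0)).map ((↑) : ℝ → ℂ) *ᵥ partII (v' 0) = p
    rw [h1, hY0, recoverSlope, hs0, map_mulVec_inv_mulVec (h.isUnit_det_visc 0), Matrix.mulVec_zero]
    ext i
    simp [partII]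

/-- If `z` is not an eigenvalue, then `(z - L) V = F` is solvable for every `F`: by linear shooting
in the initial flux of `V_II`, a problem in finite dimension. -/
theorem exists_mem_linearizedGraph (h0 : s.H0) (h1 : s.H1) (h2 : s.H2) {W : ℝ → BlockVec ℝ r m}
    (hW : ContDiffOn ℝ 2 W (Icc 0 1)) {z : ℂ}
    (hinj : ∀ V G : L2 r m, (V, G) ∈ s.linearizedGraph W → z • V - G = 0 → V = 0) (F : L2 r m) :
    ∃ V, (V, z • V - F) ∈ s.linearizedGraph W := by
  have h := isRegularPair h0 h1 h2 hW
  set E := volterraEquiv (h.opCurve z) with hE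
  let T : (Fin m → ℂ) →ₗ[ℝ] (Fin m → ℂ) :=
    { toFun := fun p => (E.symm (initialCurve r p) 1).1
      map_add' := fun p q => by
        have : initialCurve r (p + q) = initialCurve r p + initialCurve r q := by
          ext x (i | i) <;> simp [initialCurve]
        rw [this, map_add]
        rfl
      map_smul' := fun c p => by
        have : initialCurve r (c • p) = c • initialCurve r p := by
          ext x (i | i) <;> simp [initialCurve]
        rw [this, map_smul]
        rfl }
  have hT : Function.Injective T := by
    refine (injective_iff_map_eq_zero T).2 fun p hp => ?_
    have hz : sourceCurve (0 : L2 r m) = 0 := by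
      ext x : 1
      refine Prod.ext rfl ?_
      change ∫ t in (0 : ℝ)..x, (0 : L2 r m) t = 0
      rw [intervalIntegral.integral_of_le x.2.1, integral_Ioc_eq_integral_Ioo]
      refine integral_eq_zero_of_ae ?_
      refine ae_restrict_of_ae_restrict_of_subset (Ioo_subset_Ioo_right x.2.2) ?_
      exact Lp.coeFn_zero _ _ _
    obtain ⟨V, v, v', w, hVv, hmem, hvd, hw, hII, hp0⟩ :=
      exists_mem_linearizedGraph_of_right_bc h (z := z) 0 p (Y := E.symm (initialCurve r p))
        (by rw [hz, sub_zero]; exact E.apply_symm_apply _) hp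
    have hV : V = 0 := hinj V _ hmem (by simp)
    have hv : v =ᵐ[unitMeasure] 0 := by
      rw [hV] at hVv
      exact hVv.symm.trans (Lp.coeFn_zero _ _ _)
    -- uniqueness forces `v = 0`, hence `v_II'(0) = 0`, which determines the initial flux
    have hv0 : EqOn v 0 (Icc 0 1) := by
      refine Measure.eqOn_Icc_of_ae_eq volume zero_ne_one ?_ hvd.isPrimitive.continuousOn
        continuousOn_const
      rwa [← Measure.restrict_congr_set Ioo_ae_eq_Icc]
    have hII' : IsPrimitive (fun x => partII (v x)) (fun x => partII (v' x)) :=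
      IsPrimitive.pi_iff.2 fun i => IsPrimitive.pi_iff.1 hvd.isPrimitive (Sum.inr i)
    have hd := hII'.hasDerivWithinAt hw.isPrimitive.continuousOn (left_mem_Icc.2 zero_le_one)
    have hd0 : HasDerivWithinAt (fun x => partII (v x)) 0 (Icc 0 1) 0 := by
      refine (hasDerivWithinAt_const (0 : ℝ) (Icc 0 1) (0 : Fin m → ℂ)).congr
        (fun x hx => ?_) ?_
      · rw [hv0 hx]; rfl
      · rw [hv0 (left_mem_Icc.2 zero_le_one)]; rfl
    have heq := (uniqueDiffOn_Icc zero_lt_one 0 (left_mem_Icc.2 zero_le_one)).eq_deriv _ hd hd0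
    rw [← hp0, heq, Matrix.mulVec_zero]
  obtain ⟨p, hp⟩ := (LinearMap.injective_iff_surjective.1 hT) (E.symm (sourceCurve F) 1).1
  obtain ⟨V, -, -, -, -, hmem, -⟩ :=
    exists_mem_linearizedGraph_of_right_bc h (z := z) F p
      (Y := E.symm (initialCurve r p - sourceCurve F)) (E.apply_symm_apply _) (by
        rw [map_sub]
        exact sub_eq_zero.2 hp)
  exact ⟨V, hmem⟩

end ViscousSystem

/-! ### Spectral stability -/

/-- A linear graph `T` for which `z - L` is bounded below and surjective has `z` in its resolvent
set. -/
theorem mem_graphResolventSet {X : Type} [NormedAddCommGroup X] [NormedSpace ℂ X] {T : Set (X × X)}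
    (hadd : ∀ p ∈ T, ∀ q ∈ T, p + q ∈ T) (hsmul : ∀ c : ℂ, ∀ p ∈ T, c • p ∈ T) {z : ℂ} {K : ℝ}
    (hbound : ∀ V G, (V, G) ∈ T → ‖V‖ ≤ K * ‖z • V - G‖)
    (hex : ∀ F, ∃ V, (V, z • V - F) ∈ T) : z ∈ graphResolventSet T := by
  choose R hR using hex
  have huniq : ∀ V G, (V, G) ∈ T → ∀ V' G', (V', G') ∈ T → z • V - G = z • V' - G' → V = V' := by
    intro V G h V' G' h' heq
    have h1 := hbound (V + (-1 : ℂ) • V') (G + (-1 : ℂ) • G') (hadd _ h _ (hsmul (-1) _ h'))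
    have h2 : z • (V + (-1 : ℂ) • V') - (G + (-1 : ℂ) • G') = 0 := by
      rw [← sub_eq_zero.2 heq]
      module
    rw [h2, norm_zero, mul_zero] at h1
    have h3 := norm_le_zero_iff.1 h1
    rw [neg_one_smul] at h3
    exact eq_of_sub_eq_zero ((sub_eq_add_neg V V').trans h3)
  let R' : X →ₗ[ℂ] X :=
    { toFun := R
      map_add' := fun F F' => by
        refine huniq _ _ (hR _) _ _ (hadd _ (hR F) _ (hR F')) ?_
        simp only
        module
      map_smul' := fun c F => by
        refine huniq _ _ (hR _) _ _ (hsmul c _ (hR F)) ?_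
        simp only [RingHom.id_apply]
        module }
  refine ⟨R'.mkContinuous K fun F => ?_, fun F => hR F, fun V G h => ?_⟩
  · have := hbound _ _ (hR F)
    rwa [sub_sub_cancel] at this
  · refine huniq _ _ (hR _) _ _ h ?_
    rw [sub_sub_cancel]

namespace ViscousSystem

variable {r m : ℕ} {s : ViscousSystem r m}

theorem add_mem_linearizedGraph {W : ℝ → BlockVec ℝ r m} {p q : L2 r m × L2 r m}
    (hp : p ∈ s.linearizedGraph W) (hq : q ∈ s.linearizedGraph W) :
    p + q ∈ s.linearizedGraph W := by
  obtain ⟨v, v', g, w, a1, a2, a3, a4, a5, a6, a7⟩ := hp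
  obtain ⟨u, u', k, l, b1, b2, b3, b4, b5, b6, b7⟩ := hq
  refine ⟨fun x => v x + u x, fun x => v' x + u' x, fun x => g x + k x, fun x => w x + l x,
    (Lp.coeFn_add _ _).trans (a1.add b1), (Lp.coeFn_add _ _).trans (a2.add b2), a3.add b3,
    a4.add b4, ?_, ?_, (a7.add b7).congr fun x _ => ?_⟩
  · simp only [a5, b5, add_zero]
  · have : partII (v 1 + u 1) = partII (v 1) + partII (u 1) := rfl
    rw [this, a6, b6, add_zero]
  · simp only [linearizedFlux_eq, Matrix.mulVec_add]
    abel

theorem smul_mem_linearizedGraph {W : ℝ → BlockVec ℝ r m} (c : ℂ) {p : L2 r m × L2 r m}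
    (hp : p ∈ s.linearizedGraph W) : c • p ∈ s.linearizedGraph W := by
  obtain ⟨v, v', g, w, a1, a2, a3, a4, a5, a6, a7⟩ := hp
  refine ⟨fun x => c • v x, fun x => c • v' x, fun x => c • g x, fun x => c • w x,
    (Lp.coeFn_smul _ _).trans (a1.const_smul c), (Lp.coeFn_smul _ _).trans (a2.const_smul c),
    a3.const_smul c, a4.const_smul c, ?_, ?_, (a7.const_smul c).congr fun x _ => ?_⟩
  · simp only [a5, smul_zero]
  · have : partII (c • v 1) = c • partII (v 1) := rfl
    rw [this, a6, smul_zero]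
  · simp only [linearizedFlux_eq, Matrix.mulVec_smul, smul_sub]

/-- Curves that are `C¹`-close to a constant are spectrally stable. -/
theorem exists_isSpectrallyStable (h0 : s.H0) (h1 : s.H1) (h2 : s.H2) (h3 : s.H3)
    (U₀ : BlockVec ℝ r m) :
    ∃ ρ : ℝ, 0 < ρ ∧ ∀ W : ℝ → BlockVec ℝ r m, ContDiffOn ℝ 2 W (Icc 0 1) →
      (∀ x ∈ Icc (0 : ℝ) 1, ‖W x - U₀‖ ≤ ρ) → (∀ x ∈ Icc (0 : ℝ) 1, ‖dx W x‖ ≤ ρ) →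
      s.IsSpectrallyStable W := by
  obtain ⟨S, hS⟩ := exists_isSymmetrizer h2 h3
  obtain ⟨ρ, hρ, h⟩ := hS.exists_resolvent_estimate h0 U₀
  refine ⟨ρ, hρ, fun W hW hWU hWx z hz => ?_⟩
  obtain ⟨K, hK⟩ := h W (hW.of_le (by norm_num)) hWU hWx
  by_contra! hre
  refine hz (mem_graphResolventSet (fun p hp q hq => add_mem_linearizedGraph hp hq)
    (fun c p hp => smul_mem_linearizedGraph c hp) (hK z hre)
    (exists_mem_linearizedGraph h0 h1 h2 hW fun V G hVG hF => ?_))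
  have := hK z hre V G hVG
  rw [hF, norm_zero, mul_zero] at this
  exact norm_le_zero_iff.1 this

/-! ### Steady solutions -/

theorem Φ_eq (h0 : s.H0) (h1 : s.H1) (h2 : s.H2) {U₀ : BlockVec ℝ r m} {U₁ C : Fin m → ℝ}
    {W : ℝ → BlockVec ℝ r m} (hW : s.IsProfile U₀ C W) : s.Φ U₀ U₁ C = partII (W 1) - U₁ := by
  have h : ∃ W, s.IsProfile U₀ C W := ⟨W, hW⟩
  rw [Φ, dif_pos h, h.choose_spec.eqOn h0 h1 h2 hW (right_mem_Icc.2 zero_le_one)]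

end ViscousSystem

end

theorem theorem9p4 {r m : ℕ} (s : ViscousSystem r m) (h0 : s.H0) (h1 : s.H1) (h2 : s.H2) (h3 : s.H3)
    (U₀ : BlockVec ℝ r m) :
    ∃ ε₀ > (0 : ℝ), ∀ ε : ℝ, 0 < ε → ε ≤ ε₀ → ∃ δ > (0 : ℝ),
      ∀ U₁ : Fin m → ℝ, ‖U₁ - partII U₀‖ ≤ δ →
        ∃ W : ℝ → BlockVec ℝ r m,
          s.IsSteadySolution U₀ U₁ W ∧
          (∀ x ∈ Icc (0 : ℝ) 1, ‖ViscousSystem.dx W x‖ ≤ ε) ∧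
          (∀ W' : ℝ → BlockVec ℝ r m, s.IsSteadySolution U₀ U₁ W' →
            ‖partII (ViscousSystem.dx W' 0)‖ ≤ ε₀ → EqOn W' W (Icc 0 1)) ∧
          s.IsNondegenerate U₀ U₁ W ∧
          s.IsSpectrallyStable W := by
  obtain ⟨ρ, w, hρ, hw, hinj, hder, hsurj, hsmall⟩ := ViscousSystem.exists_shooting h0 h1 h2 h3 U₀
  obtain ⟨σ, hσ, hstab⟩ := ViscousSystem.exists_isSpectrallyStable h0 h1 h2 h3 U₀
  refine ⟨ρ / 2, by positivity, fun ε hε _ => ?_⟩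
  obtain ⟨τ, hτ, hwτ⟩ := hsmall (min ε σ) (lt_min hε hσ)
  obtain ⟨δ, hδ, hC⟩ := hsurj (min τ ρ) (lt_min hτ hρ)
  refine ⟨δ, hδ, fun U₁ hU₁ => ?_⟩
  obtain ⟨C, hCτ, hC1⟩ := hC U₁ hU₁
  obtain ⟨hCτ, hCρ⟩ := lt_min_iff.1 hCτ
  have hP := hw C hCρ
  have hC0 : partII (ViscousSystem.dx (w C) 0) = C := hP.partII_dx_zero h0 h1 h2
  have hnear := hwτ C hCτ
  refine ⟨w C, hP.isSteadySolution h0 h1 h2 hC1,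
    fun x hx => (hnear x hx).2.trans (min_le_left _ _), fun W' hW' hsm => ?_, ?_,
    hstab _ (hP.contDiffOn h0 h1 h2) (fun x hx => (hnear x hx).1.trans (min_le_right _ _))
      fun x hx => (hnear x hx).2.trans (min_le_right _ _)⟩
  · -- a second solution is the profile of a parameter in the ball where the shooting map is injective
    set C' := partII (ViscousSystem.dx W' 0)
    have hC'ρ : ‖C'‖ < ρ := by linarith
    have heq := (hW'.isProfile h0).eqOn h0 h1 h2 (hw C' hC'ρ)
    have hCC : C' = C := by
      refine hinj (mem_ball_zero_iff.2 hC'ρ) (mem_ball_zero_iff.2 hCρ) ?_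
      simp only
      rw [hC1, ← heq (right_mem_Icc.2 zero_le_one), hW'.right_bc]
    rwa [hCC] at heq
  · have hev : ∀ᶠ C' in 𝓝 C, ‖C'‖ < ρ := continuous_norm.continuousAt.eventually (gt_mem_nhds hCρ)
    have hΦ : ∀ C', ‖C'‖ < ρ → s.Φ U₀ U₁ C' = partII (w C' 1) - U₁ := fun C' hC' =>
      ViscousSystem.Φ_eq h0 h1 h2 (hw C' hC')
    obtain ⟨L, hL⟩ := hder C hCρ
    rw [ViscousSystem.IsNondegenerate, hC0]
    refine ⟨hev.mono fun C' hC' => ⟨_, hw C' hC'⟩, by rw [hΦ C hCρ, hC1, sub_self], L, ?_⟩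
    exact (hL.sub_const U₁).congr_of_eventuallyEq (hev.mono hΦ)
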